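/- Let $\mathcal{A}$ be an essentially small additive category and $K$ a (commutative) field. Write $\mathcal{F}(\mathcal{C};K)$ for the category of functors from a category $\mathcal{C}$ to $K$-vector spaces and $\mathcal{F}^{df}(\mathcal{C};K)$ for the full subcategory of functors with finite-dimensional values. Tensor products of functors are over $K$ and computed pointwise. Definitions. A functor $F$ in $\mathcal{F}(\mathcal{A};K)$ is *polynomial* if there is $d\in\mathbb{N}$ such that all maps $f:\mathcal{A}(x,y)\to \mathrm{Hom}_K(F(x),F(y))$ induced by $F$ are polynomial of degree at most $d$, i.e. $\sum_{J\subseteq\{1,\dots,d+1\}}(-1)^{d+1-|J|}f\big(\sum_{j\in J}u_j\big)=0$ for all $u_1,\dots,u_{d+1}\in\mathcal{A}(x,y)$. An ideal $\mathcal{I}$ of $\mathcal{A}$ (subgroups $\mathcal{I}(x,y)\subseteq\mathcal{A}(x,y)$ stable under composition on both sides) is *$K$-cotrivial* if, for all $x,y$, the group $\mathcal{A}(x,y)/\mathcal{I}(x,y)$ is finite and $K\otimes_{\mathbb{Z}}\big(\mathcal{A}(x,y)/\mathcal{I}(x,y)\big)=0$. A functor in $\mathcal{F}(\mathcal{A};K)$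 is *antipolynomial* if it is isomorphic to a functor factoring through the canonical functor $\mathcal{A}\to\mathcal{A}/\mathcal{I}$ for some $K$-cotrivial ideal $\mathcal{I}$. A simple functor $S$ is *absolutely simple* if the canonical map $K\to\mathrm{End}(S)$ is an isomorphism, and $K$ is a *non-additive splitting field* of a category $\mathcal{C}$ if every simple functor of $\mathcal{F}^{df}(\mathcal{C};K)$ is absolutely simple. 1. A functor $F$ of $\mathcal{F}^{df}(\mathcal{A};K)$ is simple if and only if it is isomorphic to the composite of the diagonal $\mathcal{A}\to\mathcal{A}\times\mathcal{A}$ with a simple bifunctor $B$ of $\mathcal{F}^{df}(\mathcal{A}\times\mathcal{A};K)$ which is antipolynomial in the first variable (every $B(-,x)$ is antipolynomial) and polynomial in the second (every $B(x,-)$ is polynomial). Moreover, $B$ is determined by $F$ up to isomorphism. 2. If $K$ contains all roots of unity (that is, $X^n-1$ splits over $K$ for every $n\geq 1$), then $K$ is a non-additive splitting field of $\mathcal{A}/\mathcal{I}$ for every $K$-cotrivial ideal $\mathcal{I}$ of $\mathcal{A}$. 3. Suppose that $K$ is a non-additive splitting field of $\mathcal{A}/\mathcal{I}$ for every $K$-cotrivial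 ideal $\mathcal{I}$ of $\mathcal{A}$. Then a functor $F$ of $\mathcal{F}^{df}(\mathcal{A};K)$ is simple if and only if $F\simeq S\otimes T$ with $S$ a simple polynomial functor of $\mathcal{F}^{df}(\mathcal{A};K)$ and $T$ a simple antipolynomial functor of $\mathcal{F}(\mathcal{A};K)$. Moreover this decomposition is unique up to isomorphism: if $S\otimes T\simeq S'\otimes T'$ with $S,S'$ and $T,T'$ of these two kinds, then $S\simeq S'$ and $T\simeq T'$. -/

import Mathlib

open CategoryTheory CategoryTheory.Limits
open scoped MonoidalCategory TensorProduct

universe u v w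

namespace TensorDecomposition

/-- The functor takes finite-dimensional values. -/
def FiniteDimValued {C : Type u} [Category.{v} C] {K : Type w} [Field K]
    (F : C ⥤ ModuleCat.{w} K) : Prop :=
  ∀ x : C, FiniteDimensional K (F.obj x)

/-! ### Polynomial functions and polynomial functors -/

/-- The `d`-th deviation of a function between abelian groups:
`δ_d(f)(u_1, …, u_d) = ∑_{I ⊆ {1, …, d}} (-1)^{d - |I|} f(∑_{i ∈ I} u_i)`. -/
def deviation {U V : Type*} [AddCommGroup U] [AddCommGroup V] (d : ℕ) (f : U → V)
    (a : Fin d → U) : V :=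
  ∑ I : Finset (Fin d), ((-1 : ℤ) ^ (d - I.card)) • f (∑ i ∈ I, a i)

/-- `f` is polynomial of degree at most `d`: its `(d+1)`-st deviation vanishes. -/
def IsPolynomialOfDegreeLE {U V : Type*} [AddCommGroup U] [AddCommGroup V] (d : ℕ)
    (f : U → V) : Prop :=
  ∀ a : Fin (d + 1) → U, deviation (d + 1) f a = 0

/-- A functor on an additive category is polynomial (in the sense of Eilenberg and Mac Lane) if,
for some `d`, all the functions it induces on morphism groups are polynomial of degree at
most `d`. -/
def IsPolynomial {A : Type u} [Category.{v} A] [Preadditive A] {K : Type w} [Field K]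
    (F : A ⥤ ModuleCat.{w} K) : Prop :=
  ∃ d : ℕ, ∀ x y : A,
    IsPolynomialOfDegreeLE d (fun f : x ⟶ y => (F.map f : F.obj x ⟶ F.obj y))

/-! ### Ideals of an additive category and antipolynomial functors -/

/-- An ideal of a preadditive category: subgroups of the morphism groups, stable under composition
on both sides with arbitrary morphisms. -/
structure CatIdeal (A : Type u) [Category.{v} A] [Preadditive A] where
  /-- The subgroup of morphisms from `x` to `y` belonging to the ideal. -/
  hom : ∀ x y : A, AddSubgroup (x ⟶ y)
  comp_mem_right : ∀ {x y z : A} {f : x ⟶ y} (g : y ⟶ z), f ∈ hom x y → f ≫ g ∈ hom x z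
  comp_mem_left : ∀ {x y z : A} (f : x ⟶ y) {g : y ⟶ z}, g ∈ hom y z → f ≫ g ∈ hom x z

namespace CatIdeal

variable {A : Type u} [Category.{v} A] [Preadditive A] (I : CatIdeal A)

/-- Congruence modulo the ideal. -/
def rel : HomRel A := fun x y f g => f - g ∈ I.hom x y

instance congruence_rel : Congruence I.rel where
  comp_left f g g' h := by
    have := I.comp_mem_left f h
    rwa [Preadditive.comp_sub] at this
  comp_right g h := by
    have := I.comp_mem_right g h
    rwa [Preadditive.sub_comp] at this
  equivalence :=
    { refl := fun f => by simp [rel]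
      symm := fun {f g} h => by
        have := (I.hom _ _).neg_mem h
        rwa [neg_sub] at this
      trans := fun {f g k} h h' => by
        have := (I.hom _ _).add_mem h h'
        rwa [sub_add_sub_cancel] at this }

/-- The category `A / I`: same objects as `A`, morphisms `A(x, y) / I(x, y)`. -/
abbrev Quot : Type u := CategoryTheory.Quotient I.rel

/-- The canonical functor `A ⥤ A / I`. -/
abbrev proj : A ⥤ I.Quot := CategoryTheory.Quotient.functor I.rel

/-- The ideal `I` is `K`-cotrivial: each group `A(x, y) / I(x, y)` is finite and becomes zero after
tensoring with `K` over `ℤ`. -/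
def IsCotrivial (K : Type w) [Field K] : Prop :=
  ∀ x y : A, Finite ((x ⟶ y) ⧸ I.hom x y) ∧
    Subsingleton (K ⊗[ℤ] ((x ⟶ y) ⧸ I.hom x y))

end CatIdeal

/-- A functor is antipolynomial if it is isomorphic to one that factors through `A ⥤ A / I` for
some `K`-cotrivial ideal `I`. -/
def IsAntipolynomial {A : Type u} [Category.{v} A] [Preadditive A] {K : Type w} [Field K]
    (F : A ⥤ ModuleCat.{w} K) : Prop :=
  ∃ I : CatIdeal A, I.IsCotrivial K ∧
    ∃ G : I.Quot ⥤ ModuleCat.{w} K, Nonempty (F ≅ I.proj ⋙ G)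

/-! ### Absolutely simple functors and splitting fields -/

/-- A functor is absolutely simple if it is simple and the canonical map from `K` to its
endomorphism ring is an isomorphism. -/
def IsAbsolutelySimple {C : Type u} [Category.{v} C] {K : Type w} [Field K]
    (S : C ⥤ ModuleCat.{w} K) : Prop :=
  Simple S ∧ Function.Bijective (fun c : K => (c • 𝟙 S : S ⟶ S))

/-- `K` is a non-additive splitting field of the category `C`: every simple functor from `C` to
`K`-vector spaces with finite-dimensional values is absolutely simple. -/
def IsNonadditiveSplittingField (K : Type w) [Field K] (C : Type u) [Category.{v} C] : Prop :=
  ∀ S : C ⥤ ModuleCat.{w} K, Simple S → FiniteDimValued S → IsAbsolutelySimple S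

/-- `K` contains all roots of unity: every polynomial `X ^ n - 1`, `n ≥ 1`, splits over `K`. -/
def ContainsAllRootsOfUnity (K : Type w) [Field K] : Prop :=
  ∀ n : ℕ, 0 < n → (Polynomial.X ^ n - 1 : Polynomial K).Splits

/-! ### Bifunctors -/

/-- The bifunctor `B` is antipolynomial in the first variable: every `B(-, x)` is. -/
def IsAntipolynomialFst {A : Type u} [Category.{v} A] [Preadditive A] {K : Type w} [Field K]
    (B : A × A ⥤ ModuleCat.{w} K) : Prop :=
  ∀ x : A, IsAntipolynomial (Prod.sectL A x ⋙ B)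

/-- The bifunctor `B` is polynomial in the second variable: every `B(x, -)` is. -/
def IsPolynomialSnd {A : Type u} [Category.{v} A] [Preadditive A] {K : Type w} [Field K]
    (B : A × A ⥤ ModuleCat.{w} K) : Prop :=
  ∀ x : A, IsPolynomial (Prod.sectR x A ⋙ B)

end TensorDecomposition

/-! A simple functor `F` is controlled by one nonzero value `F x₀`, so the first question is how `F`
depends on a morphism as a function on the group `x₀ ⟶ x₀`. Its matrix coefficients, with their
translates, span a finite-dimensional translation-stable space `W` of functions. Over an algebraic
closure, the group algebra acts on `W` through a finite-dimensional commutative quotient whose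
residue fields give characters lying in `W`. Precomposition with `n • 𝟙` turns a character into its
`n`-th power, and `W` contains only finitely many characters, so all of them have finite order, with
a common exponent invertible in `K`. Their kernels cut out a cotrivial ideal `I`, and `F` is
polynomial along the cosets of `I` (`exists_hasMixedType`).

The two behaviours are separated by interpolation. Let `N` be invertible in `K` with all `N • f` in
`I`, and let `q ^ N ≡ X` modulo a high power of `X - 1`. Then `∑ q_j F(f + jN(g - f))` freezes the
`I`-invariant part at `f` and moves the polynomial part to `g`, because translations act unipotently
on polynomial functions. This action of pairs `(f, g)` is multiplicative (`pairMap_comp`), and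
cutting `F (x ⊞ y)` by an idempotent gives a bifunctor with diagonal `F`. Conversely the same
formula expresses a bifunctor through its diagonal (`HasBitype.bmap_eq_interp`), so simplicity and
isomorphisms pass between the two.

For the tensor decomposition, let `T` be a simple subfunctor of some `B(-, y₀)`. If `T` is
absolutely simple, every nonzero subfunctor of `V ⊗ T` contains a pure tensor
(`exists_tmul_mem_of_absolutelySimple`), and the evaluation of `Hom(T, B(-, y)) ⊗ T` in `B` is an
isomorphism (`nonempty_box_iso`).

For roots of unity, the quotient categories have finite morphism sets. In characteristic `p`, `K`
contains an algebraically closed subfield and `S` is extended from it. In characteristic zero, a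
projection of minimal rank in a finite monoid reduces to an irreducible representation of a finite
group, whose commutant `D` must be shown to be `K`. If `δ = dim D`, the sums of `χ(g) χ(g⁻¹)` over
cosets of `p`-groups acquire a factor `δ ^ 2`; a congruence modulo powers of `p` transfers this to
the whole group, where the sum is `|G| δ`. So no prime divides `δ`. -/

namespace TensorDecomposition

/-! ### Subfunctors and simplicity in terms of stable families of subspaces -/

section Subfamily

variable {C : Type u} [Category.{v} C] {K : Type w} [Field K]

/-- A subfunctor of a functor to vector spaces, as a family of subspaces stable under all
morphisms. -/
structure Subfamily (F : C ⥤ ModuleCat.{w} K) where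
  /-- The subspace at an object. -/
  obj : ∀ x : C, Submodule K (F.obj x)
  map_mem : ∀ {x y : C} (f : x ⟶ y) {m : F.obj x}, m ∈ obj x → (F.map f).hom m ∈ obj y

namespace Subfamily

variable {F : C ⥤ ModuleCat.{w} K} (G : Subfamily F)

/-- A stable family of subspaces as a functor. -/
@[simps]
def toFunctor : C ⥤ ModuleCat.{w} K where
  obj x := ModuleCat.of K (G.obj x)
  map f := ModuleCat.ofHom (((F.map f).hom).restrict fun _ hm => G.map_mem f hm)
  map_id x := by ext m; simp
  map_comp f g := by ext m; simp

/-- The inclusion of a stable family of subspaces. -/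
@[simps]
def incl : G.toFunctor ⟶ F where
  app x := ModuleCat.ofHom (G.obj x).subtype

/-- The subfunctor generated by an element. -/
def gen (F : C ⥤ ModuleCat.{w} K) {x : C} (m : F.obj x) : Subfamily F where
  obj y := Submodule.span K (Set.range fun f : x ⟶ y => (F.map f).hom m)
  map_mem {y z} g n hn := by
    have : Submodule.span K (Set.range fun f : x ⟶ y => (F.map f).hom m) ≤
        (Submodule.span K (Set.range fun f : x ⟶ z => (F.map f).hom m)).comap (F.map g).hom := by
      rw [Submodule.span_le]
      rintro _ ⟨f, rfl⟩
      refine Submodule.subset_span ⟨f ≫ g, ?_⟩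
      simp
    exact this hn

lemma mem_gen {x : C} (m : F.obj x) : m ∈ (gen F m).obj x :=
  Submodule.subset_span ⟨𝟙 x, by simp⟩

end Subfamily

lemma map_zero_apply_ne {F F' : C ⥤ ModuleCat.{w} K} {η : F ⟶ F'} (h : η ≠ 0) :
    ∃ (x : C) (m : F.obj x), (η.app x).hom m ≠ 0 := by
  by_contra! H
  apply h
  ext x m
  simpa using H x m

/-- Monomorphisms of functors are pointwise injective, so subobjects are given by their pointwise
ranges. All later simplicity arguments use this elementwise form. -/
lemma simple_iff_subfamily (F : C ⥤ ModuleCat.{w} K) :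
    Simple F ↔ (∃ x : C, Nontrivial (F.obj x)) ∧
      ∀ G : Subfamily F, (∀ x, G.obj x = ⊥) ∨ ∀ x, G.obj x = ⊤ := by
  constructor
  · intro hF
    constructor
    · obtain ⟨x, m, hm⟩ := map_zero_apply_ne (id_nonzero F)
      exact ⟨x, m, 0, by simpa using hm⟩
    · intro G
      by_cases h : G.incl = 0
      · left
        intro x
        rw [eq_bot_iff]
        intro m hm
        have := congrArg (fun η : G.toFunctor ⟶ F => (η.app x).hom ⟨m, hm⟩) h
        exact this
      · right
        have : Mono G.incl := by
          have : ∀ x, Mono (G.incl.app x) := fun x => by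
            rw [ModuleCat.mono_iff_injective]
            exact Subtype.val_injective
          exact NatTrans.mono_of_mono_app _
        have := isIso_of_mono_of_nonzero h
        intro x
        rw [eq_top_iff]
        intro m _
        have h2 : Function.Surjective (G.incl.app x).hom :=
          (ModuleCat.epi_iff_surjective _).1 inferInstance
        obtain ⟨n, rfl⟩ := h2 m
        exact n.2
  · rintro ⟨⟨x₀, hx₀⟩, h⟩
    refine ⟨fun {Y} f hf => ?_⟩
    have hinj : ∀ x, Function.Injective (f.app x).hom := fun x =>
      (ModuleCat.mono_iff_injective _).1 inferInstance
    let G : Subfamily F :=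
      { obj := fun x => LinearMap.range (f.app x).hom
        map_mem := by
          rintro x y g _ ⟨m, rfl⟩
          exact ⟨(Y.map g).hom m, NatTrans.naturality_apply f g m⟩ }
    constructor
    · intro hf0 hf1
      subst hf1
      obtain ⟨m, hm⟩ := exists_ne (0 : F.obj x₀)
      have h2 : Function.Surjective ((0 : Y ⟶ F).app x₀).hom :=
          (ModuleCat.epi_iff_surjective _).1 inferInstance
      obtain ⟨n, rfl⟩ := h2 m
      simp at hm
    · intro hf0
      rcases h G with h | h
      · exfalso
        obtain ⟨x, m, hm⟩ := map_zero_apply_ne hf0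
        have : (f.app x).hom m ∈ G.obj x := ⟨m, rfl⟩
        rw [h x] at this
        exact hm (by simpa using this)
      · have : ∀ x, IsIso (f.app x) := fun x => by
          have h1 : Epi (f.app x) := by
            rw [ModuleCat.epi_iff_surjective]
            exact LinearMap.range_eq_top.1 (h x)
          exact isIso_of_mono_of_epi _
        exact NatIso.isIso_of_isIso_app f

section Simple

variable {F : C ⥤ ModuleCat.{w} K}

lemma Subfamily.eq_top_of_mem (hF : Simple F) (G : Subfamily F) {x : C} {m : F.obj x}
    (hm : m ∈ G.obj x) (h0 : m ≠ 0) (y : C) : G.obj y = ⊤ := by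
  rcases ((simple_iff_subfamily F).1 hF).2 G with h | h
  · rw [h x] at hm
    exact absurd (by simpa using hm) h0
  · exact h y

lemma Subfamily.eq_bot_of_ne_top (hF : Simple F) (G : Subfamily F) {x : C}
    (hm : G.obj x ≠ ⊤) (y : C) : G.obj y = ⊥ := by
  rcases ((simple_iff_subfamily F).1 hF).2 G with h | h
  · exact h y
  · exact absurd (h x) hm

lemma span_map_eq_top (hF : Simple F) {x : C} {m : F.obj x} (h0 : m ≠ 0) (y : C) :
    Submodule.span K (Set.range fun f : x ⟶ y => (F.map f).hom m) = ⊤ :=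
  (Subfamily.gen F m).eq_top_of_mem hF (Subfamily.mem_gen m) h0 y

lemma exists_map_ne_zero (hF : Simple F) {x : C} {m : F.obj x} (h0 : m ≠ 0) (y : C)
    [Nontrivial (F.obj y)] : ∃ f : x ⟶ y, (F.map f).hom m ≠ 0 := by
  by_contra! H
  have := span_map_eq_top hF h0 y
  have h2 : Submodule.span K (Set.range fun f : x ⟶ y => (F.map f).hom m) = ⊥ := by
    rw [Submodule.span_eq_bot]
    rintro _ ⟨f, rfl⟩
    exact H f
  exact bot_ne_top (h2.symm.trans this)

lemma exists_nontrivial (hF : Simple F) : ∃ x : C, Nontrivial (F.obj x) :=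
  ((simple_iff_subfamily F).1 hF).1

/-- Two linear maps out of a value of a simple functor agree if they agree on a generating
element after all morphisms. -/
lemma ext_of_simple (hF : Simple F) {x y : C} {m : F.obj x} (h0 : m ≠ 0) {V : Type*}
    [AddCommGroup V] [Module K V] {φ ψ : F.obj y →ₗ[K] V}
    (h : ∀ f : x ⟶ y, φ ((F.map f).hom m) = ψ ((F.map f).hom m)) : φ = ψ := by
  apply LinearMap.ext_on (span_map_eq_top hF h0 y)
  rintro _ ⟨f, rfl⟩
  exact h f

/-- A linear map between values of a simple functor vanishes if all its compositions with the
maps induced by morphisms from and to `x₀` vanish. -/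
lemma eq_zero_of_simple (hF : Simple F) (x₀ : C) [Nontrivial (F.obj x₀)] {x y : C}
    {φ : F.obj x →ₗ[K] F.obj y}
    (h : ∀ (b : x₀ ⟶ x) (a : y ⟶ x₀), (F.map a).hom ∘ₗ φ ∘ₗ (F.map b).hom = 0) : φ = 0 := by
  obtain ⟨m, hm⟩ := exists_ne (0 : F.obj x₀)
  refine ext_of_simple hF hm fun b => ?_
  by_contra h1
  obtain ⟨a, ha⟩ := exists_map_ne_zero hF (m := φ ((F.map b).hom m)) h1 x₀
  exact ha (by simpa using LinearMap.congr_fun (h b a) m)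

/-- A nonzero subfunctor of `T × X` which meets `0 × X` trivially is the graph of a
natural transformation, if `T` is simple. -/
lemma exists_natTrans_of_graph {T X : C ⥤ ModuleCat.{w} K} (hT : Simple T)
    (Γ : ∀ x, Submodule K (T.obj x × X.obj x))
    (hΓ : ∀ {x y : C} (f : x ⟶ y) {t : T.obj x} {m : X.obj x}, (t, m) ∈ Γ x →
      ((T.map f).hom t, (X.map f).hom m) ∈ Γ y)
    (h0 : ∀ (x : C) (m : X.obj x), (0, m) ∈ Γ x → m = 0)
    (hne : ∃ (x : C) (t : T.obj x) (m : X.obj x), t ≠ 0 ∧ (t, m) ∈ Γ x) :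
    ∃ η : T ⟶ X, ∀ (x : C) (t : T.obj x) (m : X.obj x), (t, m) ∈ Γ x → (η.app x).hom t = m := by
  let G : Subfamily T :=
    { obj := fun x => (Γ x).map (LinearMap.fst K _ _)
      map_mem := by
        rintro x y f _ ⟨⟨t, m⟩, h, rfl⟩
        exact ⟨_, hΓ f h, rfl⟩ }
  have hG : ∀ x, G.obj x = ⊤ := by
    obtain ⟨x, t, m, ht, hm⟩ := hne
    exact G.eq_top_of_mem hT (m := t) ⟨_, hm, rfl⟩ ht
  have hex : ∀ (x : C) (t : T.obj x), ∃ m : X.obj x, (t, m) ∈ Γ x := by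
    intro x t
    have : t ∈ G.obj x := by rw [hG]; trivial
    obtain ⟨⟨t', m⟩, h, rfl⟩ := this
    exact ⟨m, h⟩
  have huniq : ∀ (x : C) (t : T.obj x) (m m' : X.obj x), (t, m) ∈ Γ x → (t, m') ∈ Γ x → m = m' := by
    intro x t m m' h h'
    have := (Γ x).sub_mem h h'
    rw [← sub_eq_zero]
    apply h0
    simpa using this
  choose η hη using hex
  let φ (x : C) : T.obj x →ₗ[K] X.obj x :=
    { toFun := η x
      map_add' := fun s t => huniq x _ _ _ (hη x (s + t)) ((Γ x).add_mem (hη x s) (hη x t))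
      map_smul' := fun c t => huniq x _ _ _ (hη x (c • t)) ((Γ x).smul_mem c (hη x t)) }
  refine ⟨{ app := fun x => ModuleCat.ofHom (φ x), naturality := ?_ }, ?_⟩
  · intro x y f
    ext t
    exact huniq y _ _ _ (hη y ((T.map f).hom t)) (hΓ f (hη x t))
  · intro x t m h
    exact huniq x _ _ _ (hη x t) h

lemma isIso_iff_bijective {F' : C ⥤ ModuleCat.{w} K} (η : F ⟶ F')
    (h : ∀ x, Function.Bijective (η.app x).hom) : IsIso η := by
  have : ∀ x, IsIso (η.app x) := fun x => by
    have h1 : Epi (η.app x) := (ModuleCat.epi_iff_surjective _).2 (h x).2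
    have h2 : Mono (η.app x) := (ModuleCat.mono_iff_injective _).2 (h x).1
    exact isIso_of_mono_of_epi _
  exact NatIso.isIso_of_isIso_app η

/-- A natural transformation between simple functors is an isomorphism if it is nonzero. -/
lemma nonempty_iso_of_ne_zero {S S' : C ⥤ ModuleCat.{w} K} (hS : Simple S) (hS' : Simple S')
    {η : S ⟶ S'} {x : C} {m : S.obj x} (h : (η.app x).hom m ≠ 0) : Nonempty (S ≅ S') := by
  have hker : ∀ y, LinearMap.ker (η.app y).hom = ⊥ := by
    let G : Subfamily S :=
      { obj := fun y => LinearMap.ker (η.app y).hom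
        map_mem := by
          intro y z f n hn
          have := NatTrans.naturality_apply η f n
          rw [LinearMap.mem_ker] at hn ⊢
          erw [this, hn]
          simp }
    refine G.eq_bot_of_ne_top hS (x := x) fun htop => h ?_
    have : m ∈ G.obj x := by rw [htop]; trivial
    exact this
  have hran : ∀ y, LinearMap.range (η.app y).hom = ⊤ := by
    let G : Subfamily S' :=
      { obj := fun y => LinearMap.range (η.app y).hom
        map_mem := by
          rintro y z f _ ⟨n, rfl⟩
          exact ⟨(S.map f).hom n, NatTrans.naturality_apply η f n⟩ }
    exact G.eq_top_of_mem hS' (m := (η.app x).hom m) ⟨m, rfl⟩ h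
  have := isIso_iff_bijective η fun y =>
    ⟨LinearMap.ker_eq_bot.1 (hker y), LinearMap.range_eq_top.1 (hran y)⟩
  exact ⟨asIso η⟩

lemma FiniteDimValued.of_iso {F' : C ⥤ ModuleCat.{w} K} (e : F ≅ F') (h : FiniteDimValued F) :
    FiniteDimValued F' := fun x =>
  have := h x
  LinearEquiv.finiteDimensional (e.app x).toLinearEquiv

end Simple

end Subfamily

/-! ### Functors factoring through the quotient by an ideal -/

section Quot

variable {A : Type u} [Category.{v} A] [Preadditive A] {K : Type w} [Field K] (I : CatIdeal A)

/-- The projection is full and bijective on objects, so both functors have the same stable families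
of subspaces. -/
lemma simple_proj_comp_iff (T : I.Quot ⥤ ModuleCat.{w} K) : Simple (I.proj ⋙ T) ↔ Simple T := by
  rw [simple_iff_subfamily, simple_iff_subfamily]
  refine and_congr ⟨fun ⟨x, h⟩ => ⟨I.proj.obj x, h⟩, fun ⟨x, h⟩ => ⟨x.as, h⟩⟩ ⟨fun h G => ?_, fun h G => ?_⟩
  · rcases h ⟨fun x => G.obj (I.proj.obj x), fun f _ hm => G.map_mem (I.proj.map f) hm⟩ with h | h
    · exact Or.inl fun x => h x.as
    · exact Or.inr fun x => h x.as
  · rcases h ⟨fun x => G.obj x.as, fun {x y} f _ hm => by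
      obtain ⟨f, rfl⟩ := I.proj.map_surjective (X := x.as) (Y := y.as) f
      exact G.map_mem f hm⟩ with h | h
    · exact Or.inl fun x => h (I.proj.obj x)
    · exact Or.inr fun x => h (I.proj.obj x)

lemma proj_map_eq {x y : A} {f g : x ⟶ y} (h : f - g ∈ I.hom x y) : I.proj.map f = I.proj.map g :=
  CategoryTheory.Quotient.sound _ h

lemma IsAntipolynomial.of_map_eq {I : CatIdeal A} (hI : I.IsCotrivial K) {F : A ⥤ ModuleCat.{w} K}
    (h : ∀ {x y : A} (f g : x ⟶ y), f - g ∈ I.hom x y → F.map f = F.map g) :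
    IsAntipolynomial F :=
  ⟨I, hI, CategoryTheory.Quotient.lift _ F fun _ _ f g hfg => h f g hfg,
    ⟨(CategoryTheory.Quotient.lift.isLift _ _ _).symm⟩⟩

lemma IsAntipolynomial.exists_map_eq {F : A ⥤ ModuleCat.{w} K} (hF : IsAntipolynomial F) :
    ∃ I : CatIdeal A, I.IsCotrivial K ∧
      ∀ {x y : A} (f g : x ⟶ y), f - g ∈ I.hom x y → F.map f = F.map g := by
  obtain ⟨I, hI, G, ⟨e⟩⟩ := hF
  refine ⟨I, hI, fun {x y} f g h => ?_⟩
  rw [← cancel_mono (e.hom.app y), e.hom.naturality, e.hom.naturality, Functor.comp_map,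
    Functor.comp_map, proj_map_eq I h]

lemma isAbsolutelySimple_proj_comp {T : I.Quot ⥤ ModuleCat.{w} K} (h : IsAbsolutelySimple T) :
    IsAbsolutelySimple (I.proj ⋙ T) := by
  refine ⟨(simple_proj_comp_iff I T).2 h.1, ?_, ?_⟩
  · intro c d hcd
    apply h.2.1
    ext x m
    exact congrArg (fun η : I.proj ⋙ T ⟶ I.proj ⋙ T => (η.app x.as).hom m) hcd
  · intro η
    obtain ⟨c, hc⟩ := h.2.2 (CategoryTheory.Quotient.natTransLift _ η)
    refine ⟨c, ?_⟩
    ext x m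
    exact congrArg (fun η : T ⟶ T => (η.app (I.proj.obj x)).hom m) hc

end Quot

lemma IsAbsolutelySimple.of_iso {C : Type u} [Category.{v} C] {K : Type w} [Field K]
    {S T : C ⥤ ModuleCat.{w} K} (e : S ≅ T) (h : IsAbsolutelySimple S) : IsAbsolutelySimple T := by
  refine ⟨(Simple.iff_of_iso e).1 h.1, fun c d hcd => h.2.1 ?_, fun η => ?_⟩
  · have := congrArg (fun η => e.hom ≫ η ≫ e.inv) hcd
    simpa using this
  · obtain ⟨c, hc⟩ := h.2.2 (e.hom ≫ η ≫ e.inv)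
    refine ⟨c, ?_⟩
    have := congrArg (fun η => e.inv ≫ η ≫ e.hom) hc
    simpa using this

end TensorDecomposition

namespace TensorDecomposition

/-! ### Roots of unipotent elements and the unipotent part of a character -/

section Unipotent

open Polynomial in
/-- A polynomial approximation at `1` of the `N`-th root function. -/
lemma exists_polynomial_root {K : Type*} [Field K] {N : ℕ} (hN : (N : K) ≠ 0) (d : ℕ) :
    ∃ q : K[X], q.eval 1 = 1 ∧ (X - C 1) ^ (d + 1) ∣ q ^ N - X := by
  induction d with
  | zero => exact ⟨1, by simp, by rw [zero_add, pow_one, dvd_iff_isRoot]; simp⟩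
  | succ d ih =>
    obtain ⟨q, hq, r, hr⟩ := ih
    -- Newton correction: subtracting `t` changes `q ^ N` by `-N q ^ (N - 1) t` modulo `t ^ 2`.
    -- Since `q(1) = 1`, the coefficient `r(1) / N` cancels the error `r (X - 1) ^ (d + 1)` to one
    -- further order.
    refine ⟨q - C (r.eval 1 / N) * (X - C 1) ^ (d + 1), by simp [hq], ?_⟩
    obtain ⟨s, hs⟩ : C (r.eval 1 / N) * (X - C 1) ^ (d + 1) ∣
        (q - C (r.eval 1 / N) * (X - C 1) ^ (d + 1)) ^ N - q ^ N +
          (N : K[X]) * q ^ (N - 1) * (C (r.eval 1 / N) * (X - C 1) ^ (d + 1)) := by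
      have h1 := sub_dvd_pow_sub_pow (q - C (r.eval 1 / N) * (X - C 1) ^ (d + 1)) q N
      rw [sub_sub_cancel_left, neg_dvd] at h1
      exact dvd_add h1 (dvd_mul_left _ _)
    set t := C (r.eval 1 / N) * (X - C 1) ^ (d + 1) with ht
    have h2 : t ^ 2 ∣ (q - t) ^ N - q ^ N + (N : K[X]) * q ^ (N - 1) * t := by
      obtain ⟨k, hk⟩ := (Polynomial.binomExpansion (X ^ N : K[X][X]) q (-t))
      refine ⟨k, ?_⟩
      simp only [eval_pow, eval_X, derivative_X_pow, eval_mul] at hk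
      rw [← sub_eq_add_neg] at hk
      rw [hk]
      simp
      ring
    have h3 : (X - C 1) ^ (d + 1 + 1) ∣ (q - t) ^ N - q ^ N + (N : K[X]) * q ^ (N - 1) * t := by
      refine dvd_trans ?_ h2
      rw [ht, mul_pow, ← pow_mul]
      exact dvd_mul_of_dvd_right (pow_dvd_pow _ (by omega)) _
    have h4 : (X - C 1) ^ (d + 1 + 1) ∣ q ^ N - X - (N : K[X]) * q ^ (N - 1) * t := by
      have : q ^ N - X - (N : K[X]) * q ^ (N - 1) * t
          = (X - C 1) ^ (d + 1) * (r - (N : K[X]) * q ^ (N - 1) * C (r.eval 1 / N)) := by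
        rw [hr, ht]; ring
      rw [this, pow_succ _ (d + 1)]
      refine mul_dvd_mul_left _ ?_
      rw [dvd_iff_isRoot]
      simp [hq]
      field_simp
      simp
    have := dvd_add h3 h4
    convert this using 1
    ring

/-- Unipotent elements are determined by their `N`-th powers, if `N` is invertible. -/
lemma eq_of_pow_eq_pow {R : Type*} [CommRing R] {J : Ideal R} {d N : ℕ} (hJ : J ^ d = ⊥)
    (hN : IsUnit (N : R)) {a b : R} (ha : a - 1 ∈ J) (hb : b - 1 ∈ J) (h : a ^ N = b ^ N) :
    a = b := by
  have hnil : ∀ x ∈ J, IsNilpotent x := fun x hx => ⟨d, by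
    have := Ideal.pow_mem_pow hx d
    rwa [hJ, Ideal.mem_bot] at this⟩
  have hmk : ∀ {x : R}, x - 1 ∈ J → Ideal.Quotient.mk J x = 1 := fun {x} hx => by
    rw [← map_one (Ideal.Quotient.mk J), Ideal.Quotient.eq]; exact hx
  -- The cofactor of `a - b` in `a ^ N - b ^ N` is congruent to `N` modulo a nilpotent ideal, hence
  -- a unit.
  have h1 : (∑ i ∈ Finset.range N, a ^ i * b ^ (N - 1 - i)) - N ∈ J := by
    rw [← Ideal.Quotient.eq, map_sum]
    simp [hmk ha, hmk hb]
  have h2 : IsUnit (∑ i ∈ Finset.range N, a ^ i * b ^ (N - 1 - i)) := by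
    have := (hnil _ h1).isUnit_add_right_of_commute hN (Commute.all _ _)
    simpa using this
  have h3 := (Commute.all a b).geom_sum₂_mul N
  rw [h, sub_self] at h3
  exact sub_eq_zero.1 (h2.mul_right_eq_zero.1 h3)

open Polynomial

variable {K : Type*} [Field K] {V : Type*} [AddCommGroup V] {R : Type*} [CommRing R] [Algebra K R]
  {J : Ideal R} {d N : ℕ} {I : AddSubgroup V} {q : K[X]}

/-- The unipotent part of a character, for a polynomial `q` approximating the `N`-th root. -/
noncomputable def unipPart (q : K[X]) (N : ℕ) (τ : Multiplicative V →* R) (v : V) : R :=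
  aeval (τ (.ofAdd (N • v))) q

lemma aeval_sub_one_mem (hq : q.eval 1 = 1) {a : R} (ha : a - 1 ∈ J) : aeval a q - 1 ∈ J := by
  have h : (X - C 1) ∣ q - 1 := by rw [dvd_iff_isRoot]; simp [hq]
  obtain ⟨r, hr⟩ := h
  have := congrArg (aeval a) hr
  simp at this
  rw [this]
  exact J.mul_mem_right _ ha

lemma aeval_pow_eq (hJ : J ^ d = ⊥) (hq' : (X - C 1) ^ d ∣ q ^ N - X) {a : R} (ha : a - 1 ∈ J) :
    aeval a q ^ N = a := by
  obtain ⟨r, hr⟩ := hq'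
  have := congrArg (aeval a) hr
  simp at this
  rw [← sub_eq_zero, this]
  have h0 : (a - 1) ^ d = 0 := by
    have := Ideal.pow_mem_pow ha d
    rwa [hJ, Ideal.mem_bot] at this
  rw [h0, zero_mul]

variable (hJ : J ^ d = ⊥) (hN : ∀ v : V, N • v ∈ I) (hN0 : (N : K) ≠ 0) (hq : q.eval 1 = 1)
  (hq' : (X - C 1) ^ d ∣ q ^ N - X) (τ : Multiplicative V →* R)
  (hτ : ∀ i ∈ I, τ (.ofAdd i) - 1 ∈ J)

section
include hN hτ hJ hq' in
lemma unipPart_pow (v : V) : unipPart q N τ v ^ N = τ (.ofAdd (N • v)) :=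
  aeval_pow_eq hJ hq' (hτ _ (hN v))

include hN hq hτ

lemma unipPart_sub_one_mem (v : V) : unipPart q N τ v - 1 ∈ J :=
  aeval_sub_one_mem hq (hτ _ (hN v))

include hJ hq' hN0

/-- Both sides are unipotent with `N`-th power `τ(i) ^ N`, so `eq_of_pow_eq_pow` applies. The same
uniqueness of unipotent roots makes `unipPart` multiplicative. -/
lemma unipPart_of_mem {i : V} (hi : i ∈ I) : unipPart q N τ i = τ (.ofAdd i) := by
  have hu : IsUnit (N : R) := by
    rw [← map_natCast (algebraMap K R)]; exact (IsUnit.mk0 _ hN0).map _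
  refine eq_of_pow_eq_pow hJ hu (unipPart_sub_one_mem hN hq τ hτ i) (hτ i hi) ?_
  rw [unipPart_pow hJ hN hq' τ hτ, ofAdd_nsmul, map_pow]

lemma unipPart_add (v w : V) : unipPart q N τ (v + w) = unipPart q N τ v * unipPart q N τ w := by
  have hu : IsUnit (N : R) := by
    rw [← map_natCast (algebraMap K R)]; exact (IsUnit.mk0 _ hN0).map _
  refine eq_of_pow_eq_pow hJ hu (unipPart_sub_one_mem hN hq τ hτ _) ?_ ?_
  · have h1 := unipPart_sub_one_mem hN hq τ hτ v
    have h2 := unipPart_sub_one_mem hN hq τ hτ w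
    have : unipPart q N τ v * unipPart q N τ w - 1
      = (unipPart q N τ v - 1) * unipPart q N τ w + (unipPart q N τ w - 1) := by ring
    rw [this]
    exact J.add_mem (J.mul_mem_right _ h1) h2
  · rw [mul_pow, unipPart_pow hJ hN hq' τ hτ, unipPart_pow hJ hN hq' τ hτ,
      unipPart_pow hJ hN hq' τ hτ, ← map_mul, ← ofAdd_add, smul_add]

lemma unipPart_zero : unipPart q N τ (0 : V) = 1 := by
  rw [unipPart_of_mem hJ hN hN0 hq hq' τ hτ I.zero_mem, ofAdd_zero, map_one]

/-- The unipotent part as a monoid homomorphism. -/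
lemma exists_unipHom : ∃ ν : Multiplicative V →* R, ∀ v, ν (.ofAdd v) = unipPart q N τ v :=
  ⟨{ toFun := fun v => unipPart q N τ v.toAdd
     map_one' := unipPart_zero hJ hN hN0 hq hq' τ hτ
     map_mul' := fun v w => unipPart_add hJ hN hN0 hq hq' τ hτ v.toAdd w.toAdd }, fun _ => rfl⟩

end

end Unipotent

/-! ### Polynomial functions through the group algebra; interpolation -/

section GroupAlgebra

variable {K : Type*} [Field K] {V : Type*} [AddCommGroup V] {M : Type*} [AddCommGroup M]
  [Module K M]

variable (K) in
/-- The class of a group element in the group algebra. -/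
noncomputable def pt (v : V) : AddMonoidAlgebra K V :=
  AddMonoidAlgebra.of K V (.ofAdd v)

lemma pt_add (v w : V) : pt K (v + w) = pt K v * pt K w := map_mul _ _ _

lemma pt_nsmul (n : ℕ) (v : V) : pt K (n • v) = pt K v ^ n := map_pow _ _ _

lemma pt_sum {ι : Type*} (s : Finset ι) (a : ι → V) :
    pt K (∑ i ∈ s, a i) = ∏ i ∈ s, pt K (a i) := by
  rw [pt, ofAdd_sum, map_prod]
  rfl

lemma single_eq_smul_pt (v : V) (c : K) : AddMonoidAlgebra.single v c = c • pt K v := by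
  simp [pt, AddMonoidAlgebra.of_apply]

/-- The linear extension of a function to the group algebra. -/
noncomputable def linExt (f : V → M) : AddMonoidAlgebra K V →ₗ[K] M :=
  Finsupp.linearCombination K f ∘ₗ (AddMonoidAlgebra.coeffLinearEquiv K).toLinearMap

lemma linExt_pt (f : V → M) (v : V) : linExt f (pt K v) = f v := by
  simp [linExt, pt, AddMonoidAlgebra.of_apply]

lemma hom_ext_pt {φ ψ : AddMonoidAlgebra K V →ₗ[K] M} (h : ∀ v, φ (pt K v) = ψ (pt K v)) :
    φ = ψ := by
  refine LinearMap.ext fun z => ?_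
  induction z using AddMonoidAlgebra.induction_linear with
  | zero => simp
  | add a b ha hb => rw [map_add, map_add, ha, hb]
  | single v c => rw [single_eq_smul_pt, map_smul, map_smul, h]

lemma linExt_comp {M' : Type*} [AddCommGroup M'] [Module K M'] (φ : M →ₗ[K] M') (f : V → M) :
    linExt (fun v => φ (f v)) = φ ∘ₗ linExt f :=
  hom_ext_pt fun v => by simp [linExt_pt]

variable (K) in
/-- The ideal of the group algebra generated by the elements `[i] - 1` for `i` in a subgroup. -/
noncomputable def relIdeal (I : AddSubgroup V) : Ideal (AddMonoidAlgebra K V) :=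
  Ideal.span ((fun i => pt K i - 1) '' I)

lemma pt_sub_one_mem {I : AddSubgroup V} {i : V} (hi : i ∈ I) : pt K i - 1 ∈ relIdeal K I :=
  Ideal.subset_span ⟨i, hi, rfl⟩

/-- Expanding `∏ ([a_i] - 1)` in the group algebra gives the alternating sum of the deviation.
Degree at most `d` thus means that the linear extension kills the `(d + 1)`-st power of the
augmentation ideal. -/
lemma deviation_eq_linExt (d : ℕ) (f : V → M) (a : Fin d → V) :
    deviation d f a = linExt f (∏ i, (pt K (a i) - 1)) := by
  have h : ∏ i, (pt K (a i) - 1)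
      = ∑ s : Finset (Fin d), ((-1 : ℤ) ^ (d - s.card)) • pt K (∑ i ∈ s, a i) := by
    simp_rw [sub_eq_add_neg]
    rw [Finset.prod_add, Finset.powerset_univ]
    refine Finset.sum_congr rfl fun s _ => ?_
    rw [Finset.prod_const, Finset.card_sdiff_of_subset (Finset.subset_univ _), Finset.card_univ,
      Fintype.card_fin, pt_sum, mul_comm]
    simp [zsmul_eq_mul]
  rw [h, map_sum, deviation]
  refine Finset.sum_congr rfl fun s _ => ?_
  rw [map_zsmul, linExt_pt]

/-- Since `[v]([i] - 1) = ([v + i] - 1) - ([v] - 1)`, the linear span of the `[i] - 1` is already an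
ideal. Powers of the augmentation ideal are then spanned linearly by products of such elements. -/
lemma mul_mem_span (a : AddMonoidAlgebra K V) {z : AddMonoidAlgebra K V}
    (hz : z ∈ Submodule.span K (Set.range fun i : V => pt K i - 1)) :
    a * z ∈ Submodule.span K (Set.range fun i : V => pt K i - 1) := by
  induction a using AddMonoidAlgebra.induction_linear with
  | zero => rw [zero_mul]; exact Submodule.zero_mem _
  | add a b ha hb => rw [add_mul]; exact Submodule.add_mem _ ha hb
  | single v c =>
    rw [single_eq_smul_pt, smul_mul_assoc]
    apply Submodule.smul_mem
    induction hz using Submodule.span_induction with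
    | mem x hx =>
      obtain ⟨i, rfl⟩ := hx
      have : pt K v * (pt K i - 1) = (pt K (v + i) - 1) - (pt K v - 1) := by
        rw [pt_add]; ring
      simp only [this]
      exact Submodule.sub_mem _ (Submodule.subset_span ⟨_, rfl⟩) (Submodule.subset_span ⟨_, rfl⟩)
    | zero => rw [mul_zero]; exact Submodule.zero_mem _
    | add x y _ _ hx hy => rw [mul_add]; exact Submodule.add_mem _ hx hy
    | smul c x _ hx => rw [mul_smul_comm]; exact Submodule.smul_mem _ _ hx

lemma relIdeal_top_eq_span :
    (relIdeal K (⊤ : AddSubgroup V)).restrictScalars K =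
      Submodule.span K (Set.range fun i => pt K i - 1) := by
  apply le_antisymm
  · intro z hz
    refine Submodule.span_induction (p := fun z _ => z ∈ Submodule.span K
      (Set.range fun i : V => pt K i - 1)) ?_ (Submodule.zero_mem _)
      (fun _ _ _ _ => Submodule.add_mem _) ?_ hz
    · rintro _ ⟨i, -, rfl⟩
      exact Submodule.subset_span ⟨i, rfl⟩
    · intro a z _ hz
      exact mul_mem_span a hz
  · rw [Submodule.span_le]
    rintro _ ⟨i, rfl⟩
    exact pt_sub_one_mem trivial

open Pointwise in
lemma IsPolynomialOfDegreeLE.linExt_eq_zero {d : ℕ} {f : V → M} (hf : IsPolynomialOfDegreeLE d f)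
    {z : AddMonoidAlgebra K V} (hz : z ∈ relIdeal K (⊤ : AddSubgroup V) ^ (d + 1)) :
    linExt f z = 0 := by
  have h1 : z ∈ (Submodule.span K (Set.range fun i : V => pt K i - 1)) ^ (d + 1) := by
    rw [← relIdeal_top_eq_span, ← Submodule.restrictScalars_pow (by omega)]
    exact hz
  rw [Submodule.span_pow] at h1
  have h2 : Submodule.span K ((Set.range fun i : V => pt K i - 1) ^ (d + 1)) ≤
      LinearMap.ker (linExt (K := K) f) := by
    rw [Submodule.span_le]
    intro x hx
    rw [Set.mem_pow] at hx
    obtain ⟨g, rfl⟩ := hx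
    choose a ha using fun i => (g i).2
    have := hf a
    rw [deviation_eq_linExt (K := K)] at this
    rw [SetLike.mem_coe, LinearMap.mem_ker, ← this, List.prod_ofFn]
    congr 1
    exact Finset.prod_congr rfl fun i _ => (ha i).symm
  exact h2 h1

lemma IsPolynomialOfDegreeLE.of_linExt {d : ℕ} {f : V → M}
    (hf : ∀ z ∈ relIdeal K (⊤ : AddSubgroup V) ^ (d + 1), linExt f z = 0) :
    IsPolynomialOfDegreeLE d f := fun a => by
  rw [deviation_eq_linExt (K := K)]
  apply hf
  have := Ideal.prod_mem_prod (s := Finset.univ) (I := fun _ : Fin (d + 1) => relIdeal K (⊤ : AddSubgroup V))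
    (x := fun i => pt K (a i) - 1) fun i _ => pt_sub_one_mem trivial
  simpa using this

open Polynomial

/-- Interpolation: for `f` a sum of products of functions invariant under a subgroup containing
`N V` and of polynomial functions, and `q` approximating the `N`-th root, this evaluates the
first factors at `u` and the second ones at `v`. -/
noncomputable def interp (q : K[X]) (N : ℕ) (f : V → M) (u v : V) : M :=
  ∑ j ∈ q.support, q.coeff j • f (u + (j * N) • (v - u))

lemma interp_self {q : K[X]} (hq : q.eval 1 = 1) (N : ℕ) (f : V → M) (v : V) :
    interp q N f v v = f v := by
  rw [Polynomial.eval_eq_sum, Polynomial.sum] at hq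
  simp only [one_pow, mul_one] at hq
  simp [interp, ← Finset.sum_smul, hq]

lemma map_interp {M' : Type*} [AddCommGroup M'] [Module K M'] (φ : M →ₗ[K] M') (q : K[X]) (N : ℕ)
    (f : V → M) (u v : V) : φ (interp q N f u v) = interp q N (fun x => φ (f x)) u v := by
  simp [interp]

lemma interp_comp {V' : Type*} [AddCommGroup V'] (h : V' →+ V) (q : K[X]) (N : ℕ)
    (f : V → M) (u v : V') : interp q N (fun x => f (h x)) u v = interp q N f (h u) (h v) := by
  simp [interp]

section

variable {I : AddSubgroup V} {d N : ℕ} {q : K[X]}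

lemma interp_eq_linExt (f : V → M) (u v : V) :
    interp q N f u v = linExt f (interp q N (pt K) u v) := by
  simp [interp, linExt_pt]

lemma linExt_congr {f : V → M} (hf : ∀ z ∈ relIdeal K I ^ d, linExt f z = 0)
    {z z' : AddMonoidAlgebra K V}
    (h : Ideal.Quotient.mk (relIdeal K I ^ d) z = Ideal.Quotient.mk (relIdeal K I ^ d) z') :
    linExt f z = linExt f z' := by
  rw [← sub_eq_zero, ← map_sub]
  exact hf _ (Ideal.Quotient.eq.1 h)

/-- The universal case of interpolation, for the function `v ↦ [v]` modulo `relIdeal K I ^ d`. There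
`ν` is the unipotent part of `v ↦ [v]`, and interpolating from `u` to `v` gives `[u] ν(v - u)`. The
properties of `interp` for a function `f` whose linear extension kills this ideal power follow by
applying `linExt f`. -/
lemma exists_unipHom_quotient (hN : ∀ v : V, N • v ∈ I) (hN0 : (N : K) ≠ 0) (hq : q.eval 1 = 1)
    (hq' : (X - C 1) ^ d ∣ q ^ N - X) :
    ∃ ν : Multiplicative V →* (AddMonoidAlgebra K V ⧸ relIdeal K I ^ d),
      (∀ v, ν (.ofAdd v) - 1 ∈ (relIdeal K I).map (Ideal.Quotient.mk (relIdeal K I ^ d))) ∧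
      (∀ i ∈ I, ν (.ofAdd i) = Ideal.Quotient.mk _ (pt K i)) ∧
      (∀ u v w, interp q N (fun x => Ideal.Quotient.mk (relIdeal K I ^ d) (pt K u) *
        ν (.ofAdd (x - u))) v (v + w) =
          Ideal.Quotient.mk _ (pt K u) * ν (.ofAdd (v + w - u))) ∧
      ∀ u v, Ideal.Quotient.mk _ (interp q N (pt K) u v) =
        Ideal.Quotient.mk _ (pt K u) * ν (.ofAdd (v - u)) := by
  set mk := Ideal.Quotient.mk (relIdeal K I ^ d) with hmk
  let τ : Multiplicative V →* (AddMonoidAlgebra K V ⧸ relIdeal K I ^ d) :=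
    mk.toMonoidHom.comp (AddMonoidAlgebra.of K V)
  have hτ : ∀ i ∈ I, τ (.ofAdd i) - 1 ∈ (relIdeal K I).map mk := fun i hi => by
    have := Ideal.mem_map_of_mem mk (pt_sub_one_mem (K := K) hi)
    rwa [map_sub, map_one] at this
  have hJ : (relIdeal K I).map mk ^ d = ⊥ := by
    rw [← Ideal.map_pow, hmk, Ideal.map_quotient_self]
  obtain ⟨ν, hν⟩ := exists_unipHom hJ hN hN0 hq hq' τ hτ
  have hsmul : ∀ (c : K) z, mk (c • z) = c • mk z := fun c z => rfl
  -- The coefficients of `interp` are those of `q`, so the sum is `q` evaluated at `[N • v]`.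
  have key : ∀ v, ∑ j ∈ q.support, q.coeff j • τ (.ofAdd (N • v)) ^ j = ν (.ofAdd v) := by
    intro v
    rw [hν, unipPart, aeval_def, eval₂_eq_sum, Polynomial.sum]
    refine Finset.sum_congr rfl fun j _ => ?_
    obtain ⟨z, hz⟩ := Ideal.Quotient.mk_surjective (τ (.ofAdd (N • v)) ^ j)
    rw [← hz, ← hmk, ← hsmul, Algebra.smul_def, map_mul]
    rfl
  refine ⟨ν, fun v => ?_, fun i hi => ?_, fun u v w => ?_, fun u v => ?_⟩
  · rw [hν]
    exact unipPart_sub_one_mem hN hq τ hτ v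
  · rw [hν, unipPart_of_mem hJ hN hN0 hq hq' τ hτ hi]
    rfl
  · have h1 : v + w - u = (v - u) + w := by abel
    rw [h1, ofAdd_add, map_mul, ← key w, interp, ← mul_assoc, Finset.mul_sum]
    refine Finset.sum_congr rfl fun j _ => ?_
    have h2 : v + (j * N) • (v + w - v) - u = (v - u) + j • (N • w) := by
      rw [add_sub_cancel_left, mul_smul]; abel
    -- As `N • w` lies in `I`, on which `ν` agrees with the original character, interpolating `x ↦
    -- ν(x)` reproduces it.
    have h3 : ν (.ofAdd (N • w)) = τ (.ofAdd (N • w)) := by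
      rw [hν, unipPart_of_mem hJ hN hN0 hq hq' τ hτ (hN w)]
    rw [h2, ofAdd_add, map_mul, ofAdd_nsmul, map_pow, h3, mul_smul_comm, mul_assoc]
  · rw [← key (v - u), interp, map_sum, Finset.mul_sum]
    refine Finset.sum_congr rfl fun j _ => ?_
    rw [hsmul, pt_add, map_mul, mul_smul_comm, mul_smul, pt_nsmul, map_pow]
    rfl

variable (hN : ∀ v : V, N • v ∈ I) (hN0 : (N : K) ≠ 0) (hq : q.eval 1 = 1)
  (hq' : (X - C 1) ^ d ∣ q ^ N - X) {f : V → M} (hf : ∀ z ∈ relIdeal K I ^ d, linExt f z = 0)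
include hN hN0 hq hq' hf

lemma interp_eq_of_sub_mem {u v : V} (h : v - u ∈ I) : interp q N f u v = f v := by
  obtain ⟨ν, -, h2, -, h4⟩ := exists_unipHom_quotient (d := d) hN hN0 hq hq'
  rw [interp_eq_linExt, ← linExt_pt (K := K) f v]
  apply linExt_congr hf
  rw [h4, h2 _ h, ← map_mul, ← pt_add, add_sub_cancel]

lemma interp_add_left {i : V} (hi : i ∈ I) (u v : V) :
    interp q N f (u + i) v = interp q N f u v := by
  obtain ⟨ν, -, h2, -, h4⟩ := exists_unipHom_quotient (d := d) hN hN0 hq hq'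
  rw [interp_eq_linExt, interp_eq_linExt f]
  apply linExt_congr hf
  have h : v - u = i + (v - (u + i)) := by abel
  rw [h4, h4, h, ofAdd_add, map_mul, h2 _ hi, pt_add, map_mul, mul_assoc]

/-- The second argument enters only through a unipotent character, which interpolation reproduces
whatever its base point `v`. This is the identity behind `pairMap_comp`. -/
lemma interp_interp (u v w : V) :
    interp q N (fun x => interp q N f u x) v (v + w) = interp q N f u (v + w) := by
  obtain ⟨ν, -, h2, h3, h4⟩ := exists_unipHom_quotient (d := d) hN hN0 hq hq'
  rw [interp_eq_linExt f u (v + w)]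
  have h5 : (fun x => interp q N f u x) = fun x => linExt f (interp q N (pt K) u x) := by
    ext x; rw [interp_eq_linExt]
  rw [h5, ← map_interp]
  apply linExt_congr hf
  rw [h4, ← h3]
  simp only [← h4]
  exact map_interp (Ideal.Quotient.mkₐ K (relIdeal K I ^ d)).toLinearMap _ _ _ _ _

/-- In the universal case the deviation is a multiple of `∏ (ν(a_i) - 1)`, a product of `d` elements
of an ideal whose `d`-th power vanishes. -/
lemma deviation_interp (u : V) (a : Fin d → V) : deviation d (interp q N f u) a = 0 := by
  obtain ⟨ν, h1, h2, h3, h4⟩ := exists_unipHom_quotient (d := d) hN hN0 hq hq'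
  set mk := Ideal.Quotient.mk (relIdeal K I ^ d) with hmk
  have h5 : (interp q N f u) = fun x => linExt f (interp q N (pt K) u x) := by
    ext x; rw [interp_eq_linExt]
  rw [deviation_eq_linExt (K := K), h5, linExt_comp, LinearMap.comp_apply,
    ← map_zero (linExt (K := K) f)]
  apply linExt_congr hf
  let νA : AddMonoidAlgebra K V →ₐ[K] (AddMonoidAlgebra K V ⧸ relIdeal K I ^ d) :=
    AddMonoidAlgebra.lift K _ V ν
  have hνA : ∀ v, νA (pt K v) = ν (.ofAdd v) := fun v => AddMonoidAlgebra.lift_of _ _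
  have h6 : ∀ z, mk (linExt (interp q N (pt K) u) z) = mk (pt K u) * ν (.ofAdd (-u)) * νA z := by
    intro z
    have := LinearMap.congr_fun (hom_ext_pt (M := AddMonoidAlgebra K V ⧸ relIdeal K I ^ d)
      (φ := (Ideal.Quotient.mkₐ K (relIdeal K I ^ d)).toLinearMap ∘ₗ
        linExt (interp q N (pt K) u)) (ψ := LinearMap.mulLeft K (mk (pt K u) * ν (.ofAdd (-u))) ∘ₗ
          νA.toLinearMap) (fun v => by
            simp only [LinearMap.comp_apply, linExt_pt, AlgHom.toLinearMap_apply,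
              Ideal.Quotient.mkₐ_eq_mk, LinearMap.mulLeft_apply, hνA]
            rw [h4, mul_assoc, ← map_mul, ← ofAdd_add, neg_add_eq_sub])) z
    exact this
  rw [h6, map_zero, map_prod]
  have h7 : ∏ i, νA (pt K (a i) - 1) ∈ (relIdeal K I).map mk ^ d := by
    have := Ideal.prod_mem_prod (s := Finset.univ) (I := fun _ : Fin d => (relIdeal K I).map mk)
      (x := fun i => νA (pt K (a i) - 1)) fun i _ => by
        rw [map_sub, hνA, map_one]; exact h1 _
    simpa using this
  rw [← Ideal.map_pow, hmk, Ideal.map_quotient_self, Ideal.mem_bot] at h7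
  rw [h7, mul_zero]

end

end GroupAlgebra

end TensorDecomposition

namespace TensorDecomposition

/-! ### Elementary properties of deviations; torsion of cotrivial quotients -/

section Deviation

variable {U V W : Type*} [AddCommGroup U] [AddCommGroup V] [AddCommGroup W]

lemma deviation_map (d : ℕ) (φ : V →+ W) (f : U → V) (a : Fin d → U) :
    deviation d (fun u => φ (f u)) a = φ (deviation d f a) := by
  simp [deviation]

lemma deviation_comp (d : ℕ) (φ : U →+ V) (f : V → W) (a : Fin d → U) :
    deviation d (fun u => f (φ u)) a = deviation d f (fun i => φ (a i)) := by
  simp [deviation]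

lemma IsPolynomialOfDegreeLE.map {d : ℕ} {f : U → V} (hf : IsPolynomialOfDegreeLE d f)
    (φ : V →+ W) : IsPolynomialOfDegreeLE d fun u => φ (f u) := fun a => by
  rw [deviation_map, hf a, map_zero]

lemma IsPolynomialOfDegreeLE.comp {d : ℕ} {f : V → W} (hf : IsPolynomialOfDegreeLE d f)
    (φ : U →+ V) : IsPolynomialOfDegreeLE d fun u => f (φ u) := fun a => by
  rw [deviation_comp, hf]

variable {K : Type*} [Field K] [Module K V] [Module K W]

lemma deviation_map_linear (d : ℕ) (φ : V →ₗ[K] W) (f : U → V) (a : Fin d → U) :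
    deviation d (fun u => φ (f u)) a = φ (deviation d f a) :=
  deviation_map d φ.toAddMonoidHom f a

lemma IsPolynomialOfDegreeLE.map_linear {d : ℕ} {f : U → V} (hf : IsPolynomialOfDegreeLE d f)
    (φ : V →ₗ[K] W) : IsPolynomialOfDegreeLE d fun u => φ (f u) :=
  hf.map φ.toAddMonoidHom

end Deviation

lemma isPolynomial_iff {A : Type u} [Category.{v} A] [Preadditive A] {K : Type w} [Field K]
    (F : A ⥤ ModuleCat.{w} K) : IsPolynomial F ↔
      ∃ d : ℕ, ∀ x y : A, IsPolynomialOfDegreeLE d (fun f : x ⟶ y => (F.map f).hom) :=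
  exists_congr fun _ => forall₂_congr fun x y =>
    ⟨fun h => h.map (ModuleCat.homAddEquiv (M := F.obj x) (N := F.obj y)).toAddMonoidHom,
      fun h => h.map (ModuleCat.homAddEquiv (M := F.obj x) (N := F.obj y)).symm.toAddMonoidHom⟩

lemma exists_addMonoidHom_ne_zero (k : Type*) [Field k] {Q : Type*} [AddCommGroup Q] [Module k Q]
    {x : Q} (hx : x ≠ 0) : ∃ φ : Q →+ k, φ x ≠ 0 := by
  by_contra! H
  exact hx ((Module.forall_dual_apply_eq_zero_iff k x).1 fun φ => H φ.toAddMonoidHom)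

lemma exists_addMonoidHom_zmod {Q : Type*} [AddCommGroup Q] (p : ℕ) [Fact p.Prime]
    (h : ∀ x : Q, p • x = 0) {x : Q} (hx : x ≠ 0) : ∃ φ : Q →+ ZMod p, φ x ≠ 0 :=
  let _ : Module (ZMod p) Q := AddCommGroup.zmodModule h
  exists_addMonoidHom_ne_zero (ZMod p) hx

/-- The exponent of `Q` works. If it vanished in `K`, a prime `p`, the characteristic, would divide
it. Multiplication by `p` is then not surjective on the finite group `Q`, since otherwise the
exponent could be divided by `p`. So `Q / pQ` is a nonzero vector space over `ZMod p`, and a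
functional on it, followed by `ZMod p → K`, detects a nonzero element of `K ⊗ Q`. -/
lemma exists_nsmul_eq_zero_of_subsingleton_tensor (K : Type*) [Field K] (Q : Type*)
    [AddCommGroup Q] [Finite Q] [Subsingleton (K ⊗[ℤ] Q)] :
    ∃ N : ℕ, (N : K) ≠ 0 ∧ ∀ q : Q, N • q = 0 := by
  refine ⟨AddMonoid.exponent Q, fun h0 => ?_, AddMonoid.exponent_nsmul_eq_zero⟩
  have he : AddMonoid.exponent Q ≠ 0 := AddMonoid.exponent_ne_zero_of_finite
  obtain ⟨p, hp⟩ := CharP.exists K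
  have hpe : p ∣ AddMonoid.exponent Q := (CharP.cast_eq_zero_iff K p _).1 h0
  have hp' : Fact p.Prime := ⟨(CharP.char_is_prime_or_zero K p).resolve_right fun h => by
    subst h; exact he (zero_dvd_iff.1 hpe)⟩
  obtain ⟨e, he'⟩ := hpe
  let m : Q →+ Q := nsmulAddMonoidHom p
  have hm : ¬ Function.Surjective m := by
    intro hs
    have hi : Function.Injective m := Finite.injective_iff_surjective.2 hs
    have h1 : AddMonoid.exponent Q ∣ e := AddMonoid.exponent_dvd_of_forall_nsmul_eq_zero fun q => by
      apply hi
      rw [map_zero]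
      change p • e • q = 0
      rw [← mul_nsmul', ← he']
      exact AddMonoid.exponent_nsmul_eq_zero q
    have h2 := Nat.le_of_dvd (Nat.pos_of_ne_zero fun h => by simp [h] at he'; exact he he') h1
    have := hp'.out.two_le
    have : 0 < e := Nat.pos_of_ne_zero fun h => by simp [h] at he'; exact he he'
    nlinarith
  obtain ⟨q, hq⟩ := not_forall.1 hm
  have hq0 : (QuotientAddGroup.mk q : Q ⧸ m.range) ≠ 0 := fun h =>
    hq ((QuotientAddGroup.eq_zero_iff _).1 h)
  obtain ⟨φ, hφ⟩ := exists_addMonoidHom_zmod p (fun x : Q ⧸ m.range => by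
    obtain ⟨q, rfl⟩ := QuotientAddGroup.mk_surjective x
    rw [← QuotientAddGroup.mk_nsmul]
    exact (QuotientAddGroup.eq_zero_iff _).2 ⟨q, rfl⟩) hq0
  let f : Q →+ K := (ZMod.castHom dvd_rfl K : ZMod p →+* K).toAddMonoidHom.comp
    (φ.comp (QuotientAddGroup.mk' m.range))
  have hf : f q ≠ 0 := fun h => hφ (RingHom.injective (ZMod.castHom dvd_rfl K : ZMod p →+* K)
    (by rw [map_zero]; exact h))
  let Φ := TensorProduct.liftAddHom (R := ℤ) ((AddMonoidHom.mul (R := K)).compl₂ f)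
    (fun r k q => by simp; ring)
  have h1 : Φ (1 ⊗ₜ q) = f q := by
    simp only [Φ, TensorProduct.liftAddHom_tmul]
    simp
  rw [Subsingleton.elim (1 ⊗ₜ[ℤ] q : K ⊗[ℤ] Q) 0, map_zero] at h1
  exact hf h1.symm

/-! ### Bifunctors of bounded type and their diagonals -/

section Bifunctor

variable {A : Type u} [Category.{v} A] {K : Type w} [Field K]

open CategoryTheory.Prod

/-- The linear map induced by a bifunctor on a pair of morphisms. -/
def bmap (B : A × A ⥤ ModuleCat.{w} K) {x x' y y' : A} (f : x ⟶ x') (g : y ⟶ y') :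
    B.obj (x, y) →ₗ[K] B.obj (x', y') :=
  (B.map (f ×ₘ g)).hom

lemma bmap_comp (B : A × A ⥤ ModuleCat.{w} K) {x x' x'' y y' y'' : A} (f : x ⟶ x') (f' : x' ⟶ x'')
    (g : y ⟶ y') (g' : y' ⟶ y'') :
    bmap B (f ≫ f') (g ≫ g') = bmap B f' g' ∘ₗ bmap B f g := by
  have : (f ≫ f' ×ₘ g ≫ g') = (f ×ₘ g) ≫ (f' ×ₘ g') := rfl
  rw [bmap, this, B.map_comp]
  rfl

lemma bmap_id (B : A × A ⥤ ModuleCat.{w} K) (x y : A) :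
    bmap B (𝟙 x) (𝟙 y) = LinearMap.id := by
  have : (𝟙 x ×ₘ 𝟙 y) = 𝟙 (x, y) := rfl
  rw [bmap, this, B.map_id]
  rfl

lemma bmap_eq_comp (B : A × A ⥤ ModuleCat.{w} K) {x x' y y' : A} (f : x ⟶ x') (g : y ⟶ y') :
    bmap B f g = bmap B (𝟙 x') g ∘ₗ bmap B f (𝟙 y) := by
  rw [← bmap_comp, Category.comp_id, Category.id_comp]

lemma bmap_eq_comp' (B : A × A ⥤ ModuleCat.{w} K) {x x' y y' : A} (f : x ⟶ x') (g : y ⟶ y') :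
    bmap B f g = bmap B f (𝟙 y') ∘ₗ bmap B (𝟙 x) g := by
  rw [← bmap_comp, Category.comp_id, Category.id_comp]

variable [Preadditive A]

/-- A bifunctor which is invariant under `N`-th multiples in the first variable, where `N` is
invertible in the field, and polynomial of degree at most `d` in the second one. -/
structure HasBitype (B : A × A ⥤ ModuleCat.{w} K) (N d : ℕ) : Prop where
  ne_zero : (N : K) ≠ 0
  fst : ∀ {x x' : A} (y : A) (f g : x ⟶ x'), bmap B (f + N • g) (𝟙 y) = bmap B f (𝟙 y)
  snd : ∀ (x y y' : A), IsPolynomialOfDegreeLE d fun g : y ⟶ y' => bmap B (𝟙 x) g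

lemma IsPolynomialOfDegreeLE.mono {U V : Type*} [AddCommGroup U] [AddCommGroup V] [Module K V]
    {d d' : ℕ} (h : d ≤ d')
    {f : U → V} (hf : IsPolynomialOfDegreeLE d f) : IsPolynomialOfDegreeLE d' f :=
  .of_linExt (K := K) fun _ hz => hf.linExt_eq_zero (Ideal.pow_le_pow_right (by omega) hz)

lemma HasBitype.mono {B : A × A ⥤ ModuleCat.{w} K} {N d N' d' : ℕ} (hB : HasBitype B N d)
    (hN : (N' : K) ≠ 0) (hNN' : N ∣ N') (hd : d ≤ d') : HasBitype B N' d' where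
  ne_zero := hN
  fst y f g := by
    obtain ⟨k, rfl⟩ := hNN'
    rw [mul_nsmul', hB.fst]
  snd x y y' := (hB.snd x y y').mono (K := K) hd

open Polynomial in
/-- The action of a pair of morphisms is a linear combination of actions of diagonal pairs. -/
lemma HasBitype.bmap_eq_interp {B : A × A ⥤ ModuleCat.{w} K} {N d : ℕ} (hB : HasBitype B N d)
    {q : K[X]} (hq : q.eval 1 = 1) (hq' : (X - C 1) ^ (d + 1) ∣ q ^ N - X) {x y : A}
    (f g : x ⟶ y) : bmap B f g = interp q N (fun h : x ⟶ y => bmap B h h) f g := by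
  rw [bmap_eq_comp, ← interp_eq_of_sub_mem (K := K) (I := ⊤) (f := fun h : x ⟶ y => bmap B (𝟙 y) h)
    (fun _ => trivial) hB.ne_zero hq hq' (fun z hz => (hB.snd y x y).linExt_eq_zero hz) (u := f)
    trivial]
  have := map_interp (LinearMap.lcomp K (B.obj (y, y)) (bmap B f (𝟙 x))) q N
    (fun h : x ⟶ y => bmap B (𝟙 y) h) f g
  refine Eq.trans this ?_
  refine Finset.sum_congr rfl fun j _ => ?_
  congr 1
  change bmap B (𝟙 y) _ ∘ₗ bmap B f (𝟙 x) = bmap B (f + (j * N) • (g - f)) _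
  rw [bmap_eq_comp B (f + _), mul_comm, mul_nsmul', hB.fst]

/-- A bifunctor with diagonal values simple is simple. -/
lemma simple_of_simple_diag [HasBinaryBiproducts A] {B : A × A ⥤ ModuleCat.{w} K}
    (h : Simple (Functor.diag A ⋙ B)) : Simple B := by
  rw [simple_iff_subfamily] at h ⊢
  obtain ⟨⟨x, hx⟩, h⟩ := h
  refine ⟨⟨(x, x), hx⟩, fun G => ?_⟩
  -- The pair `(x, y)` is a retract of the diagonal pair at `x ⊞ y`, so a subfunctor of `B` is
  -- determined by its diagonal values.
  have hr : ∀ (x y : A) (m : B.obj (x, y)),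
      bmap B biprod.fst biprod.snd (bmap B (biprod.inl : x ⟶ x ⊞ y) (biprod.inr : y ⟶ x ⊞ y) m)
        = m := by
    intro x y m
    rw [← LinearMap.comp_apply, ← bmap_comp, biprod.inl_fst, biprod.inr_snd, bmap_id]
    rfl
  rcases h ⟨fun x => G.obj (x, x), fun f _ hm => G.map_mem (f ×ₘ f) hm⟩ with h | h
  · left
    rintro ⟨x, y⟩
    rw [eq_bot_iff]
    intro m hm
    have h1 : bmap B (biprod.inl : x ⟶ x ⊞ y) (biprod.inr : y ⟶ x ⊞ y) m ∈ G.obj (x ⊞ y, x ⊞ y) :=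
      G.map_mem _ hm
    have h2 : G.obj (x ⊞ y, x ⊞ y) = ⊥ := h (x ⊞ y)
    rw [h2, Submodule.mem_bot] at h1
    rw [Submodule.mem_bot, ← hr x y m, h1, map_zero]
  · right
    rintro ⟨x, y⟩
    rw [eq_top_iff]
    intro m _
    have h2 : G.obj (x ⊞ y, x ⊞ y) = ⊤ := h (x ⊞ y)
    rw [← hr x y m]
    exact G.map_mem (biprod.fst ×ₘ biprod.snd) (by rw [h2]; trivial)

/-- By `HasBitype.bmap_eq_interp` a subfunctor of the diagonal is stable under all `B(f, g)`, not
only the `B(f, f)`. Pulling it back along the inclusion of `(x, y)` in `(x ⊞ y, x ⊞ y)` extends it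
to a subfunctor of `B`. -/
lemma HasBitype.simple_diag [HasBinaryBiproducts A] {B : A × A ⥤ ModuleCat.{w} K} {N d : ℕ}
    (hB : HasBitype B N d) (h : Simple B) : Simple (Functor.diag A ⋙ B) := by
  obtain ⟨q, hq, hq'⟩ := exists_polynomial_root hB.ne_zero d
  rw [simple_iff_subfamily] at h ⊢
  obtain ⟨⟨⟨x, y⟩, hx⟩, h⟩ := h
  have hr : ∀ (x y : A) (m : B.obj (x, y)),
      bmap B biprod.fst biprod.snd (bmap B (biprod.inl : x ⟶ x ⊞ y) (biprod.inr : y ⟶ x ⊞ y) m)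
        = m := by
    intro x y m
    rw [← LinearMap.comp_apply, ← bmap_comp, biprod.inl_fst, biprod.inr_snd, bmap_id]
    rfl
  constructor
  · obtain ⟨m, hm⟩ := exists_ne (0 : B.obj (x, y))
    refine ⟨x ⊞ y, bmap B biprod.inl biprod.inr m, 0, fun h0 => hm ?_⟩
    rw [← hr x y m, h0]
    exact map_zero _
  · intro G
    have hG : ∀ {x y : A} (f g : x ⟶ y) {m : B.obj (x, x)}, m ∈ G.obj x →
        bmap B f g m ∈ G.obj y := by
      intro x y f g m hm
      rw [hB.bmap_eq_interp hq hq', interp, LinearMap.sum_apply]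
      exact Submodule.sum_mem _ fun j _ => Submodule.smul_mem _ _ (G.map_mem _ hm)
    let G' : Subfamily B :=
      { obj := fun p => (G.obj (p.1 ⊞ p.2)).comap (bmap B biprod.inl biprod.inr)
        map_mem := by
          rintro ⟨x, y⟩ ⟨x', y'⟩ ⟨f, g⟩ m hm
          rw [Submodule.mem_comap] at hm ⊢
          have := hG (biprod.map f g) (biprod.map f g) hm
          rw [← LinearMap.comp_apply, ← bmap_comp, biprod.inl_map, biprod.inr_map, bmap_comp] at this
          exact this }
    have hGG' : ∀ x, G.obj x = G'.obj (x, x) := by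
      intro x
      apply le_antisymm
      · intro m hm
        exact hG _ _ hm
      · intro m hm
        rw [← hr x x m]
        exact hG _ _ hm
    rcases h G' with h | h
    · exact Or.inl fun x => (hGG' x).trans (h _)
    · exact Or.inr fun x => (hGG' x).trans (h _)

/-- An isomorphism of diagonals commutes with the off-diagonal actions, because these are the same
combinations of diagonal actions on both sides. The retraction of the diagonal pair at `x ⊞ y` onto
`(x, y)` then carries it to all values. -/
lemma HasBitype.nonempty_iso [HasBinaryBiproducts A] {B B' : A × A ⥤ ModuleCat.{w} K}
    {N d N' d' : ℕ} (hB : HasBitype B N d) (hB' : HasBitype B' N' d')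
    (e : Functor.diag A ⋙ B ≅ Functor.diag A ⋙ B') : Nonempty (B ≅ B') := by
  -- Passing to `N * N'` and `max d d'` allows one polynomial `q` to serve for both bifunctors.
  have hN : ((N * N' : ℕ) : K) ≠ 0 := by
    rw [Nat.cast_mul]; exact mul_ne_zero hB.ne_zero hB'.ne_zero
  replace hB := hB.mono hN (dvd_mul_right _ _) (le_max_left d d')
  replace hB' := hB'.mono hN (dvd_mul_left _ _) (le_max_right d d')
  obtain ⟨q, hq, hq'⟩ := exists_polynomial_root hN (max d d')
  have hnat : ∀ {x y : A} (f g : x ⟶ y), B.map (f ×ₘ g) ≫ e.hom.app y =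
      e.hom.app x ≫ B'.map (f ×ₘ g) := by
    intro x y f g
    apply ModuleCat.hom_ext
    change (e.hom.app y).hom ∘ₗ bmap B f g = bmap B' f g ∘ₗ (e.hom.app x).hom
    rw [hB.bmap_eq_interp hq hq', hB'.bmap_eq_interp hq hq', interp, interp]
    ext m
    simp only [LinearMap.comp_apply, LinearMap.sum_apply, map_sum, LinearMap.smul_apply, map_smul]
    refine Finset.sum_congr rfl fun j _ => ?_
    congr 1
    exact NatTrans.naturality_apply e.hom _ m
  have hnat' : ∀ {x y : A} (f g : x ⟶ y), B'.map (f ×ₘ g) ≫ e.inv.app y =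
      e.inv.app x ≫ B.map (f ×ₘ g) := by
    intro x y f g
    rw [← cancel_mono (e.hom.app y), ← cancel_epi (e.hom.app x)]
    simp only [Category.assoc, Iso.inv_hom_id_app, Iso.hom_inv_id_app_assoc, hnat]
    erw [Category.comp_id]
    rfl
  have hm : ∀ (B : A × A ⥤ ModuleCat.{w} K) {x x' x'' y y' y'' : A} (f : x ⟶ x') (f' : x' ⟶ x'')
    (g : y ⟶ y') (g' : y' ⟶ y''), B.map (f ×ₘ g) ≫ B.map (f' ×ₘ g') =
      B.map (f ≫ f' ×ₘ g ≫ g') := fun B _ _ _ _ _ _ f f' g g' => (B.map_comp _ _).symm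
  have hi : ∀ (B : A × A ⥤ ModuleCat.{w} K) (x y : A), B.map (𝟙 x ×ₘ 𝟙 y) = 𝟙 _ :=
    fun B x y => B.map_id _
  have hcomp : ∀ (B B' : A × A ⥤ ModuleCat.{w} K) (φ : ∀ x : A, B.obj (x, x) ⟶ B'.obj (x, x))
      (ψ : ∀ x : A, B'.obj (x, x) ⟶ B.obj (x, x)) (_ : ∀ x, φ x ≫ ψ x = 𝟙 _)
      (_ : ∀ {x y : A} (f g : x ⟶ y), B'.map (f ×ₘ g) ≫ ψ y = ψ x ≫ B.map (f ×ₘ g)) (x y : A),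
      (B.map (biprod.inl ×ₘ biprod.inr : (x, y) ⟶ (x ⊞ y, x ⊞ y)) ≫ φ (x ⊞ y) ≫
          B'.map (biprod.fst ×ₘ biprod.snd)) ≫
        B'.map (biprod.inl ×ₘ biprod.inr : (x, y) ⟶ (x ⊞ y, x ⊞ y)) ≫ ψ (x ⊞ y) ≫
          B.map (biprod.fst ×ₘ biprod.snd) = 𝟙 _ := by
    intro B B' φ ψ hφ hψ x y
    simp only [Category.assoc]
    rw [reassoc_of% (hm B'), reassoc_of% hψ, reassoc_of% hφ, hm, hm]
    simp [hi]
  refine ⟨NatIso.ofComponents (fun p =>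
    { hom := B.map (biprod.inl ×ₘ biprod.inr : (p.1, p.2) ⟶ (p.1 ⊞ p.2, p.1 ⊞ p.2)) ≫
        e.hom.app (p.1 ⊞ p.2) ≫ B'.map (biprod.fst ×ₘ biprod.snd)
      inv := B'.map (biprod.inl ×ₘ biprod.inr : (p.1, p.2) ⟶ (p.1 ⊞ p.2, p.1 ⊞ p.2)) ≫
        e.inv.app (p.1 ⊞ p.2) ≫ B.map (biprod.fst ×ₘ biprod.snd)
      hom_inv_id := hcomp B B' (fun x => e.hom.app x) (fun x => e.inv.app x)
        (fun x => e.hom_inv_id_app x) (fun f g => hnat' f g) p.1 p.2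
      inv_hom_id := hcomp B' B (fun x => e.inv.app x) (fun x => e.hom.app x)
        (fun x => e.inv_hom_id_app x) (fun f g => hnat f g) p.1 p.2 }) ?_⟩
  rintro ⟨x, y⟩ ⟨x', y'⟩ ⟨f, g⟩
  change B.map (f ×ₘ g) ≫ B.map (biprod.inl ×ₘ biprod.inr) ≫ _ ≫ B'.map _ =
    (B.map (biprod.inl ×ₘ biprod.inr) ≫ _ ≫ B'.map _) ≫ B'.map (f ×ₘ g)
  have h1 : B.map (f ×ₘ g) ≫ B.map (biprod.inl ×ₘ biprod.inr) =
      B.map (biprod.inl ×ₘ biprod.inr) ≫ B.map (biprod.map f g ×ₘ biprod.map f g) := by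
    rw [hm, hm]; simp
  have h2 : B'.map (biprod.fst ×ₘ biprod.snd) ≫ B'.map (f ×ₘ g) =
      B'.map (biprod.map f g ×ₘ biprod.map f g) ≫ B'.map (biprod.fst ×ₘ biprod.snd) := by
    rw [hm, hm]; simp
  simp only [Category.assoc]
  rw [reassoc_of% h1, h2]
  have h3 := congrArg (fun t => B.map (biprod.inl ×ₘ biprod.inr : (x, y) ⟶ (x ⊞ y, x ⊞ y)) ≫ t ≫
    B'.map (biprod.fst ×ₘ biprod.snd : (x' ⊞ y', x' ⊞ y') ⟶ (x', y')))
    (hnat (biprod.map f g) (biprod.map f g))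
  simpa only [Category.assoc] using h3

lemma CatIdeal.IsCotrivial.exists_nsmul_mem {I : CatIdeal A} (hI : I.IsCotrivial K) (x y : A) :
    ∃ N : ℕ, (N : K) ≠ 0 ∧ ∀ f : x ⟶ y, N • f ∈ I.hom x y := by
  have := (hI x y).1
  have := (hI x y).2
  obtain ⟨N, hN, h⟩ := exists_nsmul_eq_zero_of_subsingleton_tensor K ((x ⟶ y) ⧸ I.hom x y)
  refine ⟨N, hN, fun f => ?_⟩
  have := h (QuotientAddGroup.mk f)
  rw [← QuotientAddGroup.mk_nsmul] at this
  exact (QuotientAddGroup.eq_zero_iff _).1 this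

lemma IsPolynomialSnd.exists_bmap {B : A × A ⥤ ModuleCat.{w} K} (h : IsPolynomialSnd B) (x : A) :
    ∃ d, ∀ y y' : A, IsPolynomialOfDegreeLE d fun g : y ⟶ y' => bmap B (𝟙 x) g :=
  (isPolynomial_iff _).1 (h x)

/-- A simple bifunctor which is antipolynomial in the first variable and polynomial in the second
one is so uniformly. -/
lemma exists_hasBitype {B : A × A ⥤ ModuleCat.{w} K} (hB : Simple B)
    (h1 : IsAntipolynomialFst B) (h2 : IsPolynomialSnd B) : ∃ N d, HasBitype B N d := by
  obtain ⟨⟨x₀, y₀⟩, h0⟩ := exists_nontrivial hB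
  obtain ⟨I, hI, hI'⟩ := (h1 y₀).exists_map_eq
  obtain ⟨d, hd⟩ := h2.exists_bmap x₀
  obtain ⟨N, hN, hN'⟩ := hI.exists_nsmul_mem x₀ x₀
  refine ⟨N, d, hN, fun {x x'} y f g => ?_, fun x y y' a => ?_⟩
  · rw [← sub_eq_zero]
    -- Sandwiching with arbitrary morphisms from and to `(x₀, y₀)` reduces the claim to
    -- endomorphisms there, where the single ideal of `B(-, y₀)` applies; this is where uniformity
    -- comes from. The degree bound below is obtained likewise from `B(x₀, -)`.
    refine eq_zero_of_simple hB (x₀, y₀) fun b a => ?_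
    change bmap B a.1 a.2 ∘ₗ _ ∘ₗ bmap B b.1 b.2 = 0
    rw [LinearMap.sub_comp, LinearMap.comp_sub, ← bmap_comp, ← bmap_comp, ← bmap_comp, ← bmap_comp,
      sub_eq_zero, bmap_eq_comp, bmap_eq_comp B ((b.1 ≫ f) ≫ a.1)]
    simp only [Category.assoc]
    congr 1
    have : ((Prod.sectL A y₀ ⋙ B).map (b.1 ≫ (f + N • g) ≫ a.1)).hom =
        ((Prod.sectL A y₀ ⋙ B).map (b.1 ≫ f ≫ a.1)).hom := by
      congr 1
      apply hI'
      simpa using hN' (b.1 ≫ g ≫ a.1)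
    exact this
  · refine eq_zero_of_simple hB (x₀, y₀) fun b c => ?_
    have h3 : IsPolynomialOfDegreeLE d (fun g : y ⟶ y' => bmap B c.1 c.2 ∘ₗ bmap B (𝟙 x) g ∘ₗ
        bmap B b.1 b.2) := by
      have h4 := (IsPolynomialOfDegreeLE.comp (hd y₀ y₀)
        ((Preadditive.leftComp _ b.2).comp (Preadditive.rightComp _ c.2))).map_linear
          (LinearMap.llcomp K (B.obj (x₀, y₀)) _ _ (bmap B (b.1 ≫ c.1) (𝟙 y₀)))
      convert h4 using 2 with g
      have : b.1 ≫ 𝟙 x = b.1 := Category.comp_id _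
      rw [← bmap_comp, ← bmap_comp, this, Category.assoc, bmap_eq_comp']
      rfl
    have := h3 a
    have h6 := deviation_map_linear (K := K) (d + 1) ((LinearMap.llcomp K _ _ _ (bmap B c.1 c.2)) ∘ₗ
      (LinearMap.lcomp K (B.obj (x, y')) (bmap B b.1 b.2)))
      (fun g : y ⟶ y' => bmap B (𝟙 x) g) a
    exact h6.symm.trans this

end Bifunctor

end TensorDecomposition

namespace TensorDecomposition

/-! ### From a functor of mixed type to a bifunctor -/

section Extension

variable {A : Type u} [Category.{v} A] [Preadditive A] {K : Type w} [Field K]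

open CategoryTheory.Prod

/-- The functor `F` acts on morphisms through sums of products of functions invariant under `I`
and of polynomial functions of degree at most `d`, where `N • A ⊆ I` and `N` is invertible. -/
structure HasMixedType (F : A ⥤ ModuleCat.{w} K) (I : CatIdeal A) (N d : ℕ) : Prop where
  ne_zero : (N : K) ≠ 0
  nsmul_mem : ∀ {x y : A} (f : x ⟶ y), N • f ∈ I.hom x y
  linExt_eq_zero : ∀ {x y : A}, ∀ z ∈ relIdeal K (I.hom x y) ^ (d + 1),
    linExt (fun f : x ⟶ y => (F.map f).hom) z = 0

open Polynomial

/-- The action of pairs of morphisms extending the action of a functor on diagonal pairs. -/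
noncomputable def pairMap (q : K[X]) (N : ℕ) (F : A ⥤ ModuleCat.{w} K) {x y : A} (f g : x ⟶ y) :
    F.obj x →ₗ[K] F.obj y :=
  interp q N (fun h : x ⟶ y => (F.map h).hom) f g

variable {F : A ⥤ ModuleCat.{w} K} {I : CatIdeal A} {N d : ℕ} {q : K[X]}

lemma pairMap_self (hq : q.eval 1 = 1) {x y : A} (f : x ⟶ y) :
    pairMap q N F f f = (F.map f).hom :=
  interp_self hq _ _ _

lemma map_comp_pairMap {x y z : A} (f g : x ⟶ y) (h : y ⟶ z) :
    (F.map h).hom ∘ₗ pairMap q N F f g = pairMap q N F (f ≫ h) (g ≫ h) := by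
  have h1 := map_interp (LinearMap.llcomp K (F.obj x) _ _ (F.map h).hom) q N
    (fun h : x ⟶ y => (F.map h).hom) f g
  have h2 := interp_comp (Preadditive.rightComp x h) q N
    (fun h : x ⟶ z => (F.map h).hom) f g
  refine h1.trans (Eq.trans ?_ h2)
  congr 1
  ext k : 1
  exact congrArg ModuleCat.Hom.hom (F.map_comp k h).symm

variable (hF : HasMixedType F I N d) (hq : q.eval 1 = 1)
  (hq' : (X - C 1) ^ (d + 1) ∣ q ^ N - X)
include hF hq hq'

lemma pairMap_add_left {x y : A} (f g : x ⟶ y) {i : x ⟶ y} (hi : i ∈ I.hom x y) :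
    pairMap q N F (f + i) g = pairMap q N F f g :=
  interp_add_left (fun v => hF.nsmul_mem v) hF.ne_zero hq hq' hF.linExt_eq_zero hi f g

lemma pairMap_congr_left {x y : A} {f f' : x ⟶ y} (g : x ⟶ y) (hi : f - f' ∈ I.hom x y) :
    pairMap q N F f g = pairMap q N F f' g := by
  rw [← pairMap_add_left hF hq hq' f' g hi, add_sub_cancel]

lemma isPolynomialOfDegreeLE_pairMap {x y : A} (f : x ⟶ y) :
    IsPolynomialOfDegreeLE d fun g : x ⟶ y => pairMap q N F f g :=
  fun a => deviation_interp (fun v => hF.nsmul_mem v) hF.ne_zero hq hq' hF.linExt_eq_zero f a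

/-- Expanding only the left factor and pushing the ordinary morphisms `f' + jN(g' - f')` through the
right one yields pair actions. Their first arguments differ from `f ≫ f'` by elements of `I`, and
the remaining sum is an iterated interpolation. -/
lemma pairMap_comp {x y z : A} (f g : x ⟶ y) (f' g' : y ⟶ z) :
    pairMap q N F f' g' ∘ₗ pairMap q N F f g = pairMap q N F (f ≫ f') (g ≫ g') := by
  have h1 := map_interp (LinearMap.lcomp K (F.obj z) (pairMap q N F f g)) q N
    (fun h : y ⟶ z => (F.map h).hom) f' g'
  refine Eq.trans h1 ?_
  have h2 := interp_interp (fun v : x ⟶ z => hF.nsmul_mem v) hF.ne_zero hq hq' hF.linExt_eq_zero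
    (f ≫ f') (g ≫ f') (g ≫ g' - g ≫ f')
  rw [add_sub_cancel] at h2
  refine Eq.trans ?_ h2
  refine Finset.sum_congr rfl fun j _ => ?_
  congr 1
  change (F.map _).hom ∘ₗ pairMap q N F f g = pairMap q N F (f ≫ f') _
  -- The first argument may be shifted by `N • (j • f ≫ (g' - f'))`, which lies in the ideal.
  rw [map_comp_pairMap, ← pairMap_add_left hF hq hq' (f ≫ f') _
    (hF.nsmul_mem (j • (f ≫ (g' - f'))))]
  congr 1
  · rw [Preadditive.comp_add, ← mul_nsmul', mul_comm, Preadditive.comp_nsmul]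
  · rw [Preadditive.comp_add, Preadditive.comp_nsmul, Preadditive.comp_sub]

omit hF hq hq'

variable [HasBinaryBiproducts A]

/-- The biproduct as a functor of two variables. -/
@[simps]
noncomputable def biprodFunctor (A : Type u) [Category.{v} A] [Preadditive A]
    [HasBinaryBiproducts A] : A × A ⥤ A where
  obj p := p.1 ⊞ p.2
  map f := biprod.map f.1 f.2

/-- The projector of `F (x ⊞ y)` onto the value at `(x, y)` of the bifunctor attached to `F`. -/
noncomputable abbrev pairProj (q : K[X]) (N : ℕ) (F : A ⥤ ModuleCat.{w} K) (x y : A) :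
    F.obj (x ⊞ y) →ₗ[K] F.obj (x ⊞ y) :=
  pairMap q N F (biprod.fst ≫ biprod.inl) (biprod.snd ≫ biprod.inr)

include hF hq hq'

lemma pairProj_natural {x y x' y' : A} (f : x ⟶ x') (g : y ⟶ y') :
    (F.map (biprod.map f g)).hom ∘ₗ pairProj q N F x y =
      pairProj q N F x' y' ∘ₗ (F.map (biprod.map f g)).hom := by
  rw [map_comp_pairMap, ← pairMap_self (N := N) hq, pairMap_comp hF hq hq']
  congr 1 <;> simp

/-- The values of the bifunctor attached to `F`. -/
noncomputable def pairFamily : Subfamily (biprodFunctor A ⋙ F) where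
  obj p := LinearMap.range (pairProj q N F p.1 p.2)
  map_mem := by
    rintro ⟨x, y⟩ ⟨x', y'⟩ ⟨f, g⟩ _ ⟨m, rfl⟩
    exact ⟨(F.map (biprod.map f g)).hom m,
      (LinearMap.congr_fun (pairProj_natural hF hq hq' f g) m).symm⟩

/-- On the image of the projector, `biprod.map f g` acts as a pair in which `f` occurs only in the
first slot and `g` only in the second. Invariance under `I` in one variable and polynomiality in the
other then come from the two slots of `pairMap`. -/
lemma pairFamily_bmap {x y x' y' : A} (f : x ⟶ x') (g : y ⟶ y')
    (m : (pairFamily hF hq hq').toFunctor.obj (x, y)) :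
    (bmap (pairFamily hF hq hq').toFunctor f g m).1 =
      pairMap q N F (biprod.fst ≫ f ≫ biprod.inl) (biprod.snd ≫ g ≫ biprod.inr) m.1 := by
  obtain ⟨m, m, rfl⟩ := m
  have h1 := LinearMap.congr_fun (map_comp_pairMap (q := q) (N := N) (F := F)
    (biprod.fst ≫ biprod.inl) (biprod.snd ≫ biprod.inr) (biprod.map f g)) m
  have h2 := LinearMap.congr_fun (pairMap_comp hF hq hq' (biprod.fst ≫ biprod.inl : x ⊞ y ⟶ _)
    (biprod.snd ≫ biprod.inr) (biprod.fst ≫ f ≫ biprod.inl)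
    (biprod.snd ≫ g ≫ biprod.inr : x ⊞ y ⟶ x' ⊞ y')) m
  refine Eq.trans h1 (Eq.trans ?_ h2.symm)
  congr 2 <;> simp

lemma pairFamily_bmap_congr {x y x' y' : A} {f f' : x ⟶ x'} (h : f - f' ∈ I.hom x x')
    (g : y ⟶ y') : bmap (pairFamily hF hq hq').toFunctor f g =
      bmap (pairFamily hF hq hq').toFunctor f' g := by
  ext m
  apply Subtype.ext
  rw [pairFamily_bmap, pairFamily_bmap, pairMap_congr_left hF hq hq']
  rw [← Preadditive.comp_sub, ← Preadditive.sub_comp]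
  exact I.comp_mem_left _ (I.comp_mem_right _ h)

lemma pairFamily_isPolynomialSnd : IsPolynomialSnd (pairFamily hF hq hq').toFunctor := by
  intro x
  rw [isPolynomial_iff]
  refine ⟨d, fun y y' a => ?_⟩
  ext m
  apply Subtype.ext
  have h1 := ((isPolynomialOfDegreeLE_pairMap hF hq hq'
    (biprod.fst ≫ 𝟙 x ≫ biprod.inl : x ⊞ y ⟶ x ⊞ y')).comp
    ((Preadditive.rightComp _ biprod.inr).comp
      (Preadditive.leftComp y' (biprod.snd : x ⊞ y ⟶ y)))).map_linear (LinearMap.applyₗ m.1) a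
  have h2 := deviation_map_linear (K := K) (d + 1)
    ((Submodule.subtype ((pairFamily hF hq hq').obj (x, y'))) ∘ₗ LinearMap.applyₗ m)
    (fun g : y ⟶ y' => bmap (pairFamily hF hq hq').toFunctor (𝟙 x) g) a
  refine Eq.trans h2.symm (Eq.trans ?_ h1)
  congr 1
  ext g
  refine (pairFamily_bmap hF hq hq' (𝟙 x) g m).trans ?_
  rw [← Category.assoc biprod.snd g]
  rfl

/-- The pair `(inl, inr)` maps `F x` to the image of the projector, and `(fst, snd)` maps back. The
composites of pairs are `(𝟙, 𝟙)` and the projector itself. -/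
lemma pairFamily_diag : Nonempty (F ≅ Functor.diag A ⋙ (pairFamily hF hq hq').toFunctor) := by
  have h0 : ∀ (x : A) (m : F.obj x), pairMap q N F biprod.inl biprod.inr m ∈
      LinearMap.range (pairProj q N F x x) := fun x m =>
    ⟨pairMap q N F biprod.inl biprod.inr m, by
      rw [← LinearMap.comp_apply, pairMap_comp hF hq hq']; simp⟩
  let η : F ⟶ Functor.diag A ⋙ (pairFamily hF hq hq').toFunctor :=
    { app := fun x => ModuleCat.ofHom
        (LinearMap.codRestrict _ (pairMap q N F biprod.inl biprod.inr) (h0 x))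
      naturality := by
        intro x y f
        ext m
        apply Subtype.ext
        have h1 := LinearMap.congr_fun (map_comp_pairMap (q := q) (N := N) (F := F)
          (biprod.inl : x ⟶ x ⊞ x) biprod.inr (biprod.map f f)) m
        have h2 := LinearMap.congr_fun (pairMap_comp hF hq hq' f f
          (biprod.inl : y ⟶ y ⊞ y) biprod.inr) m
        rw [pairMap_self hq] at h2
        refine Eq.trans h2 (Eq.trans ?_ h1.symm)
        rw [biprod.inl_map, biprod.inr_map] }
  have : IsIso η := isIso_iff_bijective η fun x => by
    constructor
    · intro m m' h
      have h1 := congrArg (pairMap q N F biprod.fst biprod.snd) (congrArg Subtype.val h)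
      change pairMap q N F biprod.fst biprod.snd (pairMap q N F biprod.inl biprod.inr m) =
        pairMap q N F biprod.fst biprod.snd (pairMap q N F biprod.inl biprod.inr m') at h1
      rw [← LinearMap.comp_apply, ← LinearMap.comp_apply, pairMap_comp hF hq hq', biprod.inl_fst,
        biprod.inr_snd, pairMap_self hq] at h1
      simpa using h1
    · rintro ⟨_, m, rfl⟩
      refine ⟨pairMap q N F biprod.fst biprod.snd m, Subtype.ext ?_⟩
      exact LinearMap.congr_fun (pairMap_comp hF hq hq' (biprod.fst : x ⊞ x ⟶ x) biprod.snd
        biprod.inl biprod.inr) m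
  exact ⟨asIso η⟩

omit hq hq' in
/-- A functor of mixed type is the diagonal of a bifunctor invariant under `I` in the first
variable and polynomial in the second one. -/
lemma HasMixedType.exists_bifunctor :
    ∃ B : A × A ⥤ ModuleCat.{w} K, (FiniteDimValued F → FiniteDimValued B) ∧
      (∀ {x x' : A} (y : A) (f f' : x ⟶ x'), f - f' ∈ I.hom x x' →
        bmap B f (𝟙 y) = bmap B f' (𝟙 y)) ∧
      IsPolynomialSnd B ∧ Nonempty (F ≅ Functor.diag A ⋙ B) := by
  obtain ⟨q, hq, hq'⟩ := exists_polynomial_root hF.ne_zero d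
  refine ⟨(pairFamily hF hq hq').toFunctor, fun hfd p => ?_,
    fun y f f' h => pairFamily_bmap_congr hF hq hq' h _, pairFamily_isPolynomialSnd hF hq hq',
    pairFamily_diag hF hq hq'⟩
  have : Module.Finite K ((biprodFunctor A ⋙ F).obj p) := hfd _
  exact Module.Finite.of_injective (Submodule.subtype ((pairFamily hF hq hq').obj p))
    Subtype.val_injective

end Extension

end TensorDecomposition

namespace TensorDecomposition

/-! ### Characters in finite-dimensional translation-stable spaces of functions -/

section Weights

variable {V : Type*} [AddCommGroup V]

lemma map_mem_pow_of_mem_relIdeal_pow {K : Type*} [Field K] {R : Type*} [CommRing R] [Algebra K R]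
    {J : Ideal R} {I : AddSubgroup V} (φ : AddMonoidAlgebra K V →ₐ[K] R)
    (h : ∀ i ∈ I, φ (pt K i) - 1 ∈ J) (n : ℕ) {z : AddMonoidAlgebra K V}
    (hz : z ∈ relIdeal K I ^ n) : φ z ∈ J ^ n := by
  have h1 : (relIdeal K I).map φ ≤ J := by
    rw [Ideal.map_le_iff_le_comap, relIdeal, Ideal.span_le]
    rintro _ ⟨i, hi, rfl⟩
    simpa using h i hi
  have h2 := Ideal.mem_map_of_mem φ hz
  rw [Ideal.map_pow] at h2
  exact Ideal.pow_right_mono h1 n h2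

variable {L : Type*} [Field L]

/-- The elements of the group algebra which annihilate a translation-stable space of functions. -/
noncomputable def annIdeal (W : Submodule L (V → L))
    (hW : ∀ (v : V), ∀ g ∈ W, (fun x => g (x + v)) ∈ W) : Ideal (AddMonoidAlgebra L V) where
  carrier := {z | ∀ g ∈ W, linExt g z = 0}
  add_mem' := fun {a b} ha hb g hg => by rw [map_add, ha g hg, hb g hg, add_zero]
  zero_mem' := fun g _ => map_zero _
  smul_mem' := fun a z hz => by
    rw [smul_eq_mul]
    induction a using AddMonoidAlgebra.induction_linear with
    | zero => intro g hg; simp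
    | add a b ha hb => intro g hg; rw [add_mul, map_add, ha g hg, hb g hg, add_zero]
    | single v c =>
      intro g hg
      have h1 : linExt g ∘ₗ LinearMap.mulLeft L (pt L v) = linExt (fun x => g (x + v)) :=
        hom_ext_pt fun x => by simp [linExt_pt, ← pt_add, add_comm]
      have h2 := LinearMap.congr_fun h1 z
      rw [LinearMap.comp_apply, LinearMap.mulLeft_apply, hz _ (hW v g hg)] at h2
      rw [single_eq_smul_pt, smul_mul_assoc, map_smul, h2, smul_zero]

lemma linExt_add_fun (f g : V → L) : linExt (K := L) (f + g) = linExt f + linExt g :=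
  hom_ext_pt fun v => by simp [linExt_pt]

lemma linExt_smul_fun (c : L) (g : V → L) : linExt (K := L) (c • g) = c • linExt g :=
  hom_ext_pt fun v => by simp [linExt_pt]

variable (L V) in
/-- Linear extension, as a linear map. -/
noncomputable def linExtₗ : (V → L) →ₗ[L] Module.Dual L (AddMonoidAlgebra L V) where
  toFun g := linExt g
  map_add' := linExt_add_fun
  map_smul' := linExt_smul_fun

variable {W : Submodule L (V → L)} [FiniteDimensional L W]
  (hW : ∀ (v : V), ∀ g ∈ W, (fun x => g (x + v)) ∈ W)

lemma finite_quotient_annIdeal : Module.Finite L (AddMonoidAlgebra L V ⧸ annIdeal W hW) := by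
  let φ : AddMonoidAlgebra L V →ₗ[L] Module.Dual L W := (linExtₗ V L ∘ₗ W.subtype).flip
  have hφ : (annIdeal W hW).restrictScalars L = LinearMap.ker φ := by
    ext z
    refine ⟨fun h => ?_, fun h g hg => ?_⟩
    · ext g
      exact h g.1 g.2
    · exact LinearMap.congr_fun (h : φ z = 0) ⟨g, hg⟩
  have h1 : Module.Finite L (AddMonoidAlgebra L V ⧸ (annIdeal W hW).restrictScalars L) := by
    rw [hφ]
    exact Module.Finite.of_injective _ (LinearMap.ker_eq_bot.1 (Submodule.ker_liftQ_eq_bot' _ _ rfl))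
  exact Module.Finite.equiv (Submodule.Quotient.restrictScalarsEquiv L (annIdeal W hW))

/-- An algebra morphism which vanishes on the annihilator of `W` comes from an element of `W`. -/
lemma exists_mem_of_annIdeal_le_ker (χ : AddMonoidAlgebra L V →ₐ[L] L)
    (hχ : ∀ z ∈ annIdeal W hW, χ z = 0) : (fun v => χ (pt L v)) ∈ W := by
  let W' := W.map (linExtₗ V L)
  have h1 : χ.toLinearMap ∈ W' := by
    -- A finite-dimensional subspace of a dual space is its own double annihilator, so membership of
    -- `χ` is tested on the elements killed by `W`.
    rw [← Subspace.dualCoannihilator_dualAnnihilator_eq (W := W'), Submodule.mem_dualAnnihilator]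
    intro z hz
    refine hχ z fun g hg => ?_
    rw [Submodule.mem_dualCoannihilator] at hz
    exact hz _ ⟨g, hg, rfl⟩
  obtain ⟨g, hg, h⟩ := h1
  have : (fun v => χ (pt L v)) = g := by
    ext v
    rw [← linExt_pt (K := L) g v]
    exact (LinearMap.congr_fun h (pt L v)).symm
  rwa [this]

/-- If all characters in a finite-dimensional translation-stable space of functions are trivial on
a subgroup, then this subgroup acts unipotently. -/
lemma exists_relIdeal_pow_le_annIdeal [IsAlgClosed L] {I : AddSubgroup V}
    (hI : ∀ χ : Multiplicative V →* L, (fun v => χ (.ofAdd v)) ∈ W → ∀ i ∈ I, χ (.ofAdd i) = 1) :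
    ∃ d : ℕ, relIdeal L I ^ (d + 1) ≤ annIdeal W hW := by
  have hfin := finite_quotient_annIdeal hW
  have hnoeth : IsNoetherianRing (AddMonoidAlgebra L V ⧸ annIdeal W hW) :=
    isNoetherian_of_isNoetherianRing_of_finite L _ |> fun h => isNoetherian_of_tower L h
  obtain ⟨n, hn⟩ := IsNoetherianRing.isNilpotent_nilradical (AddMonoidAlgebra L V ⧸ annIdeal W hW)
  have hJ : (relIdeal L I).map (Ideal.Quotient.mk (annIdeal W hW)) ≤
      nilradical (AddMonoidAlgebra L V ⧸ annIdeal W hW) := by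
    rw [Ideal.map_le_iff_le_comap, relIdeal, Ideal.span_le]
    rintro _ ⟨i, hi, rfl⟩
    rw [SetLike.mem_coe, Ideal.mem_comap]
    -- Every prime of this finite-dimensional algebra is maximal with residue field `L`, hence
    -- defines a character. That character lies in `W`, so it is trivial on `I` and `[i] - 1`
    -- belongs to the prime.
    have : IsArtinianRing (AddMonoidAlgebra L V ⧸ annIdeal W hW) := IsArtinianRing.of_finite L _
    rw [nilradical_eq_sInf, Ideal.mem_sInf]
    intro m hm
    have hm' : m.IsPrime := hm
    have hmax : m.IsMaximal := hm'.isMaximal'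
    let _ : Field ((AddMonoidAlgebra L V ⧸ annIdeal W hW) ⧸ m) := Ideal.Quotient.field m
    have hb := IsAlgClosed.algebraMap_bijective_of_isIntegral (k := L)
      (K := (AddMonoidAlgebra L V ⧸ annIdeal W hW) ⧸ m)
    let e := AlgEquiv.ofBijective (Algebra.ofId L ((AddMonoidAlgebra L V ⧸ annIdeal W hW) ⧸ m)) hb
    let χ : AddMonoidAlgebra L V →ₐ[L] L := e.symm.toAlgHom.comp
      ((Ideal.Quotient.mkₐ L m).comp (Ideal.Quotient.mkₐ L (annIdeal W hW)))
    have h1 := hI (χ.toMonoidHom.comp (AddMonoidAlgebra.of L V))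
      (exists_mem_of_annIdeal_le_ker hW χ fun z hz => by
        have : Ideal.Quotient.mk (annIdeal W hW) z = 0 := Ideal.Quotient.eq_zero_iff_mem.2 hz
        simp [χ, this]) i hi
    have h2 : χ (pt L i - 1) = 0 := by
      rw [map_sub, map_one, sub_eq_zero]
      exact h1
    have h3 : e.symm (Ideal.Quotient.mk m (Ideal.Quotient.mk (annIdeal W hW) (pt L i - 1))) = 0 := h2
    rw [map_eq_zero_iff _ e.symm.injective] at h3
    exact Ideal.Quotient.eq_zero_iff_mem.1 h3
  -- The exponent `n` would do; `n + 1` matches the form in which degree at most `n` is expressed.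
  refine ⟨n, fun z hz => ?_⟩
  have h1 := Ideal.mem_map_of_mem (Ideal.Quotient.mk (annIdeal W hW))
    (Ideal.pow_le_pow_right (Nat.le_succ n) hz)
  rw [Ideal.map_pow] at h1
  have h2 := Ideal.pow_right_mono hJ n h1
  rw [hn] at h2
  exact Ideal.Quotient.eq_zero_iff_mem.1 (by simpa using h2)

omit [FiniteDimensional L W] in
/-- A finite-dimensional space of functions contains finitely many characters. -/
lemma finite_characters [FiniteDimensional L W] :
    {χ : Multiplicative V →* L | (fun v => χ (.ofAdd v)) ∈ W}.Finite := by
  let S := {χ : Multiplicative V →* L | (fun v => χ (.ofAdd v)) ∈ W}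
  have h1 := (linearIndependent_monoidHom (Multiplicative V) L).comp (Subtype.val : S → _)
    Subtype.val_injective
  have h2 : LinearIndependent L (fun χ : S => (⟨fun v => χ.1 (.ofAdd v), χ.2⟩ : W)) :=
    LinearIndependent.of_comp W.subtype h1
  have := h2.finite
  exact Set.toFinite _

/-- A finite set of characters stable under powers consists of characters of finite order
invertible in the field. -/
lemma exists_pow_eq_one_of_finite {G : Type*} [Group G] {X : Set (G →* L)} (hX : X.Finite)
    (hpow : ∀ χ ∈ X, ∀ n : ℕ, 0 < n → χ ^ n ∈ X) :
    ∃ N : ℕ, (N : L) ≠ 0 ∧ ∀ χ ∈ X, ∀ g, χ g ^ N = 1 := by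
  classical
  have h1 : ∀ χ ∈ X, ∃ n : ℕ, 0 < n ∧ ∀ g, χ g ^ n = 1 := by
    intro χ hχ
    -- Pigeonhole on the powers; the shift by one is there because only positive powers are known to
    -- stay in `X`.
    have : ¬ Function.Injective (fun n : ℕ => (⟨χ ^ (n + 1), hpow χ hχ _ n.succ_pos⟩ : X)) := by
      have := hX.to_subtype
      exact not_injective_infinite_finite _
    rw [Function.not_injective_iff] at this
    obtain ⟨i, j, hij, hne⟩ := this
    wlog hlt : i < j generalizing i j
    · exact this j i hij.symm hne.symm (by omega)
    refine ⟨j - i, by omega, fun g => ?_⟩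
    have h2 : χ g ^ (i + 1) = χ g ^ (j + 1) := DFunLike.congr_fun (congrArg Subtype.val hij) g
    have h3 : χ g ≠ 0 := (Group.isUnit g).map χ |>.ne_zero
    have h4 : j + 1 = (i + 1) + (j - i) := by omega
    rw [h4, pow_add _ (i + 1) (j - i)] at h2
    exact (mul_right_eq_self₀.1 h2.symm).resolve_right (pow_ne_zero _ h3)
  have h2 : ∃ N : ℕ, 0 < N ∧ ∀ χ ∈ X, ∀ g, χ g ^ N = 1 := by
    choose! n hn hn' using h1
    refine ⟨∏ χ ∈ hX.toFinset, n χ, Finset.prod_pos fun χ hχ => hn χ (hX.mem_toFinset.1 hχ),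
      fun χ hχ g => ?_⟩
    obtain ⟨k, hk⟩ := Finset.dvd_prod_of_mem n (hX.mem_toFinset.2 hχ)
    rw [hk, pow_mul, hn' χ hχ, one_pow]
  -- The least exponent is invertible in `L`: if the characteristic `p` divided it, injectivity of
  -- Frobenius would allow it to be replaced by its quotient by `p`.
  obtain ⟨hpos, hN⟩ := Nat.find_spec h2
  refine ⟨Nat.find h2, fun h0 => ?_, hN⟩
  obtain ⟨p, hp⟩ := CharP.exists L
  obtain ⟨e, he⟩ := (CharP.cast_eq_zero_iff L p _).1 h0
  have he0 : 0 < e := Nat.pos_of_ne_zero fun h => by rw [h] at he; omega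
  have hp' : p.Prime := (CharP.char_is_prime_or_zero L p).resolve_right fun h => by
    rw [h] at he; omega
  have : Fact p.Prime := ⟨hp'⟩
  refine Nat.find_min h2 (m := e) ?_ ⟨he0, fun χ hχ g => ?_⟩
  · have := hp'.two_le
    nlinarith
  · have h3 := hN χ hχ g
    rw [he, mul_comm, pow_mul] at h3
    apply frobenius_inj L p
    simpa [frobenius_def] using h3

end Weights

end TensorDecomposition

namespace TensorDecomposition

/-! ### Simple functors are of mixed type -/

section SimpleMixedType

variable {A : Type u} [Category.{v} A] [Preadditive A] {K : Type w} [Field K]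
  (L : Type*) [Field L] [Algebra K L]

/-- The space of functions on `A(x, y)` spanned by the coefficients of the maps
`F (c + a ≫ f ≫ b)`, for `a`, `b` and `c` morphisms between `x₀` and `x`, `y` and `x₀`. -/
noncomputable def coeffSpace (F : A ⥤ ModuleCat.{w} K) (x₀ x y : A) :
    Submodule L ((x ⟶ y) → L) :=
  Submodule.span L {g | ∃ (ψ : (F.obj x₀ →ₗ[K] F.obj x₀) →ₗ[K] L) (c : x₀ ⟶ x₀) (a : x₀ ⟶ x)
    (b : y ⟶ x₀), g = fun f => ψ (F.map (c + a ≫ f ≫ b)).hom}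

variable {F : A ⥤ ModuleCat.{w} K} {x₀ : A}

/-- Every `c + a ≫ f ≫ b` factors as `lift (𝟙, a) ≫ (𝟙 ⊞ f) ≫ desc (c, b)`. So all coefficients are
functionals of the single map `F(𝟙 ⊞ f)`, which lies in a fixed finite-dimensional space. -/
lemma finiteDimensional_coeffSpace [HasBinaryBiproducts A] (hF : FiniteDimValued F) (x y : A) :
    FiniteDimensional L (coeffSpace L F x₀ x y) := by
  have h1 : Module.Finite K (F.obj (x₀ ⊞ x)) := hF _
  have h2 : Module.Finite K (F.obj (x₀ ⊞ y)) := hF _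
  let Φ : ((F.obj (x₀ ⊞ x) →ₗ[K] F.obj (x₀ ⊞ y)) →ₗ[K] L) →ₗ[L] ((x ⟶ y) → L) :=
    { toFun := fun ψ f => ψ (F.map (biprod.map (𝟙 x₀) f)).hom
      map_add' := fun _ _ => rfl
      map_smul' := fun _ _ => rfl }
  have hle : coeffSpace L F x₀ x y ≤ LinearMap.range Φ := by
    rw [coeffSpace, Submodule.span_le]
    rintro _ ⟨ψ, c, a, b, rfl⟩
    refine ⟨ψ ∘ₗ LinearMap.llcomp K _ _ _ (F.map (biprod.desc c b)).hom ∘ₗ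
      LinearMap.lcomp K _ (F.map (biprod.lift (𝟙 x₀) a)).hom, ?_⟩
    ext f
    have : c + a ≫ f ≫ b = biprod.lift (𝟙 x₀) a ≫ biprod.map (𝟙 x₀) f ≫ biprod.desc c b := by
      have h : biprod.map (𝟙 x₀) f ≫ biprod.desc c b = biprod.desc c (f ≫ b) := by
        ext <;> simp
      rw [h, biprod.lift_desc, Category.id_comp]
    rw [this, F.map_comp, F.map_comp]
    rfl
  exact Submodule.finiteDimensional_of_le hle

lemma coeffSpace_translate (v : x₀ ⟶ x₀) (g : (x₀ ⟶ x₀) → L) (hg : g ∈ coeffSpace L F x₀ x₀ x₀) :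
    (fun f => g (f + v)) ∈ coeffSpace L F x₀ x₀ x₀ := by
  have : coeffSpace L F x₀ x₀ x₀ ≤
      (coeffSpace L F x₀ x₀ x₀).comap (LinearMap.funLeft L L fun f => f + v) := by
    nth_rw 1 [coeffSpace]
    rw [Submodule.span_le]
    rintro _ ⟨ψ, c, a, b, rfl⟩
    refine Submodule.subset_span ⟨ψ, c + a ≫ v ≫ b, a, b, ?_⟩
    ext f
    have : c + a ≫ (f + v) ≫ b = (c + a ≫ v ≫ b) + a ≫ f ≫ b := by
      rw [Preadditive.add_comp, Preadditive.comp_add]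
      abel
    simp only [LinearMap.funLeft_apply, this]
  exact this hg

lemma coeffSpace_comp {x y x' y' : A} (a : x' ⟶ x) (b : y ⟶ y') (g : (x' ⟶ y') → L)
    (hg : g ∈ coeffSpace L F x₀ x' y') :
    (fun f => g (a ≫ f ≫ b)) ∈ coeffSpace L F x₀ x y := by
  have : coeffSpace L F x₀ x' y' ≤
      (coeffSpace L F x₀ x y).comap (LinearMap.funLeft L L fun f => a ≫ f ≫ b) := by
    nth_rw 1 [coeffSpace]
    rw [Submodule.span_le]
    rintro _ ⟨ψ, c, a', b', rfl⟩
    refine Submodule.subset_span ⟨ψ, c, a' ≫ a, b ≫ b', ?_⟩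
    ext f
    simp only [LinearMap.funLeft_apply, Category.assoc]
  exact this hg

/-- The power `χ ^ n` is `χ` precomposed with `n • 𝟙 x₀`. This additive structure of the category is
what forces the characters to have finite order. -/
lemma coeffSpace_pow (χ : Multiplicative (x₀ ⟶ x₀) →* L)
    (hχ : (fun v => χ (.ofAdd v)) ∈ coeffSpace L F x₀ x₀ x₀) (n : ℕ) :
    (fun v => (χ ^ n) (.ofAdd v)) ∈ coeffSpace L F x₀ x₀ x₀ := by
  have := coeffSpace_comp L (𝟙 x₀) (n • 𝟙 x₀) _ hχ
  simpa [ofAdd_nsmul] using this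

variable (F x₀) in
/-- The ideal of the morphisms on which all characters appearing in `F` are trivial. -/
def charIdeal : CatIdeal A where
  hom x y :=
    { carrier := {f | ∀ (a : x₀ ⟶ x) (b : y ⟶ x₀) (χ : Multiplicative (x₀ ⟶ x₀) →* L),
        (fun v => χ (.ofAdd v)) ∈ coeffSpace L F x₀ x₀ x₀ → χ (.ofAdd (a ≫ f ≫ b)) = 1}
      add_mem' := fun {f g} hf hg a b χ hχ => by
        simp [Preadditive.add_comp, Preadditive.comp_add, hf a b χ hχ, hg a b χ hχ]
      zero_mem' := fun a b χ _ => by simp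
      neg_mem' := fun {f} hf a b χ hχ => by
        have h1 : χ (.ofAdd (a ≫ f ≫ b)) * χ (.ofAdd (a ≫ (-f) ≫ b)) = 1 := by
          rw [← map_mul, ← ofAdd_add]
          simp
        rwa [hf a b χ hχ, one_mul] at h1 }
  comp_mem_right g hf a b χ hχ := by
    have := hf a (g ≫ b) χ hχ
    simpa using this
  comp_mem_left f _ hg a b χ hχ := by
    have := hg (a ≫ f) b χ hχ
    simpa using this

lemma subsingleton_tensor_of_nsmul {K : Type*} [Field K] {Q : Type*} [AddCommGroup Q] {N : ℕ}
    (hN : (N : K) ≠ 0) (h : ∀ q : Q, N • q = 0) : Subsingleton (K ⊗[ℤ] Q) := by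
  refine subsingleton_of_forall_eq 0 fun z => ?_
  induction z using TensorProduct.induction_on with
  | zero => rfl
  | add a b ha hb => rw [ha, hb, add_zero]
  | tmul c q =>
    have : c = (N : ℤ) • (c / N) := by
      rw [zsmul_eq_mul, Int.cast_natCast, mul_div_cancel₀ _ hN]
    rw [this, TensorProduct.smul_tmul, natCast_zsmul, h q, TensorProduct.tmul_zero]

/-- Simple functors with finite-dimensional values are of mixed type. -/
lemma exists_hasMixedType [HasBinaryBiproducts A] (hF : FiniteDimValued F) (hS : Simple F) :
    ∃ (I : CatIdeal A) (N d : ℕ), I.IsCotrivial K ∧ HasMixedType F I N d := by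
  obtain ⟨x₀, hx₀⟩ := exists_nontrivial hS
  let L := AlgebraicClosure K
  have hfd := fun x y => finiteDimensional_coeffSpace L (x₀ := x₀) hF x y
  have hcast : ∀ n : ℕ, (n : L) ≠ 0 → (n : K) ≠ 0 := fun n hn h0 => hn (by
    rw [← map_natCast (algebraMap K L), h0, map_zero])
  obtain ⟨N, hN, hN'⟩ := exists_pow_eq_one_of_finite
    (finite_characters (W := coeffSpace L F x₀ x₀ x₀)) fun χ hχ n _ => coeffSpace_pow L χ hχ n
  let I := charIdeal L F x₀
  have hNI : ∀ {x y : A} (f : x ⟶ y), N • f ∈ I.hom x y := by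
    intro x y f a b χ hχ
    rw [Preadditive.nsmul_comp, Preadditive.comp_nsmul, ofAdd_nsmul, map_pow, hN' χ hχ]
  let I₀ : AddSubgroup (x₀ ⟶ x₀) := I.hom x₀ x₀
  obtain ⟨d, hd⟩ := exists_relIdeal_pow_le_annIdeal (coeffSpace_translate L (F := F) (x₀ := x₀))
    (I := I₀) fun χ hχ i hi => by simpa using hi (𝟙 _) (𝟙 _) χ hχ
  refine ⟨I, N, d, fun x y => ⟨?_, subsingleton_tensor_of_nsmul (hcast N hN) ?_⟩, hcast N hN, hNI, ?_⟩
  -- Finiteness of the quotient: pulling back characters along `f ↦ a ≫ f ≫ b` gives only finitely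
  -- many characters of `x ⟶ y`, all with values in the finite set of `N`-th roots of unity. Their
  -- joint values determine `f` modulo `I`.
  · let Y := {χ : Multiplicative (x ⟶ y) →* L | (fun v => χ (.ofAdd v)) ∈ coeffSpace L F x₀ x y}
    have hY : Finite Y := (finite_characters (W := coeffSpace L F x₀ x y)).to_subtype
    let Y' := {χ : Y | ∀ f, χ.1 f ^ N = 1}
    have hN0 : 0 < N := Nat.pos_of_ne_zero fun h => hN (by rw [h, Nat.cast_zero])
    have hR : Finite {r : L // r ^ N = 1} := by
      refine Set.Finite.to_subtype (s := {r : L | r ^ N = 1}) ?_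
      classical
      refine (Polynomial.nthRoots N (1 : L)).toFinset.finite_toSet.subset fun r hr => ?_
      simpa [Polynomial.mem_nthRoots hN0] using hr
    let Θ : (x ⟶ y) → (Y' → {r : L // r ^ N = 1}) := fun f χ => ⟨χ.1.1 (.ofAdd f), χ.2 _⟩
    have hΘ : ∀ f g, Θ f = Θ g → f - g ∈ I.hom x y := by
      intro f g h a b χ hχ
      let χ' : Multiplicative (x ⟶ y) →* L := χ.comp (AddMonoidHom.toMultiplicative
        ((Preadditive.leftComp x₀ a).comp (Preadditive.rightComp x b)))
      have h1 : χ' (.ofAdd f) = χ' (.ofAdd g) :=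
        congrArg Subtype.val (congrFun h ⟨⟨χ', coeffSpace_comp L a b _ hχ⟩, fun f => hN' χ hχ _⟩)
      have h2 : χ' (.ofAdd (f - g)) * χ' (.ofAdd g) = χ' (.ofAdd f) := by
        rw [← map_mul, ← ofAdd_add, sub_add_cancel]
      have h3 : χ' (.ofAdd g) ≠ 0 := ((Group.isUnit _).map χ').ne_zero
      rw [h1] at h2
      exact mul_right_cancel₀ h3 (h2.trans (one_mul _).symm)
    refine Finite.of_injective (fun z => Θ z.out) fun z z' h => ?_
    have := hΘ _ _ h
    rw [← QuotientAddGroup.out_eq' z, ← QuotientAddGroup.out_eq' z', QuotientAddGroup.eq,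
      neg_add_eq_sub, ← neg_sub]
    exact (I.hom x y).neg_mem this
  · intro z
    obtain ⟨f, rfl⟩ := QuotientAddGroup.mk_surjective z
    rw [← QuotientAddGroup.mk_nsmul]
    exact (QuotientAddGroup.eq_zero_iff _).2 (hNI f)
  · intro x y z hz
    refine eq_zero_of_simple hS x₀ fun a b => ?_
    let π : AddMonoidAlgebra K (x ⟶ y) →ₐ[K] AddMonoidAlgebra K (x₀ ⟶ x₀) :=
      AddMonoidAlgebra.lift K _ _ ((AddMonoidAlgebra.of K _).comp (AddMonoidHom.toMultiplicative
        ((Preadditive.leftComp x₀ a).comp (Preadditive.rightComp x b))))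
    have hπ : ∀ f, π (pt K f) = pt K (a ≫ f ≫ b) := fun f => AddMonoidAlgebra.lift_of _ _
    have h1 : π z ∈ relIdeal K I₀ ^ (d + 1) :=
      map_mem_pow_of_mem_relIdeal_pow π (fun i hi => by
        rw [hπ]
        exact pt_sub_one_mem (I.comp_mem_left _ (I.comp_mem_right _ hi))) _ hz
    have h2 : (F.map b).hom ∘ₗ linExt (fun f : x ⟶ y => (F.map f).hom) z ∘ₗ (F.map a).hom =
        linExt (fun f : x₀ ⟶ x₀ => (F.map f).hom) (π z) := by
      have := hom_ext_pt (φ := LinearMap.llcomp K _ _ _ (F.map b).hom ∘ₗ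
        LinearMap.lcomp K _ (F.map a).hom ∘ₗ linExt (fun f : x ⟶ y => (F.map f).hom))
        (ψ := linExt (fun f : x₀ ⟶ x₀ => (F.map f).hom) ∘ₗ π.toLinearMap) fun f => by
          simp only [LinearMap.comp_apply, linExt_pt, AlgHom.toLinearMap_apply, hπ, F.map_comp]
          rfl
      exact LinearMap.congr_fun this z
    rw [h2]
    -- The annihilation is known over the algebraic closure `L`. It descends because each `K`-valued
    -- functional of `F` becomes, after embedding in `L`, a member of `coeffSpace`.
    let σ : AddMonoidAlgebra K (x₀ ⟶ x₀) →ₐ[K] AddMonoidAlgebra L (x₀ ⟶ x₀) :=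
      AddMonoidAlgebra.lift K _ _ (AddMonoidAlgebra.of L _)
    have hσ : ∀ f, σ (pt K f) = pt L f := fun f => AddMonoidAlgebra.lift_of _ _
    have h3 : σ (π z) ∈ relIdeal L I₀ ^ (d + 1) :=
      map_mem_pow_of_mem_relIdeal_pow σ (fun i hi => by rw [hσ]; exact pt_sub_one_mem hi) _ h1
    rw [← Module.forall_dual_apply_eq_zero_iff K]
    intro φ
    apply FaithfulSMul.algebraMap_injective K L
    let ψ : (F.obj x₀ →ₗ[K] F.obj x₀) →ₗ[K] L := Algebra.linearMap K L ∘ₗ φ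
    have hψ : (fun f : x₀ ⟶ x₀ => ψ (F.map f).hom) ∈ coeffSpace L F x₀ x₀ x₀ :=
      Submodule.subset_span ⟨ψ, 0, 𝟙 _, 𝟙 _, by simp⟩
    have h4 := hd h3 _ hψ
    have h5 := hom_ext_pt (φ := ψ ∘ₗ linExt (fun f : x₀ ⟶ x₀ => (F.map f).hom))
      (ψ := (linExt (K := L) (fun f : x₀ ⟶ x₀ => ψ (F.map f).hom)).restrictScalars K ∘ₗ
        σ.toLinearMap) fun f => by
          simp only [LinearMap.comp_apply, linExt_pt, AlgHom.toLinearMap_apply, hσ,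
            LinearMap.restrictScalars_apply]
    rw [map_zero]
    exact (LinearMap.congr_fun h5 (π z)).trans h4

end SimpleMixedType

end TensorDecomposition

namespace TensorDecomposition

/-! ### Simple functors as diagonals of simple bifunctors -/

section DiagonalDecomposition

variable {A : Type u} [Category.{v} A] [Preadditive A] {K : Type w} [Field K]

lemma exists_bifunctor_of_simple [HasBinaryBiproducts A] {F : A ⥤ ModuleCat.{w} K}
    (hF : FiniteDimValued F) (hS : Simple F) :
    ∃ (B : A × A ⥤ ModuleCat.{w} K) (I : CatIdeal A), Simple B ∧ FiniteDimValued B ∧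
      I.IsCotrivial K ∧ (∀ {x x' : A} (y : A) (f f' : x ⟶ x'), f - f' ∈ I.hom x x' →
        bmap B f (𝟙 y) = bmap B f' (𝟙 y)) ∧ IsPolynomialSnd B ∧
      Nonempty (F ≅ Functor.diag A ⋙ B) := by
  obtain ⟨I, N, d, hI, hM⟩ := exists_hasMixedType hF hS
  obtain ⟨B, h1, h2, h3, ⟨e⟩⟩ := hM.exists_bifunctor
  exact ⟨B, I, simple_of_simple_diag (Simple.of_iso e.symm), h1 hF, hI, h2, h3, ⟨e⟩⟩

lemma isAntipolynomialFst_of_bmap_eq {B : A × A ⥤ ModuleCat.{w} K} {I : CatIdeal A}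
    (hI : I.IsCotrivial K) (h : ∀ {x x' : A} (y : A) (f f' : x ⟶ x'), f - f' ∈ I.hom x x' →
        bmap B f (𝟙 y) = bmap B f' (𝟙 y)) : IsAntipolynomialFst B := fun y =>
  IsAntipolynomial.of_map_eq hI fun f f' hf => ModuleCat.hom_ext (h y f f' hf)

/-- Simple functors with finite-dimensional values are the diagonals of the simple bifunctors which
are antipolynomial in the first variable and polynomial in the second one. -/
theorem simple_iff_exists_bifunctor [HasBinaryBiproducts A] (F : A ⥤ ModuleCat.{w} K)
    (hF : FiniteDimValued F) : Simple F ↔ ∃ B : A × A ⥤ ModuleCat.{w} K,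
      Simple B ∧ FiniteDimValued B ∧ IsAntipolynomialFst B ∧ IsPolynomialSnd B ∧
      Nonempty (F ≅ Functor.diag A ⋙ B) := by
  constructor
  · intro hS
    obtain ⟨B, I, h1, h2, hI, h3, h4, h5⟩ := exists_bifunctor_of_simple hF hS
    exact ⟨B, h1, h2, isAntipolynomialFst_of_bmap_eq hI h3, h4, h5⟩
  · rintro ⟨B, hB, -, h1, h2, ⟨e⟩⟩
    obtain ⟨N, d, h⟩ := exists_hasBitype hB h1 h2
    have := h.simple_diag hB
    exact Simple.of_iso e

theorem nonempty_iso_of_diag_iso [HasBinaryBiproducts A] {B B' : A × A ⥤ ModuleCat.{w} K}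
    (hB : Simple B) (h1 : IsAntipolynomialFst B) (h2 : IsPolynomialSnd B)
    (hB' : Simple B') (h1' : IsAntipolynomialFst B') (h2' : IsPolynomialSnd B')
    (e : Functor.diag A ⋙ B ≅ Functor.diag A ⋙ B') : Nonempty (B ≅ B') := by
  obtain ⟨N, d, h⟩ := exists_hasBitype hB h1 h2
  obtain ⟨N', d', h'⟩ := exists_hasBitype hB' h1' h2'
  exact h.nonempty_iso h' e

end DiagonalDecomposition

/-! ### External tensor products and pure tensors -/

section ExternalProduct

variable {A : Type u} [Category.{v} A] {K : Type w} [Field K]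

/-- A nonzero subfunctor of a sum of copies of a simple functor with scalar endomorphisms
contains an element all of whose coordinates are proportional. -/
lemma exists_smul_mem_of_scalar_end {T : A ⥤ ModuleCat.{w} K} (hT : IsAbsolutelySimple T)
    {ι : Type*} (M : ∀ x : A, Submodule K (ι →₀ T.obj x))
    (hM : ∀ {x y : A} (f : x ⟶ y) {m : ι →₀ T.obj x}, m ∈ M x →
      Finsupp.mapRange.linearMap (T.map f).hom m ∈ M y) (hne : ∃ x, M x ≠ ⊥) :
    ∃ (x : A) (t : T.obj x) (c : ι →₀ K), t ≠ 0 ∧ c ≠ 0 ∧ c.mapRange (· • t) (zero_smul K t) ∈ M x := by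
  classical
  -- A nonzero element of minimal support, over all objects at once, will have proportional
  -- coordinates.
  let P : ℕ → Prop := fun n => ∃ (x : A) (m : ι →₀ T.obj x), m ∈ M x ∧ m ≠ 0 ∧ m.support.card = n
  have hP : ∃ n, P n := by
    obtain ⟨x, hx⟩ := hne
    obtain ⟨m, hm, h0⟩ := Submodule.exists_mem_ne_zero_of_ne_bot hx
    exact ⟨_, x, m, hm, h0, rfl⟩
  obtain ⟨x, m, hm, h0, hn⟩ := Nat.find_spec hP
  have hmin : ∀ (y : A) (m' : ι →₀ T.obj y), m' ∈ M y → m'.support.card < m.support.card →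
      m' = 0 := by
    intro y m' hm' hlt
    by_contra h
    rw [hn] at hlt
    exact Nat.find_min hP hlt ⟨y, m', hm', h, rfl⟩
  obtain ⟨i, hi⟩ := Finsupp.support_nonempty_iff.2 h0
  have key : ∀ j, ∃ c : K, m j = c • m i := by
    intro j
    -- Among elements supported in the support of `m`, minimality makes the `i`-th coordinate
    -- determine the `j`-th. The pairs of coordinates form the graph of an endomorphism of `T`,
    -- hence of a scalar.
    let N : ∀ y, Submodule K (ι →₀ T.obj y) := fun y => M y ⊓ Finsupp.supported (T.obj y) K m.support
    obtain ⟨η, hη⟩ := exists_natTrans_of_graph (X := T) hT.1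
      (fun y => (N y).map ((Finsupp.lapply i).prod (Finsupp.lapply j))) (by
        rintro y z f t b ⟨m', ⟨h1, h2⟩, h3⟩
        obtain ⟨rfl, rfl⟩ := Prod.ext_iff.1 h3
        refine ⟨Finsupp.mapRange.linearMap (T.map f).hom m', ⟨hM f h1, ?_⟩, by simp⟩
        rw [SetLike.mem_coe, Finsupp.mem_supported] at h2 ⊢
        exact fun k hk => h2 (Finset.mem_coe.2 (Finsupp.support_mapRange (hf := map_zero _) hk))) (by
        rintro y b ⟨m', ⟨h1, h2⟩, h3⟩
        have h4 : m' i = 0 := congrArg Prod.fst h3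
        have h5 : m' j = b := congrArg Prod.snd h3
        rw [SetLike.mem_coe, Finsupp.mem_supported, Finset.coe_subset] at h2
        rw [← h5, hmin y m' h1 (Finset.card_lt_card ⟨h2, fun h => ?_⟩)]
        · rfl
        · exact Finsupp.mem_support_iff.1 (h hi) h4)
      ⟨x, m i, m j, Finsupp.mem_support_iff.1 hi, m, ⟨hm, fun _ h => h⟩, rfl⟩
    obtain ⟨c, hc⟩ := hT.2.2 η
    refine ⟨c, ?_⟩
    rw [← hη x (m i) (m j) ⟨m, ⟨hm, fun _ h => h⟩, rfl⟩, ← hc]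
    rfl
  choose c hc using key
  refine ⟨x, m i, Finsupp.onFinset m.support c fun j hj => ?_, Finsupp.mem_support_iff.1 hi, ?_, ?_⟩
  · rw [Finsupp.mem_support_iff, hc j]
    exact smul_ne_zero hj (Finsupp.mem_support_iff.1 hi)
  · intro h
    have : c i = 0 := DFunLike.congr_fun h i
    exact Finsupp.mem_support_iff.1 hi (by rw [hc i, this, zero_smul])
  · convert hm using 1
    ext j
    simp [hc j]

/-- A basis of `V` turns `V ⊗ T` into a sum of copies of `T`, where proportional coordinates `c_i •
t` mean a pure tensor. This gives the injectivity of all maps out of tensor products below. -/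
lemma exists_tmul_mem_of_absolutelySimple {T : A ⥤ ModuleCat.{w} K} (hT : IsAbsolutelySimple T)
    (V : Type*) [AddCommGroup V] [Module K V] (M : ∀ x : A, Submodule K (V ⊗[K] T.obj x))
    (hM : ∀ {x y : A} (f : x ⟶ y) {m : V ⊗[K] T.obj x}, m ∈ M x →
      (T.map f).hom.lTensor V m ∈ M y) (hne : ∃ x, M x ≠ ⊥) :
    ∃ (x : A) (s : V) (t : T.obj x), s ≠ 0 ∧ t ≠ 0 ∧ s ⊗ₜ[K] t ∈ M x := by
  classical
  let b := Module.Basis.ofVectorSpace K V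
  let e := fun x : A => TensorProduct.equivFinsuppOfBasisLeft (N := T.obj x) b
  have he : ∀ {x y : A} (f : x ⟶ y) (m : V ⊗[K] T.obj x),
      e y ((T.map f).hom.lTensor V m) = Finsupp.mapRange.linearMap (T.map f).hom (e x m) := by
    intro x y f m
    induction m using TensorProduct.induction_on with
    | zero => simp
    | add m n hm hn => rw [map_add, map_add, map_add, map_add, hm, hn]
    | tmul s t => ext i; simp [e]
  obtain ⟨x, t, c, ht, hc, h⟩ := exists_smul_mem_of_scalar_end hT
    (fun x => (M x).map (e x).toLinearMap) (by
      rintro x y f _ ⟨m, hm, rfl⟩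
      exact ⟨_, hM f hm, he f m⟩) (by
      obtain ⟨x, hx⟩ := hne
      exact ⟨x, fun h => hx (Submodule.map_eq_bot_iff.1 h)⟩)
  obtain ⟨m, hm, h⟩ := h
  refine ⟨x, b.repr.symm c, t, b.repr.symm.map_ne_zero_iff.2 hc, ht, ?_⟩
  suffices b.repr.symm c ⊗ₜ[K] t = m from this ▸ hm
  apply (e x).injective
  refine Eq.trans ?_ h.symm
  ext i
  simp [e]

/-- The external tensor product of two functors. -/
noncomputable abbrev box (S T : A ⥤ ModuleCat.{w} K) : A × A ⥤ ModuleCat.{w} K where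
  obj p := ModuleCat.of K (S.obj p.2 ⊗[K] T.obj p.1)
  map f := ModuleCat.ofHom (TensorProduct.map (S.map f.2).hom (T.map f.1).hom)
  map_id p := by
    ext
    simp
  map_comp f g := by
    ext
    simp

/-- The values of the external tensor product. -/
noncomputable def boxEquiv (S T : A ⥤ ModuleCat.{w} K) (x y : A) :
    S.obj y ⊗[K] T.obj x ≃ₗ[K] (box S T).obj (x, y) :=
  (Iso.refl (ModuleCat.of K (S.obj y ⊗[K] T.obj x)) :
    ModuleCat.of K (S.obj y ⊗[K] T.obj x) ≅ (box S T).obj (x, y)).toLinearEquiv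

noncomputable def diagBoxIso (S T : A ⥤ ModuleCat.{w} K) : Functor.diag A ⋙ box S T ≅ S ⊗ T :=
  NatIso.ofComponents (fun _ => Iso.refl _) fun f => by
    ext
    rfl

lemma exists_functional_left {V W : Type*} [AddCommGroup V] [Module K V] [AddCommGroup W]
    [Module K W] {z : V ⊗[K] W} (hz : z ≠ 0) :
    ∃ φ : V →ₗ[K] K, TensorProduct.lid K W (φ.rTensor W z) ≠ 0 := by
  classical
  let b := Module.Basis.ofVectorSpace K V
  by_contra! h
  apply hz
  apply (TensorProduct.equivFinsuppOfBasisLeft (N := W) b).injective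
  ext i
  have h1 : (TensorProduct.lid K W).toLinearMap ∘ₗ (b.coord i).rTensor W =
      Finsupp.lapply i ∘ₗ (TensorProduct.equivFinsuppOfBasisLeft (N := W) b).toLinearMap := by
    ext s t
    simp
  rw [map_zero, Finsupp.zero_apply, ← h (b.coord i)]
  exact (LinearMap.congr_fun h1 z).symm

lemma exists_functional_right {V W : Type*} [AddCommGroup V] [Module K V] [AddCommGroup W]
    [Module K W] {z : V ⊗[K] W} (hz : z ≠ 0) :
    ∃ φ : W →ₗ[K] K, TensorProduct.rid K V (φ.lTensor V z) ≠ 0 := by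
  obtain ⟨φ, h⟩ := exists_functional_left ((TensorProduct.comm K V W).map_ne_zero_iff.2 hz)
  refine ⟨φ, fun h0 => h ?_⟩
  rw [← h0]
  have : (TensorProduct.lid K V).toLinearMap ∘ₗ φ.rTensor V ∘ₗ
      (TensorProduct.comm K V W).toLinearMap =
      (TensorProduct.rid K V).toLinearMap ∘ₗ φ.lTensor V := by
    ext s t
    simp
  exact LinearMap.congr_fun this z

lemma tmul_ne_zero {V W : Type*} [AddCommGroup V] [Module K V] [AddCommGroup W]
    [Module K W] {s : V} {t : W} (hs : s ≠ 0) (ht : t ≠ 0) : s ⊗ₜ[K] t ≠ 0 := by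
  obtain ⟨φ, hφ⟩ : ∃ φ : V →ₗ[K] K, φ s ≠ 0 := by
    by_contra! h
    exact hs ((Module.forall_dual_apply_eq_zero_iff K s).1 h)
  intro h
  have := congrArg (fun z => TensorProduct.lid K W (φ.rTensor W z)) h
  simp [hφ, ht] at this

/-- A nonzero subfunctor contains some pure tensor `s ⊗ t`. Since `t` generates `T` and `s`
generates `S`, moving one variable at a time produces all pure tensors. -/
lemma simple_box {S T : A ⥤ ModuleCat.{w} K} (hS : Simple S) (hT : IsAbsolutelySimple T) :
    Simple (box S T) := by
  rw [simple_iff_subfamily]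
  constructor
  · obtain ⟨y, hy⟩ := exists_nontrivial hS
    obtain ⟨x, hx⟩ := exists_nontrivial hT.1
    obtain ⟨s, hs⟩ := exists_ne (0 : S.obj y)
    obtain ⟨t, ht⟩ := exists_ne (0 : T.obj x)
    exact ⟨(x, y), ⟨⟨s ⊗ₜ[K] t, 0, tmul_ne_zero hs ht⟩⟩⟩
  · intro G
    by_cases hG : ∀ p, G.obj p = ⊥
    · exact Or.inl hG
    · right
      push Not at hG
      obtain ⟨⟨x, y⟩, hG⟩ := hG
      let H : ∀ x y, Submodule K (S.obj y ⊗[K] T.obj x) := fun x y =>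
        (G.obj (x, y)).comap (boxEquiv S T x y).toLinearMap
      have hH : ∀ {x x' y y' : A} (f : x ⟶ x') (g : y ⟶ y') {m : S.obj y ⊗[K] T.obj x},
          m ∈ H x y → TensorProduct.map (S.map g).hom (T.map f).hom m ∈ H x' y' :=
        fun {x x' y y'} f g {m} hm => by
          have := G.map_mem (x := (x, y)) (y := (x', y')) (f, g) hm
          exact this
      obtain ⟨x, s, t, hs, ht, h⟩ := exists_tmul_mem_of_absolutelySimple hT (S.obj y)
        (fun x => H x y) (fun {x x'} f m hm => by
          have := hH f (𝟙 y) hm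
          rwa [S.map_id] at this) ⟨x, fun h => hG (by
            rw [eq_bot_iff]
            intro m hm
            have : (boxEquiv S T x y).symm m ∈ H x y := by
              rw [Submodule.mem_comap]
              simpa using hm
            rw [h, Submodule.mem_bot, LinearEquiv.map_eq_zero_iff] at this
            exact this)⟩
      rintro ⟨x', y'⟩
      have h1 : ∀ (f : x ⟶ x') (g : y ⟶ y'),
          (S.map g).hom s ⊗ₜ[K] (T.map f).hom t ∈ H x' y' := fun f g => hH f g h
      have h2 : ∀ (t' : T.obj x') (g : y ⟶ y'), (S.map g).hom s ⊗ₜ[K] t' ∈ H x' y' := by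
        intro t' g
        have : Submodule.span K (Set.range fun f : x ⟶ x' => (T.map f).hom t) ≤
            (H x' y').comap (TensorProduct.mk K _ _ ((S.map g).hom s)) := by
          rw [Submodule.span_le]
          rintro _ ⟨f, rfl⟩
          exact h1 f g
        rw [span_map_eq_top hT.1 ht] at this
        exact this trivial
      have h3 : ∀ (t' : T.obj x') (s' : S.obj y'), s' ⊗ₜ[K] t' ∈ H x' y' := by
        intro t' s'
        have : Submodule.span K (Set.range fun g : y ⟶ y' => (S.map g).hom s) ≤
            (H x' y').comap ((TensorProduct.mk K _ _).flip t') := by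
          rw [Submodule.span_le]
          rintro _ ⟨g, rfl⟩
          exact h2 t' g
        rw [span_map_eq_top hS hs] at this
        exact this trivial
      have h4 : H x' y' = ⊤ := by
        rw [eq_top_iff, ← TensorProduct.span_tmul_eq_top K (S.obj y') (T.obj x'), Submodule.span_le]
        rintro _ ⟨s', t', rfl⟩
        exact h3 t' s'
      rw [eq_top_iff]
      intro m _
      have : (boxEquiv S T x' y').symm m ∈ H x' y' := h4 ▸ trivial
      rw [Submodule.mem_comap] at this
      simpa using this

end ExternalProduct

end TensorDecomposition

namespace TensorDecomposition

/-! ### Simple subfunctors in one variable; simple antipolynomial functors -/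

section SplittingField

variable {A : Type u} [Category.{v} A] {K : Type w} [Field K]

lemma bmap_box_eq (S T : A ⥤ ModuleCat.{w} K) {x x' y y' : A} (f : x ⟶ x') (g : y ⟶ y') :
    bmap (box S T) f g = LinearEquiv.arrowCongr (boxEquiv S T x y) (boxEquiv S T x' y')
      (TensorProduct.map (S.map g).hom (T.map f).hom) := by
  ext m
  rfl

/-- A functor that is cogenerated at a finite-dimensional value has a simple subfunctor. -/
lemma exists_simple_subfamily {X : A ⥤ ModuleCat.{w} K} {x₀ : A} [FiniteDimensional K (X.obj x₀)]
    [h0 : Nontrivial (X.obj x₀)]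
    (hco : ∀ {x : A} {m : X.obj x}, m ≠ 0 → ∃ a : x ⟶ x₀, (X.map a).hom m ≠ 0) :
    ∃ G : Subfamily X, Simple G.toFunctor ∧ G.obj x₀ ≠ ⊥ := by
  classical
  -- Choose a subfunctor with nonzero value of least dimension at `x₀`, then the part generated by
  -- one element there. Cogeneration makes every nonzero subfunctor of it visible at `x₀`, where
  -- minimality forces it to contain the generator.
  let P : ℕ → Prop := fun n => ∃ G : Subfamily X, G.obj x₀ ≠ ⊥ ∧ Module.finrank K (G.obj x₀) = n
  have hP : ∃ n, P n :=
    ⟨_, ⟨fun _ => ⊤, fun _ _ _ => trivial⟩, top_ne_bot, rfl⟩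
  obtain ⟨G, hG, hn⟩ := Nat.find_spec hP
  obtain ⟨m, hm, hm0⟩ := Submodule.exists_mem_ne_zero_of_ne_bot hG
  have hle : ∀ H : Subfamily X, m ∈ H.obj x₀ → ∀ x, (Subfamily.gen X m).obj x ≤ H.obj x := by
    intro H hH x
    refine Submodule.span_le.2 ?_
    rintro _ ⟨f, rfl⟩
    exact H.map_mem f hH
  have hmem := Subfamily.mem_gen (F := X) m
  refine ⟨Subfamily.gen X m, ?_, fun h => hm0 ((Submodule.mem_bot K).1 (h ▸ hmem))⟩
  rw [simple_iff_subfamily]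
  refine ⟨⟨x₀, ⟨⟨⟨m, hmem⟩, 0, fun h => hm0 (congrArg Subtype.val h)⟩⟩⟩, fun H => ?_⟩
  by_cases hH : ∀ x, H.obj x = ⊥
  · exact Or.inl hH
  right
  push Not at hH
  obtain ⟨x, hx⟩ := hH
  obtain ⟨h, hhx, hh0⟩ := Submodule.exists_mem_ne_zero_of_ne_bot hx
  let H' : Subfamily X :=
    { obj := fun y => (H.obj y).map ((Subfamily.gen X m).obj y).subtype
      map_mem := by
        rintro y z f _ ⟨k, hk, rfl⟩
        exact ⟨_, H.map_mem f hk, rfl⟩ }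
  obtain ⟨a, ha⟩ := hco (m := h.1) fun h0 => hh0 (Subtype.ext h0)
  have h1 : H'.obj x₀ ≠ ⊥ := fun h2 => ha ((Submodule.mem_bot K).1 (h2 ▸ H'.map_mem a ⟨h, hhx, rfl⟩))
  have h2 : H'.obj x₀ ≤ G.obj x₀ := by
    rintro _ ⟨k, _, rfl⟩
    exact hle G hm x₀ k.2
  have h3 : H'.obj x₀ = G.obj x₀ := by
    refine Submodule.eq_of_le_of_finrank_le h2 ?_
    rw [hn]
    exact Nat.find_min' hP ⟨H', h1, rfl⟩
  intro y
  rw [eq_top_iff]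
  rintro k -
  obtain ⟨k', hk', h4⟩ := hle H' (h3 ▸ hm) y k.2
  rwa [← Subtype.ext h4]

/-- A bifunctor that is generated and cogenerated at one value contains a simple functor of the
first variable. -/
lemma exists_simple_sub_sectL {B : A × A ⥤ ModuleCat.{w} K} (hB : Simple B)
    (hfd : FiniteDimValued B) {x₀ y₀ : A} (h0 : Nontrivial (B.obj (x₀, y₀))) :
    ∃ G : Subfamily (CategoryTheory.Prod.sectL A y₀ ⋙ B), Simple G.toFunctor ∧
      G.obj x₀ ≠ ⊥ := by
  let X := CategoryTheory.Prod.sectL A y₀ ⋙ B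
  have hco : ∀ {x : A} {m : X.obj x}, m ≠ 0 → ∃ a : x ⟶ x₀, (X.map a).hom m ≠ 0 := by
    intro x m hm
    obtain ⟨f, hf⟩ := exists_map_ne_zero hB (x := (x, y₀)) hm (x₀, y₀)
    refine ⟨f.1, fun h => hf ?_⟩
    have h1 : bmap B f.1 f.2 m = bmap B (𝟙 x₀) f.2 (bmap B f.1 (𝟙 y₀) m) :=
      LinearMap.congr_fun (bmap_eq_comp B f.1 f.2) m
    have h2 : bmap B f.1 (𝟙 y₀) m = 0 := h
    rw [h2, map_zero] at h1
    exact h1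
  have : FiniteDimensional K (X.obj x₀) := hfd (x₀, y₀)
  have : Nontrivial (X.obj x₀) := h0
  exact exists_simple_subfamily hco

variable [Preadditive A]

/-- A nonzero vector generates `T`, and its image under a morphism depends only on the class in a
finite quotient, so each value is spanned by a finite set. -/
lemma IsAntipolynomial.finiteDimValued {T : A ⥤ ModuleCat.{w} K} (h : IsAntipolynomial T)
    (hT : Simple T) : FiniteDimValued T := by
  obtain ⟨I, hI, h⟩ := h.exists_map_eq
  obtain ⟨x, hx⟩ := exists_nontrivial hT
  obtain ⟨m, hm⟩ := exists_ne (0 : T.obj x)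
  intro y
  have := (hI x y).1
  have hfin : (Set.range fun f : x ⟶ y => (T.map f).hom m).Finite := by
    refine (Set.finite_range fun q : (x ⟶ y) ⧸ I.hom x y => (T.map q.out).hom m).subset ?_
    rintro _ ⟨f, rfl⟩
    refine ⟨(f : (x ⟶ y) ⧸ I.hom x y), ?_⟩
    dsimp only
    rw [h (Quotient.out (f : (x ⟶ y) ⧸ I.hom x y)) f]
    rw [← neg_sub, ← neg_add_eq_sub]
    exact (I.hom x y).neg_mem (QuotientAddGroup.eq.1 (QuotientAddGroup.out_eq' _))
  exact ⟨(Submodule.fg_def).2 ⟨_, hfin, span_map_eq_top hT hm y⟩⟩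

lemma IsAntipolynomial.isAbsolutelySimple {T : A ⥤ ModuleCat.{w} K} (h : IsAntipolynomial T)
    (hT : Simple T) (hK : ∀ I : CatIdeal A, I.IsCotrivial K →
      IsNonadditiveSplittingField K I.Quot) : IsAbsolutelySimple T := by
  have hfd := h.finiteDimValued hT
  obtain ⟨I, hI, G, ⟨e⟩⟩ := h
  have hG : Simple (I.proj ⋙ G) := Simple.of_iso e.symm
  refine IsAbsolutelySimple.of_iso e.symm (isAbsolutelySimple_proj_comp I
    (hK I hI G ((simple_proj_comp_iff I G).1 hG) fun x => ?_))
  exact hfd.of_iso e x.as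

lemma IsAntipolynomial.box_fst {T : A ⥤ ModuleCat.{w} K} (h : IsAntipolynomial T)
    (S : A ⥤ ModuleCat.{w} K) : IsAntipolynomialFst (box S T) := by
  obtain ⟨I, hI, h⟩ := h.exists_map_eq
  refine isAntipolynomialFst_of_bmap_eq hI fun y f f' hf => ?_
  rw [bmap_box_eq, bmap_box_eq, h f f' hf]

lemma IsPolynomial.box_snd {S : A ⥤ ModuleCat.{w} K} (h : IsPolynomial S)
    (T : A ⥤ ModuleCat.{w} K) : IsPolynomialSnd (box S T) := by
  intro x
  rw [isPolynomial_iff] at h ⊢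
  obtain ⟨d, h⟩ := h
  refine ⟨d, fun y y' => ?_⟩
  have := (h y y').map_linear (((boxEquiv S T x y).arrowCongr (boxEquiv S T x y')).toLinearMap ∘ₗ
    (TensorProduct.mapBilinear (RingHom.id K) (S.obj y) (T.obj x) (S.obj y') (T.obj x)).flip
      (T.map (𝟙 x)).hom)
  exact this

end SplittingField

/-! ### The multiplicity functor of an absolutely simple functor in a bifunctor -/

section Multiplicity

variable {A : Type u} [Category.{v} A] {K : Type w} [Field K]

/-- The functor of the linear maps from a given vector space to the values of a bifunctor. -/
@[simps]
def homFunctor (B : A × A ⥤ ModuleCat.{w} K) (x₀ : A) (V : ModuleCat.{w} K) :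
    A ⥤ ModuleCat.{w} K where
  obj y := ModuleCat.of K (V →ₗ[K] B.obj (x₀, y))
  map g := ModuleCat.ofHom (LinearMap.llcomp K V _ _ (bmap B (𝟙 x₀) g))
  map_id y := by
    ext φ
    rw [bmap_id]
    rfl
  map_comp g g' := by
    ext φ
    rw [← Category.comp_id (𝟙 x₀), bmap_comp]
    simp

/-- The natural transformation between values of a bifunctor induced by a morphism in the
second variable. -/
def sectLMap (B : A × A ⥤ ModuleCat.{w} K) {y y' : A} (g : y ⟶ y') :
    CategoryTheory.Prod.sectL A y ⋙ B ⟶ CategoryTheory.Prod.sectL A y' ⋙ B where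
  app x := ModuleCat.ofHom (bmap B (𝟙 x) g)
  naturality x x' f := by
    ext m
    exact LinearMap.congr_fun ((bmap_eq_comp B f g).symm.trans (bmap_eq_comp' B f g)) m

/-- The linear maps from a value of `T` to the values of a bifunctor which extend to a natural
transformation in the first variable. -/
def multFamily (T : A ⥤ ModuleCat.{w} K) (B : A × A ⥤ ModuleCat.{w} K) (x₀ : A) :
    Subfamily (homFunctor B x₀ (T.obj x₀)) where
  obj y :=
    { carrier := {φ | ∃ η : T ⟶ CategoryTheory.Prod.sectL A y ⋙ B, (η.app x₀).hom = φ}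
      add_mem' := by
        rintro _ _ ⟨η, rfl⟩ ⟨η', rfl⟩
        exact ⟨η + η', rfl⟩
      zero_mem' := ⟨0, rfl⟩
      smul_mem' := by
        rintro c _ ⟨η, rfl⟩
        exact ⟨c • η, rfl⟩ }
  map_mem := by
    rintro y y' g _ ⟨η, rfl⟩
    exact ⟨η ≫ sectLMap B g, rfl⟩

variable {T : A ⥤ ModuleCat.{w} K} {B : A × A ⥤ ModuleCat.{w} K} {x₀ : A}

/-- The natural transformation extending an element of `multFamily`. -/
noncomputable def multExt {y : A} (φ : (multFamily T B x₀).toFunctor.obj y) :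
    T ⟶ CategoryTheory.Prod.sectL A y ⋙ B :=
  φ.2.choose

lemma multExt_app {y : A} (φ : (multFamily T B x₀).toFunctor.obj y) : ((multExt φ).app x₀).hom = φ.1 :=
  φ.2.choose_spec

lemma natTrans_ext_of_simple {X : A ⥤ ModuleCat.{w} K} (hT : Simple T) {x : A} {t : T.obj x}
    (ht : t ≠ 0) {η η' : T ⟶ X} (h : (η.app x).hom t = (η'.app x).hom t) : η = η' := by
  ext1
  ext1 y
  refine ModuleCat.hom_ext (ext_of_simple hT ht fun f => ?_)
  have h1 := NatTrans.naturality_apply η f t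
  have h2 := NatTrans.naturality_apply η' f t
  exact h1.trans ((congrArg (X.map f).hom h).trans h2.symm)

lemma multExt_eq (hT : Simple T) [Nontrivial (T.obj x₀)] {y : A} (φ : (multFamily T B x₀).toFunctor.obj y)
    (η : T ⟶ CategoryTheory.Prod.sectL A y ⋙ B) (h : (η.app x₀).hom = φ.1) : multExt φ = η := by
  obtain ⟨t, ht⟩ := exists_ne (0 : T.obj x₀)
  exact natTrans_ext_of_simple hT ht (LinearMap.congr_fun ((multExt_app φ).trans h.symm) t)

/-- The evaluation of natural transformations. -/
noncomputable def multEval (hT : Simple T) [Nontrivial (T.obj x₀)] (x y : A) :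
    (multFamily T B x₀).toFunctor.obj y ⊗[K] T.obj x →ₗ[K] B.obj (x, y) :=
  TensorProduct.lift
    { toFun := fun φ => ((multExt φ).app x).hom
      map_add' := fun φ ψ => by
        have h : multExt (φ + ψ) = multExt φ + multExt ψ :=
          multExt_eq hT _ _ (congrArg₂ (· + ·) (multExt_app φ) (multExt_app ψ))
        rw [h]
        rfl
      map_smul' := fun c φ => by
        have h : multExt (c • φ) = c • multExt φ :=
          multExt_eq hT _ _ (congrArg (c • ·) (multExt_app φ))
        rw [h]
        rfl }

lemma multEval_tmul (hT : Simple T) [Nontrivial (T.obj x₀)] {x y : A}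
    (φ : (multFamily T B x₀).toFunctor.obj y) (t : T.obj x) :
    multEval hT x y (φ ⊗ₜ t) = ((multExt φ).app x).hom t := rfl

lemma multEval_natural (hT : Simple T) [Nontrivial (T.obj x₀)] {x y x' y' : A} (f : x ⟶ x')
    (g : y ⟶ y') (z : (multFamily T B x₀).toFunctor.obj y ⊗[K] T.obj x) :
    multEval hT x' y' (TensorProduct.map ((multFamily T B x₀).toFunctor.map g).hom (T.map f).hom z) =
      bmap B f g (multEval hT x y z) := by
  induction z using TensorProduct.induction_on with
  | zero => simp only [map_zero]
  | add a b ha hb => rw [map_add, map_add, map_add, map_add, ha, hb]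
  | tmul φ t =>
    have h1 : multExt (((multFamily T B x₀).toFunctor.map g).hom φ) =
        multExt φ ≫ sectLMap B g :=
      multExt_eq hT _ _ (congrArg (fun ψ => bmap B (𝟙 x₀) g ∘ₗ ψ) (multExt_app φ))
    have h2 := NatTrans.naturality_apply (multExt φ) f t
    rw [TensorProduct.map_tmul]
    refine (multEval_tmul hT _ _).trans ?_
    rw [h1, multEval_tmul]
    exact (congrArg (bmap B (𝟙 x') g) h2).trans
      (LinearMap.congr_fun (bmap_eq_comp B f g) _).symm

/-- Otherwise the kernel would contain a nonzero pure tensor `φ ⊗ t`; the transformation extending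
`φ` would kill `t`, hence vanish. -/
lemma multEval_injective (hT : IsAbsolutelySimple T) [Nontrivial (T.obj x₀)] (x y : A) :
    Function.Injective (multEval (B := B) (x₀ := x₀) hT.1 x y) := by
  rw [← LinearMap.ker_eq_bot]
  by_contra hne
  obtain ⟨x', φ, t, hφ, ht, h⟩ := exists_tmul_mem_of_absolutelySimple hT _
    (fun x => LinearMap.ker (multEval (B := B) (x₀ := x₀) hT.1 x y)) (fun {x x'} f m hm => by
      have := multEval_natural hT.1 f (𝟙 y) m
      rw [LinearMap.mem_ker.1 hm, map_zero] at this
      rw [CategoryTheory.Functor.map_id] at this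
      exact this) ⟨x, hne⟩
  have h1 : multExt φ = 0 := natTrans_ext_of_simple hT.1 ht h
  apply hφ
  apply Subtype.ext
  refine (multExt_app φ).symm.trans ?_
  rw [h1]
  rfl

/-- For a nonzero subfunctor `G`, the image of `G ⊗ T` in the simple functor `B` is everything. By
injectivity of the evaluation any `ψ ⊗ t` lies in `G ⊗ T`, which a functional killing `G` but not
`ψ` would contradict. -/
lemma simple_multFamily (hT : IsAbsolutelySimple T) [Nontrivial (T.obj x₀)] (hB : Simple B)
    {y₀ : A} {η : T ⟶ CategoryTheory.Prod.sectL A y₀ ⋙ B} (hη : η ≠ 0) :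
    Simple (multFamily T B x₀).toFunctor := by
  rw [simple_iff_subfamily]
  obtain ⟨t, ht⟩ := exists_ne (0 : T.obj x₀)
  refine ⟨⟨y₀, ⟨⟨⟨(η.app x₀).hom, η, rfl⟩, 0, fun h => hη ?_⟩⟩⟩, fun G => ?_⟩
  · exact natTrans_ext_of_simple hT.1 ht (LinearMap.congr_fun (congrArg Subtype.val h) t)
  by_cases hG : ∀ y, G.obj y = ⊥
  · exact Or.inl hG
  right
  push Not at hG
  obtain ⟨y, hy⟩ := hG
  obtain ⟨φ, hφ, hφ0⟩ := Submodule.exists_mem_ne_zero_of_ne_bot hy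
  let H : Subfamily B :=
    { obj := fun p => (LinearMap.range ((G.obj p.2).subtype.rTensor (T.obj p.1))).map
        (multEval hT.1 p.1 p.2)
      map_mem := by
        rintro p p' f _ ⟨_, ⟨z, rfl⟩, rfl⟩
        refine ⟨_, ⟨TensorProduct.map (((multFamily T B x₀).toFunctor.map f.2).hom.restrict
          fun _ h => G.map_mem f.2 h) (T.map f.1).hom z, rfl⟩, ?_⟩
        refine Eq.trans ?_ (multEval_natural hT.1 f.1 f.2 _)
        congr 1
        rw [← LinearMap.comp_apply, ← LinearMap.comp_apply, LinearMap.rTensor,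
          LinearMap.rTensor, ← TensorProduct.map_comp, ← TensorProduct.map_comp]
        rfl }
  have hmem : multEval hT.1 x₀ y (φ ⊗ₜ t) ∈ H.obj (x₀, y) := ⟨_, ⟨⟨φ, hφ⟩ ⊗ₜ t, rfl⟩, rfl⟩
  have hne : multEval hT.1 x₀ y (φ ⊗ₜ t) ≠ 0 := fun h =>
    tmul_ne_zero hφ0 ht (multEval_injective hT x₀ y (h.trans (map_zero _).symm))
  intro y'
  rw [eq_top_iff]
  rintro ψ -
  by_contra hψ
  obtain ⟨l, hl, hl'⟩ := Submodule.exists_le_ker_of_notMem hψ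
  have h1 : multEval hT.1 x₀ y' (ψ ⊗ₜ t) ∈ H.obj (x₀, y') :=
    (H.eq_top_of_mem hB hmem hne (x₀, y')) ▸ trivial
  obtain ⟨_, ⟨z, rfl⟩, hz⟩ := h1
  have h2 := multEval_injective hT x₀ y' hz
  have h3 : l.rTensor (T.obj x₀) ((G.obj y').subtype.rTensor (T.obj x₀) z) = 0 := by
    rw [← LinearMap.rTensor_comp_apply]
    have : l ∘ₗ (G.obj y').subtype = 0 := by
      ext k
      exact hl' k.2
    rw [this, LinearMap.rTensor_zero, LinearMap.zero_apply]
  have h4 := (congrArg (l.rTensor (T.obj x₀)) h2).symm.trans h3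
  exact tmul_ne_zero hl ht h4

lemma nonempty_box_iso (hT : IsAbsolutelySimple T) [Nontrivial (T.obj x₀)] (hB : Simple B)
    {y₀ : A} {η : T ⟶ CategoryTheory.Prod.sectL A y₀ ⋙ B} (hη : η ≠ 0) :
    Nonempty (box (multFamily T B x₀).toFunctor T ≅ B) := by
  let Φ : box (multFamily T B x₀).toFunctor T ⟶ B :=
    { app := fun p => ModuleCat.ofHom
        (multEval hT.1 p.1 p.2 ∘ₗ (boxEquiv _ T p.1 p.2).symm.toLinearMap)
      naturality := fun p p' f => by
        refine ModuleCat.hom_ext (LinearMap.ext fun z => ?_)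
        exact multEval_natural hT.1 f.1 f.2 ((boxEquiv _ T p.1 p.2).symm z) }
  obtain ⟨t, ht⟩ := exists_ne (0 : T.obj x₀)
  let φ : (multFamily T B x₀).toFunctor.obj y₀ := ⟨(η.app x₀).hom, η, rfl⟩
  have hφ : φ ≠ 0 := fun h =>
    hη (natTrans_ext_of_simple hT.1 ht (LinearMap.congr_fun (congrArg Subtype.val h) t))
  refine nonempty_iso_of_ne_zero (simple_box (simple_multFamily hT hB hη) hT) hB (η := Φ)
    (x := (x₀, y₀)) (m := boxEquiv _ T x₀ y₀ (φ ⊗ₜ t)) fun h => ?_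
  exact tmul_ne_zero hφ ht (multEval_injective hT x₀ y₀ (h.trans (map_zero _).symm))

lemma multFamily_isPolynomial {A : Type u} [Category.{v} A] [Preadditive A]
    {T : A ⥤ ModuleCat.{w} K} {B : A × A ⥤ ModuleCat.{w} K} {x₀ : A} (hB : IsPolynomialSnd B) :
    IsPolynomial (multFamily T B x₀).toFunctor := by
  rw [isPolynomial_iff]
  obtain ⟨d, hd⟩ := hB.exists_bmap x₀
  refine ⟨d, fun y y' a => ?_⟩
  ext φ
  apply Subtype.ext
  have h1 := (hd y y').map_linear ((LinearMap.llcomp K (T.obj x₀) _ _).flip φ.1) a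
  have h2 := deviation_map_linear (K := K) (d + 1)
    ((Submodule.subtype ((multFamily T B x₀).obj y')) ∘ₗ LinearMap.applyₗ φ)
    (fun g : y ⟶ y' => ((multFamily T B x₀).toFunctor.map g).hom) a
  exact h2.symm.trans h1

end Multiplicity

/-! ### The tensor product decomposition -/

section TensorDecompositionTheorem

variable {A : Type u} [Category.{v} A] [Preadditive A] [HasBinaryBiproducts A]
  {K : Type w} [Field K]
  (hK : ∀ I : CatIdeal A, I.IsCotrivial K → IsNonadditiveSplittingField K I.Quot)
include hK

/-- Over a big enough field, the simple functors with finite-dimensional values are the tensor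
products of a polynomial and an antipolynomial simple functor. -/
theorem simple_iff_exists_tensor (F : A ⥤ ModuleCat.{w} K) (hF : FiniteDimValued F) :
    Simple F ↔ ∃ S T : A ⥤ ModuleCat.{w} K,
      (Simple S ∧ IsPolynomial S ∧ FiniteDimValued S) ∧ (Simple T ∧ IsAntipolynomial T) ∧
      Nonempty (F ≅ S ⊗ T) := by
  constructor
  · intro hS
    obtain ⟨B, I, hB, hfd, hI, h1, h2, ⟨e⟩⟩ := exists_bifunctor_of_simple hF hS
    obtain ⟨⟨x₀, y₀⟩, h0⟩ := exists_nontrivial hB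
    -- This simple subfunctor of `B(-, y₀)` is the antipolynomial factor; the polynomial one is its
    -- multiplicity functor in `B`.
    obtain ⟨G, hG, hG0⟩ := exists_simple_sub_sectL hB hfd h0
    have hT : IsAntipolynomial G.toFunctor := IsAntipolynomial.of_map_eq hI fun {x x'} f f' hf => by
      ext m
      apply Subtype.ext
      exact LinearMap.congr_fun (h1 y₀ f f' hf) m.1
    have hT' := hT.isAbsolutelySimple hG hK
    obtain ⟨m, hm, hm0⟩ := Submodule.exists_mem_ne_zero_of_ne_bot hG0
    have hx₀ : Nontrivial (G.toFunctor.obj x₀) :=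
      ⟨⟨⟨m, hm⟩, 0, fun h => hm0 (congrArg Subtype.val h)⟩⟩
    have hη : G.incl ≠ 0 := fun h =>
      hm0 (congrArg (fun η : G.toFunctor ⟶ _ => (η.app x₀).hom ⟨m, hm⟩) h)
    obtain ⟨e'⟩ := nonempty_box_iso (x₀ := x₀) hT' hB hη
    refine ⟨_, _, ⟨simple_multFamily (x₀ := x₀) hT' hB hη, multFamily_isPolynomial h2, fun y => ?_⟩,
      ⟨hG, hT⟩, ⟨e ≪≫ Functor.isoWhiskerLeft _ e'.symm ≪≫ diagBoxIso _ _⟩⟩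
    have f1 : FiniteDimensional K (G.toFunctor.obj x₀) := hT.finiteDimValued hG x₀
    have f2 : FiniteDimensional K (B.obj (x₀, y)) := hfd _
    have f3 : FiniteDimensional K ((homFunctor B x₀ (G.toFunctor.obj x₀)).obj y) :=
      inferInstanceAs (FiniteDimensional K (G.toFunctor.obj x₀ →ₗ[K] B.obj (x₀, y)))
    exact FiniteDimensional.of_injective ((multFamily G.toFunctor B x₀).obj y).subtype
      Subtype.val_injective
  · rintro ⟨S, T, ⟨hS, hS', -⟩, ⟨hT, hT'⟩, ⟨e⟩⟩
    have hB := simple_box hS (hT'.isAbsolutelySimple hT hK)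
    obtain ⟨N, d, h⟩ := exists_hasBitype hB (hT'.box_fst S) (hS'.box_snd T)
    have := h.simple_diag hB
    exact Simple.of_iso (e ≪≫ (diagBoxIso S T).symm)

/-- The isomorphism lifts to the external products, where the two variables can be moved separately.
Fixing a vector `t` of `T` and contracting with a functional on `T'` gives a transformation `S ⟶
S'`, nonzero for a suitable functional; the roles are exchanged for `T`. -/
theorem nonempty_iso_of_tensor_iso {S S' T T' : A ⥤ ModuleCat.{w} K} (hS : Simple S)
    (hS1 : IsPolynomial S) (hS' : Simple S') (hS1' : IsPolynomial S') (hT : Simple T)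
    (hT1 : IsAntipolynomial T) (hT' : Simple T') (hT1' : IsAntipolynomial T')
    (e : S ⊗ T ≅ S' ⊗ T') : Nonempty (S ≅ S') ∧ Nonempty (T ≅ T') := by
  obtain ⟨E⟩ := nonempty_iso_of_diag_iso (simple_box hS (hT1.isAbsolutelySimple hT hK))
    (hT1.box_fst S) (hS1.box_snd T) (simple_box hS' (hT1'.isAbsolutelySimple hT' hK))
    (hT1'.box_fst S') (hS1'.box_snd T') (diagBoxIso S T ≪≫ e ≪≫ (diagBoxIso S' T').symm)
  obtain ⟨y, hy⟩ := exists_nontrivial hS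
  obtain ⟨x, hx⟩ := exists_nontrivial hT
  obtain ⟨s, hs⟩ := exists_ne (0 : S.obj y)
  obtain ⟨t, ht⟩ := exists_ne (0 : T.obj x)
  let L : ∀ x y, S.obj y ⊗[K] T.obj x →ₗ[K] S'.obj y ⊗[K] T'.obj x := fun x y =>
    (boxEquiv S' T' x y).symm.toLinearMap ∘ₗ (E.hom.app (x, y)).hom ∘ₗ
      (boxEquiv S T x y).toLinearMap
  have hL : ∀ {x x' y y' : A} (f : x ⟶ x') (g : y ⟶ y') (z : S.obj y ⊗[K] T.obj x),
      L x' y' (TensorProduct.map (S.map g).hom (T.map f).hom z) =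
        TensorProduct.map (S'.map g).hom (T'.map f).hom (L x y z) := fun {x x' y y'} f g z =>
    NatTrans.naturality_apply E.hom (X := (x, y)) (Y := (x', y')) (f, g) z
  have hL0 : L x y (s ⊗ₜ t) ≠ 0 := by
    intro h
    have h1 : (E.hom.app (x, y)).hom (boxEquiv S T x y (s ⊗ₜ t)) = 0 := h
    have h2 : (E.inv.app (x, y)).hom ((E.hom.app (x, y)).hom (boxEquiv S T x y (s ⊗ₜ t))) =
        boxEquiv S T x y (s ⊗ₜ t) := by
      rw [← ModuleCat.comp_apply, E.hom_inv_id_app]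
      rfl
    rw [h1, map_zero] at h2
    exact tmul_ne_zero hs ht ((LinearEquiv.map_eq_zero_iff _).1 h2.symm)
  constructor
  · obtain ⟨φ, hφ⟩ := exists_functional_right hL0
    let η : S ⟶ S' :=
      { app := fun y => ModuleCat.ofHom ((TensorProduct.rid K (S'.obj y)).toLinearMap ∘ₗ
          φ.lTensor (S'.obj y) ∘ₗ L x y ∘ₗ (TensorProduct.mk K _ _).flip t)
        naturality := fun y y' g => by
          ext s
          have h1 := hL (𝟙 x) g (s ⊗ₜ t)
          rw [TensorProduct.map_tmul, T.map_id, T'.map_id] at h1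
          have h2 : (TensorProduct.rid K (S'.obj y')).toLinearMap ∘ₗ φ.lTensor (S'.obj y') ∘ₗ
              TensorProduct.map (S'.map g).hom LinearMap.id =
              (S'.map g).hom ∘ₗ (TensorProduct.rid K (S'.obj y)).toLinearMap ∘ₗ
                φ.lTensor (S'.obj y) := by
            ext a b
            simp
          exact (congrArg (fun z => TensorProduct.rid K _ (φ.lTensor (S'.obj y') z)) h1).trans
            (LinearMap.congr_fun h2 _) }
    exact nonempty_iso_of_ne_zero hS hS' (η := η) (m := s) hφ
  · obtain ⟨φ, hφ⟩ := exists_functional_left hL0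
    let η : T ⟶ T' :=
      { app := fun x => ModuleCat.ofHom ((TensorProduct.lid K (T'.obj x)).toLinearMap ∘ₗ
          φ.rTensor (T'.obj x) ∘ₗ L x y ∘ₗ TensorProduct.mk K _ _ s)
        naturality := fun x x' f => by
          ext t
          have h1 := hL f (𝟙 y) (s ⊗ₜ t)
          rw [TensorProduct.map_tmul, S.map_id, S'.map_id] at h1
          have h2 : (TensorProduct.lid K (T'.obj x')).toLinearMap ∘ₗ φ.rTensor (T'.obj x') ∘ₗ
              TensorProduct.map LinearMap.id (T'.map f).hom =
              (T'.map f).hom ∘ₗ (TensorProduct.lid K (T'.obj x)).toLinearMap ∘ₗ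
                φ.rTensor (T'.obj x) := by
            ext a b
            simp
          exact (congrArg (fun z => TensorProduct.lid K _ (φ.rTensor (T'.obj x') z)) h1).trans
            (LinearMap.congr_fun h2 _) }
    exact nonempty_iso_of_ne_zero hT hT' (η := η) (m := t) hφ

end TensorDecompositionTheorem

end TensorDecomposition

namespace TensorDecomposition

/-! ### Roots of unity in positive characteristic -/

section RootsOfUnity

open Polynomial

/-- A nonzero element algebraic over `ZMod p` lies in a finite field, so it is a root of unity. An
irreducible polynomial over the algebraic part of `K` is thus `X` up to a constant or divides some
`X ^ n - 1`, which splits in `K`. -/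
lemma isAlgClosed_algebraicClosure {K : Type*} [Field K] (p : ℕ) [Fact p.Prime]
    [Algebra (ZMod p) K] (hK : ContainsAllRootsOfUnity K) :
    IsAlgClosed (algebraicClosure (ZMod p) K) := by
  refine IsAlgClosed.of_exists_root _ fun P hP hirr => ?_
  let k := algebraicClosure (ZMod p) K
  let L := AlgebraicClosure k
  obtain ⟨α, hα⟩ := IsAlgClosed.exists_aeval_eq_zero L P hirr.degree_pos.ne'
  by_cases h0 : α = 0
  · refine ⟨0, ?_⟩
    rw [h0, ← map_zero (algebraMap k L), aeval_algebraMap_apply, coe_aeval_eq_eval] at hα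
    exact (algebraMap k L).injective hα
  have hint : IsIntegral (ZMod p) α :=
    ((Algebra.IsAlgebraic.trans (ZMod p) k L).isAlgebraic α).isIntegral
  have := IntermediateField.adjoin.finiteDimensional hint
  have hfin : Finite (IntermediateField.adjoin (ZMod p) {α}) := Module.finite_of_finite (ZMod p)
  have := Fintype.ofFinite (IntermediateField.adjoin (ZMod p) {α})
  set n := Fintype.card (IntermediateField.adjoin (ZMod p) {α}) - 1 with hn
  have hn0 : 0 < n := Nat.sub_pos_of_lt Fintype.one_lt_card
  have hαn : α ^ n = 1 := by
    have h1 := FiniteField.pow_card_sub_one_eq_one (IntermediateField.AdjoinSimple.gen (ZMod p) α)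
      (fun h => h0 (by simpa using congrArg Subtype.val h))
    exact congrArg Subtype.val h1
  have hdvd : P ∣ X ^ n - 1 := by
    rw [minpoly.eq_of_irreducible_of_monic hirr hα hP]
    exact minpoly.dvd _ _ (by simp [hαn])
  have hdvd' : P.map (algebraMap k K) ∣ X ^ n - 1 := by
    have := Polynomial.map_dvd (algebraMap k K) hdvd
    simpa using this
  have hne : (X ^ n - 1 : K[X]) ≠ 0 := (monic_X_pow_sub_C (1 : K) hn0.ne').ne_zero
  obtain ⟨β, hβ⟩ := ((hK n hn0).of_dvd hne hdvd').exists_eval_eq_zero (by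
    rw [degree_map]
    exact hirr.degree_pos.ne')
  have hβn : β ^ n = 1 := by
    obtain ⟨Q, hQ⟩ := hdvd'
    have := congrArg (eval β) hQ
    rw [eval_mul, hβ, zero_mul] at this
    simpa [sub_eq_zero] using this
  have hβk : β ∈ k := by
    rw [mem_algebraicClosure_iff]
    refine IsIntegral.isAlgebraic ⟨X ^ n - 1, monic_X_pow_sub_C (1 : ZMod p) hn0.ne', ?_⟩
    simp [hβn]
  refine ⟨⟨β, hβk⟩, ?_⟩
  apply (algebraMap k K).injective
  rw [map_zero, ← hβ, Polynomial.eval_map]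
  exact (eval₂_at_apply (algebraMap k K) ⟨β, hβk⟩).symm

end RootsOfUnity

/-! ### Descent of simple functors to an algebraically closed subfield -/

section AlgClosed

variable {C : Type u} [Category.{v} C]

lemma isAbsolutelySimple_of_isAlgClosed {k : Type w} [Field k] [IsAlgClosed k]
    {T : C ⥤ ModuleCat.{w} k} (hT : Simple T) (hfd : FiniteDimValued T) :
    IsAbsolutelySimple T := by
  obtain ⟨x, hx⟩ := exists_nontrivial hT
  obtain ⟨t, ht⟩ := exists_ne (0 : T.obj x)
  refine ⟨hT, fun a b h => ?_, fun η => ?_⟩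
  · have h1 : a • t = b • t := congrArg (fun η : T ⟶ T => (η.app x).hom t) h
    exact smul_left_injective k ht h1
  · have : FiniteDimensional k (T.obj x) := hfd x
    obtain ⟨c, hc⟩ := Module.End.exists_eigenvalue (η.app x).hom
    obtain ⟨s, hs⟩ := hc.exists_hasEigenvector
    exact ⟨c, natTrans_ext_of_simple hT hs.2 hs.apply_eq_smul.symm⟩

/-- As morphism sets are finite, a vector generates a `k`-subfunctor with finite-dimensional values,
which contains a simple one `T`. It is absolutely simple over `k`, so `K ⊗[k] T` embeds in `S`, and
it fills `S` by simplicity. Endomorphisms of a scalar extension of such a `T` are scalars. -/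
lemma exists_smul_of_isAlgClosed {k K : Type w} [Field k] [Field K] [Algebra k K] [IsAlgClosed k]
    [∀ x y : C, Finite (x ⟶ y)] {S : C ⥤ ModuleCat.{w} K} (hS : Simple S)
    [∀ x, Module k (S.obj x)] [∀ x, IsScalarTower k K (S.obj x)] (η : S ⟶ S) :
    ∃ c : K, c • 𝟙 S = η := by
  obtain ⟨x₀, hx₀⟩ := exists_nontrivial hS
  obtain ⟨m₀, hm₀⟩ := exists_ne (0 : S.obj x₀)
  let X : C ⥤ ModuleCat.{w} k :=
    { obj := fun x => ModuleCat.of k (S.obj x)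
      map := fun f => ModuleCat.ofHom ((S.map f).hom.restrictScalars k)
      map_id := fun x => by ext; simp
      map_comp := fun f g => by ext; simp }
  let Y := Subfamily.gen X (x := x₀) m₀
  have hY : FiniteDimValued Y.toFunctor := fun y =>
    FiniteDimensional.span_of_finite k
      (Set.finite_range fun f : x₀ ⟶ y => (X.map f).hom (m₀ : X.obj x₀))
  have := hY x₀
  have : Nontrivial (Y.toFunctor.obj x₀) :=
    ⟨⟨⟨m₀, Subfamily.mem_gen (F := X) (x := x₀) m₀⟩, 0, fun h => hm₀ (congrArg Subtype.val h)⟩⟩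
  obtain ⟨G, hG, hG0⟩ := exists_simple_subfamily (X := Y.toFunctor) (x₀ := x₀) fun {x m} hm => by
    obtain ⟨a, ha⟩ := exists_map_ne_zero hS (x := x) (m := m.1) (fun h => hm (Subtype.ext h)) x₀
    exact ⟨a, fun h => ha (congrArg Subtype.val h)⟩
  let T := G.toFunctor
  have hTfd : FiniteDimValued T := fun x => by
    have := hY x
    exact FiniteDimensional.of_injective (G.obj x).subtype Subtype.val_injective
  have hT := isAbsolutelySimple_of_isAlgClosed hG hTfd
  let ι : ∀ x, T.obj x →ₗ[k] S.obj x := fun x => (Y.obj x).subtype ∘ₗ (G.obj x).subtype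
  have hι : ∀ x t, ι x t = 0 → t = 0 := fun x t h => Subtype.ext (Subtype.ext h)
  have hιn : ∀ {x y : C} (f : x ⟶ y) (t : T.obj x), ι y ((T.map f).hom t) = (S.map f).hom (ι x t) :=
    fun f t => rfl
  let Φ : ∀ x, K ⊗[k] T.obj x →ₗ[k] S.obj x := fun x =>
    TensorProduct.lift (LinearMap.mk₂ k (fun c t => c • ι x t) (fun _ _ _ => add_smul _ _ _)
      (fun _ _ _ => smul_assoc _ _ _) (fun c t t' => by rw [map_add, smul_add])
      (fun a c t => by rw [map_smul, smul_comm]))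
  have hΦ : ∀ x c t, Φ x (c ⊗ₜ t) = c • ι x t := fun x c t => rfl
  have hΦn : ∀ {x y : C} (f : x ⟶ y) (z : K ⊗[k] T.obj x),
      Φ y ((T.map f).hom.lTensor K z) = (S.map f).hom (Φ x z) := by
    intro x y f z
    induction z using TensorProduct.induction_on with
    | zero => simp only [map_zero]
    | add a b ha hb => rw [map_add, map_add, map_add, map_add, ha, hb]
    | tmul c t => rw [LinearMap.lTensor_tmul, hΦ, hΦ, map_smul, hιn]
  have hΦi : ∀ x, Function.Injective (Φ x) := by
    intro x
    rw [← LinearMap.ker_eq_bot]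
    by_contra hne
    obtain ⟨x', c, t, hc, ht, h⟩ := exists_tmul_mem_of_absolutelySimple hT K
      (fun x => LinearMap.ker (Φ x)) (fun {x y} f z hz => by
        rw [LinearMap.mem_ker, hΦn, LinearMap.mem_ker.1 hz, map_zero]) ⟨x, hne⟩
    exact (smul_ne_zero hc fun h => ht (hι x' t h)) h
  obtain ⟨t, ht, ht0⟩ := Submodule.exists_mem_ne_zero_of_ne_bot hG0
  let t₀ : T.obj x₀ := ⟨t, ht⟩
  have ht₀ : t₀ ≠ 0 := fun h => ht0 (congrArg Subtype.val h)
  let R : Subfamily S :=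
    { obj := fun x =>
        { carrier := Set.range (Φ x)
          add_mem' := by
            rintro _ _ ⟨a, rfl⟩ ⟨b, rfl⟩
            exact ⟨a + b, map_add _ _ _⟩
          zero_mem' := ⟨0, map_zero _⟩
          smul_mem' := by
            rintro c _ ⟨z, rfl⟩
            refine ⟨(LinearMap.mulLeft k c).rTensor (T.obj x) z, ?_⟩
            induction z using TensorProduct.induction_on with
            | zero => simp only [map_zero, smul_zero]
            | add a b ha hb => rw [map_add, map_add, map_add, smul_add, ha, hb]
            | tmul d t => rw [LinearMap.rTensor_tmul, hΦ, hΦ, LinearMap.mulLeft_apply, mul_smul] }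
      map_mem := by
        rintro x y f _ ⟨z, rfl⟩
        exact ⟨_, hΦn f z⟩ }
  have hR : ∀ x (m : S.obj x), ∃ z, Φ x z = m := fun x m => by
    have : m ∈ R.obj x := by
      rw [R.eq_top_of_mem hS (x := x₀) (m := ι x₀ t₀) ⟨1 ⊗ₜ t₀, by rw [hΦ, one_smul]⟩
        fun h => ht₀ (hι _ _ h)]
      trivial
    exact this
  let e : ∀ x, (K ⊗[k] T.obj x) ≃ₗ[k] S.obj x := fun x =>
    LinearEquiv.ofBijective (Φ x) ⟨hΦi x, hR x⟩
  let Ψ : ∀ x, T.obj x →ₗ[k] K ⊗[k] T.obj x := fun x =>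
    (e x).symm.toLinearMap ∘ₗ (η.app x).hom.restrictScalars k ∘ₗ ι x
  have hΨ : ∀ x t, Φ x (Ψ x t) = (η.app x).hom (ι x t) := fun x t => (e x).apply_symm_apply _
  have hΨn : ∀ {x y : C} (f : x ⟶ y) (t : T.obj x),
      Ψ y ((T.map f).hom t) = (T.map f).hom.lTensor K (Ψ x t) := by
    intro x y f t
    apply hΦi y
    rw [hΨ, hΦn, hΨ, hιn]
    exact NatTrans.naturality_apply η f (ι x t)
  -- Contracting `Ψ : T → K ⊗ T` with a functional on `K` gives an endomorphism of `T`, hence a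
  -- scalar. As functionals separate the points of `K ⊗ T`, this forces `Ψ t₀ = c ⊗ t₀`.
  have hφ : ∀ φ : K →ₗ[k] k, ∃ a : k, TensorProduct.lid k _ (φ.rTensor _ (Ψ x₀ t₀)) = a • t₀ := by
    intro φ
    let θ : T ⟶ T :=
      { app := fun x => ModuleCat.ofHom ((TensorProduct.lid k (T.obj x)).toLinearMap ∘ₗ
          φ.rTensor (T.obj x) ∘ₗ Ψ x)
        naturality := fun x y f => by
          ext t
          have h2 : (TensorProduct.lid k (T.obj y)).toLinearMap ∘ₗ φ.rTensor (T.obj y) ∘ₗ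
              (T.map f).hom.lTensor K =
              (T.map f).hom ∘ₗ (TensorProduct.lid k (T.obj x)).toLinearMap ∘ₗ
                φ.rTensor (T.obj x) := by
            ext a b
            simp
          exact (congrArg (fun z => TensorProduct.lid k _ (φ.rTensor (T.obj y) z)) (hΨn f t)).trans
            (LinearMap.congr_fun h2 _) }
    obtain ⟨a, ha⟩ := hT.2.2 θ
    exact ⟨a, (congrArg (fun θ : T ⟶ T => (θ.app x₀).hom t₀) ha).symm⟩
  obtain ⟨ψ, hψ⟩ : ∃ ψ : T.obj x₀ →ₗ[k] k, ψ t₀ = 1 := by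
    obtain ⟨ψ, hψ⟩ : ∃ ψ : T.obj x₀ →ₗ[k] k, ψ t₀ ≠ 0 := by
      by_contra! h
      exact ht₀ ((Module.forall_dual_apply_eq_zero_iff k t₀).1 h)
    exact ⟨(ψ t₀)⁻¹ • ψ, by simp [hψ]⟩
  let c : K := TensorProduct.rid k K (ψ.lTensor K (Ψ x₀ t₀))
  have hz : Ψ x₀ t₀ = c ⊗ₜ t₀ := by
    rw [← sub_eq_zero]
    by_contra hne
    obtain ⟨φ, h⟩ := exists_functional_left hne
    apply h
    obtain ⟨a, ha⟩ := hφ φ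
    have h1 : φ ∘ₗ (TensorProduct.rid k K).toLinearMap ∘ₗ ψ.lTensor K =
        ψ ∘ₗ (TensorProduct.lid k (T.obj x₀)).toLinearMap ∘ₗ φ.rTensor (T.obj x₀) := by
      ext a b
      simp [mul_comm]
    have h2 : φ c = a := by
      refine (LinearMap.congr_fun h1 (Ψ x₀ t₀)).trans ?_
      refine (congrArg ψ ha).trans ?_
      rw [map_smul, hψ, smul_eq_mul, mul_one]
    rw [map_sub, map_sub, ha, LinearMap.rTensor_tmul, TensorProduct.lid_tmul, h2, sub_self]
  refine ⟨c, natTrans_ext_of_simple hS (x := x₀) (t := ι x₀ t₀) (fun h => ht₀ (hι _ _ h)) ?_⟩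
  rw [← hΨ, hz, hΦ]
  rfl

lemma exists_smul_of_algClosed_algebra (k : Type w) {K : Type w} [Field k] [Field K] [Algebra k K]
    [IsAlgClosed k] [∀ x y : C, Finite (x ⟶ y)] {S : C ⥤ ModuleCat.{w} K} (hS : Simple S)
    (η : S ⟶ S) : ∃ c : K, c • 𝟙 S = η := by
  let : ∀ x, Module k (S.obj x) := fun x => Module.compHom _ (algebraMap k K)
  have : ∀ x, IsScalarTower k K (S.obj x) := fun x => ⟨fun a c m => by
    rw [Algebra.smul_def, mul_smul]
    rfl⟩
  exact exists_smul_of_isAlgClosed (k := k) hS η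

lemma exists_smul_of_charP {K : Type w} [Field K] (p : ℕ) [Fact p.Prime] [CharP K p]
    (hK : ContainsAllRootsOfUnity K) [∀ x y : C, Finite (x ⟶ y)] {S : C ⥤ ModuleCat.{w} K}
    (hS : Simple S) (η : S ⟶ S) : ∃ c : K, c • 𝟙 S = η := by
  let : Algebra (ZMod p) K := ZMod.algebra K p
  have := isAlgClosed_algebraicClosure p hK
  exact exists_smul_of_algClosed_algebra (algebraicClosure (ZMod p) K) hS η

end AlgClosed

end TensorDecomposition

namespace TensorDecomposition

/-! ### Irreducible representations of finite `p`-groups -/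

section Irreducible

variable {K V : Type*} [Field K] [AddCommGroup V] [Module K V]

open Module (End)

/-- Irreducibility of a linear action. -/
structure IsIrr {G : Type*} [Monoid G] (ρ : G →* End K V) : Prop where
  nontrivial : Nontrivial V
  eq_bot_or_eq_top : ∀ W : Submodule K V, (∀ g, ∀ w ∈ W, ρ g w ∈ W) → W = ⊥ ∨ W = ⊤

/-- The action induced on a stable subspace. -/
def restrictHom {G : Type*} [Monoid G] (ρ : G →* End K V) (W : Submodule K V)
    (hW : ∀ g, ∀ w ∈ W, ρ g w ∈ W) : G →* End K W where
  toFun g := (ρ g).restrict (hW g)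
  map_one' := by
    ext w
    simp
  map_mul' g h := by
    ext w
    simp

lemma IsIrr.eq_smul_one {G : Type*} [Monoid G] {ρ : G →* End K V} (hρ : IsIrr ρ) {φ : End K V}
    (hφ : ∀ g, Commute φ (ρ g)) {v : V} (hv : v ≠ 0) {c : K} (h : φ v = c • v) :
    φ = c • 1 := by
  have h1 : LinearMap.ker (φ - c • 1) = ⊤ := by
    refine (hρ.eq_bot_or_eq_top _ fun g w hw => ?_).resolve_left fun h1 => hv ?_
    · rw [LinearMap.mem_ker] at hw ⊢
      have : Commute (φ - c • 1) (ρ g) := (hφ g).sub_left ((Commute.one_left _).smul_left c)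
      rw [← Module.End.mul_apply, this.eq, Module.End.mul_apply, hw, map_zero]
    · rw [← Submodule.mem_bot K, ← h1]
      simp [h]
  rwa [LinearMap.ker_eq_top, sub_eq_zero] at h1

lemma exists_hasEigenvalue_of_pow_eq_one [FiniteDimensional K V] [Nontrivial V]
    (hK : ContainsAllRootsOfUnity K) {f : End K V} {n : ℕ} (hn : 0 < n) (h : f ^ n = 1) :
    ∃ c : K, f.HasEigenvalue c := by
  have hne : (Polynomial.X ^ n - 1 : Polynomial K) ≠ 0 :=
    (Polynomial.monic_X_pow_sub_C (1 : K) hn.ne').ne_zero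
  have hdvd : minpoly K f ∣ Polynomial.X ^ n - 1 := minpoly.dvd _ _ (by simp [h])
  obtain ⟨c, hc⟩ := ((hK n hn).of_dvd hne hdvd).exists_eval_eq_zero
    (minpoly.degree_pos (Algebra.IsIntegral.isIntegral f)).ne'
  exact ⟨c, Module.End.hasEigenvalue_of_isRoot hc⟩

lemma map_mul_inv_self {G : Type*} [Group G] (ρ : G →* End K V) (g : G) : ρ g * ρ g⁻¹ = 1 := by
  rw [← map_mul, mul_inv_cancel, map_one]

lemma map_inv_mul_self {G : Type*} [Group G] (ρ : G →* End K V) (g : G) : ρ g⁻¹ * ρ g = 1 := by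
  rw [← map_mul, inv_mul_cancel, map_one]

/-- The elements acting through scalars. -/
def scalarSubgroup {G : Type*} [Group G] (ρ : G →* End K V) : Subgroup G where
  carrier := {g | ∃ c : K, c ≠ 0 ∧ ρ g = c • 1}
  mul_mem' := by
    rintro g h ⟨c, hc, h1⟩ ⟨d, hd, h2⟩
    exact ⟨c * d, mul_ne_zero hc hd, by rw [map_mul, h1, h2, smul_mul_smul_comm, one_mul]⟩
  one_mem' := ⟨1, one_ne_zero, by simp⟩
  inv_mem' := by
    rintro g ⟨c, hc, h⟩
    refine ⟨c⁻¹, inv_ne_zero hc, ?_⟩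
    have := map_mul_inv_self ρ g
    rw [h, smul_mul_assoc, one_mul] at this
    rw [← this, smul_smul, inv_mul_cancel₀ hc, one_smul]

instance {G : Type*} [Group G] (ρ : G →* End K V) : (scalarSubgroup ρ).Normal where
  conj_mem := by
    rintro g ⟨c, hc, h⟩ x
    refine ⟨c, hc, ?_⟩
    rw [map_mul, map_mul, h, mul_smul_comm, mul_one, smul_mul_assoc, map_mul_inv_self]

/-- The elements whose action commutes with that of a given element. -/
def commSubgroup {G : Type*} [Group G] (ρ : G →* End K V) (a : G) : Subgroup G where
  carrier := {g | Commute (ρ a) (ρ g)}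
  mul_mem' {g h} hg hh := by
    rw [Set.mem_ofPred_eq, map_mul]
    exact Commute.mul_right hg hh
  one_mem' := by simp
  inv_mem' {g} hg := by
    have hg : ρ a * ρ g = ρ g * ρ a := hg
    calc ρ a * ρ g⁻¹ = ρ g⁻¹ * (ρ g * ρ a) * ρ g⁻¹ := by
          rw [← mul_assoc, map_inv_mul_self, one_mul]
      _ = ρ g⁻¹ * ρ a := by
          rw [← hg, mul_assoc, mul_assoc, map_mul_inv_self, mul_one]

/-- Irreducible representations of `p`-groups over a field containing all roots of unity have
scalar endomorphisms. -/
theorem exists_smul_of_isPGroup {p : ℕ} [Fact p.Prime] (hK : ContainsAllRootsOfUnity K)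
    {G : Type*} [Group G] [Finite G] (hG : IsPGroup p G) [FiniteDimensional K V]
    {ρ : G →* End K V} (hρ : IsIrr ρ) {φ : End K V} (hφ : ∀ g, Commute φ (ρ g)) :
    ∃ c : K, φ = c • 1 := by
  induction hn : Nat.card G using Nat.strong_induction_on generalizing G V with
  | _ n ih =>
  have := hρ.nontrivial
  -- If the whole group acts by scalars, irreducibility makes `V` a line.
  by_cases htop : scalarSubgroup ρ = ⊤
  · obtain ⟨v, hv⟩ := exists_ne (0 : V)
    have h1 : Submodule.span K {v} = ⊤ := by
      refine (hρ.eq_bot_or_eq_top _ fun g w hw => ?_).resolve_left (by simpa using hv)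
      obtain ⟨c, -, hc⟩ : g ∈ scalarSubgroup ρ := htop ▸ trivial
      rw [hc]
      exact Submodule.smul_mem _ c hw
    obtain ⟨c, hc⟩ := Submodule.mem_span_singleton.1 (h1 ▸ trivial : φ v ∈ Submodule.span K {v})
    exact ⟨c, hρ.eq_smul_one hφ hv hc.symm⟩
  have hnt : Nontrivial (G ⧸ scalarSubgroup ρ) := QuotientGroup.nontrivial_iff.2 htop
  -- Take a nonscalar `a` whose class modulo the scalars is central. Every `g` commutes with `a` up
  -- to a scalar, so it permutes the eigenspaces of `ρ a`. An eigenspace `W` is stable under the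
  -- proper subgroup commuting with `ρ a`, and the induction is applied there.
  have := (hG.to_quotient (scalarSubgroup ρ)).center_nontrivial
  obtain ⟨⟨z, hz⟩, hz1⟩ := exists_ne (1 : Subgroup.center (G ⧸ scalarSubgroup ρ))
  obtain ⟨a, rfl⟩ := QuotientGroup.mk_surjective z
  have ha : a ∉ scalarSubgroup ρ := fun h =>
    hz1 (Subtype.ext ((QuotientGroup.eq_one_iff a).2 h))
  have hcomm : ∀ g, ∃ c : K, c ≠ 0 ∧ ρ g * ρ a = c • (ρ a * ρ g) := by
    intro g
    have h1 := Subgroup.mem_center_iff.1 hz (g : G ⧸ scalarSubgroup ρ)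
    rw [← QuotientGroup.mk_mul, ← QuotientGroup.mk_mul, eq_comm, QuotientGroup.eq] at h1
    obtain ⟨c, hc0, hc⟩ := h1
    refine ⟨c, hc0, ?_⟩
    rw [← map_mul, ← map_mul, ← mul_one (ρ (a * g)), ← mul_smul_comm, ← hc, ← map_mul,
      mul_inv_cancel_left]
  obtain ⟨l, hl⟩ := exists_hasEigenvalue_of_pow_eq_one hK (orderOf_pos a)
    (f := ρ a) (by rw [← map_pow, pow_orderOf_eq_one, map_one])
  let W := (ρ a).eigenspace l
  have hW : ∀ h : commSubgroup ρ a, ∀ w ∈ W, ρ h w ∈ W := by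
    rintro ⟨h, hh⟩ w hw
    rw [Module.End.mem_eigenspace_iff] at hw ⊢
    have hh : Commute (ρ a) (ρ h) := hh
    rw [← Module.End.mul_apply, hh.eq, Module.End.mul_apply, hw, map_smul]
  have hWbot : W ≠ ⊥ := hl
  have hl0 : l ≠ 0 := by
    rintro rfl
    obtain ⟨w, hw, hw0⟩ := Submodule.exists_mem_ne_zero_of_ne_bot hWbot
    rw [Module.End.mem_eigenspace_iff, zero_smul] at hw
    apply hw0
    have := LinearMap.congr_fun (map_inv_mul_self ρ a) w
    rwa [Module.End.mul_apply, hw, map_zero, eq_comm] at this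
  have hH : commSubgroup ρ a ≠ ⊤ := by
    intro h
    have h1 : W = ⊤ := (hρ.eq_bot_or_eq_top W fun g w hw =>
      hW ⟨g, h ▸ trivial⟩ w hw).resolve_left hWbot
    refine ha ⟨l, hl0, ?_⟩
    ext w
    exact Module.End.mem_eigenspace_iff.1 (h1 ▸ trivial : w ∈ W)
  have hcard : Nat.card (commSubgroup ρ a) < n := by
    rw [← hn]
    exact not_le.1 fun h => hH ((commSubgroup ρ a).eq_top_of_le_card h)
  have hirr : IsIrr (restrictHom (ρ.comp (commSubgroup ρ a).subtype) W hW) := by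
    refine ⟨(Submodule.nontrivial_iff_ne_bot).2 hWbot, fun U hU => ?_⟩
    by_cases hUbot : U = ⊥
    · exact Or.inl hUbot
    right
    let U' := U.map W.subtype
    let X := ⨆ μ, ⨆ (_ : μ ≠ l), (ρ a).eigenspace μ
    have h1 : (⨆ g, U'.map (ρ g)) = ⊤ := by
      refine (hρ.eq_bot_or_eq_top _ fun g w hw => ?_).resolve_left fun h => hUbot ?_
      · have : (⨆ g, U'.map (ρ g)) ≤ (⨆ g, U'.map (ρ g)).comap (ρ g) := by
          refine iSup_le fun g' => ?_
          rw [← Submodule.map_le_iff_le_comap, ← Submodule.map_comp]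
          refine le_trans ?_ (le_iSup _ (g * g'))
          rw [map_mul]
          rfl
        exact this hw
      · have h2 : U' ≤ ⊥ := by
          rw [← h]
          refine le_trans ?_ (le_iSup _ 1)
          rw [map_one]
          exact (Submodule.map_id U').ge
        rw [le_bot_iff, ← LinearMap.le_ker_iff_map, Submodule.ker_subtype] at h2
        exact le_bot_iff.1 h2
    -- Elements commuting with `ρ a` preserve `U'`, and all others move it into the other
    -- eigenspaces. As the translates of `U'` span `V`, the modular law gives `U' = W`.
    have h2 : (⨆ g, U'.map (ρ g)) ≤ U' ⊔ X := by
      refine iSup_le fun g => ?_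
      by_cases hg : g ∈ commSubgroup ρ a
      · refine le_trans ?_ le_sup_left
        rintro _ ⟨_, ⟨w, hw, rfl⟩, rfl⟩
        exact ⟨_, hU ⟨g, hg⟩ w hw, rfl⟩
      · refine le_trans ?_ le_sup_right
        obtain ⟨c, hc0, hc⟩ := hcomm g
        have hne : c⁻¹ * l ≠ l := by
          intro h
          have : c = 1 := by
            have := mul_right_cancel₀ hl0 (h.trans (one_mul l).symm)
            rwa [inv_eq_one] at this
          rw [this, one_smul] at hc
          exact hg hc.symm
        refine le_trans ?_ (le_iSup₂ (f := fun μ (_ : μ ≠ l) => (ρ a).eigenspace μ) _ hne)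
        rintro _ ⟨_, ⟨w, hw, rfl⟩, rfl⟩
        rw [Module.End.mem_eigenspace_iff]
        have h3 := LinearMap.congr_fun hc w.1
        rw [Module.End.mul_apply, Module.End.mem_eigenspace_iff.1 w.2, map_smul,
          LinearMap.smul_apply, Module.End.mul_apply] at h3
        rw [Submodule.subtype_apply, mul_smul, h3, smul_smul, inv_mul_cancel₀ hc0, one_smul]
    rw [h1, top_le_iff] at h2
    have h3 : U' ≤ W := Submodule.map_subtype_le W U
    have h4 : Disjoint W X := (ρ a).eigenspaces_iSupIndep l
    have h5 : W = U' := by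
      calc W = (U' ⊔ X) ⊓ W := by rw [h2, top_inf_eq]
        _ = U' ⊔ X ⊓ W := (sup_inf_assoc_of_le X h3).symm ▸ rfl
        _ = U' := by rw [inf_comm, h4.eq_bot, sup_bot_eq]
    rw [eq_top_iff]
    rintro w -
    obtain ⟨w', hw', h6⟩ : (w : V) ∈ U' := h5 ▸ w.2
    rwa [← Subtype.ext h6]
  have hφW : ∀ w ∈ W, φ w ∈ W := by
    intro w hw
    rw [Module.End.mem_eigenspace_iff] at hw ⊢
    rw [← Module.End.mul_apply, ← (hφ a).eq, Module.End.mul_apply, hw, map_smul]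
  obtain ⟨c, hc⟩ := ih _ hcard (hG.to_subgroup _) hirr (φ := φ.restrict hφW) (fun g => by
    ext w
    exact LinearMap.congr_fun (hφ g) w.1) rfl
  obtain ⟨w, hw, hw0⟩ := Submodule.exists_mem_ne_zero_of_ne_bot hWbot
  exact ⟨c, hρ.eq_smul_one hφ hw0 (congrArg Subtype.val (LinearMap.congr_fun hc ⟨w, hw⟩))⟩

end Irreducible

end TensorDecomposition

namespace TensorDecomposition

/-! ### From finite monoids to finite groups -/

section MonoidAction

variable {K V : Type*} [Field K] [AddCommGroup V] [Module K V] [FiniteDimensional K V]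

open Module (End)

/-- The units of the endomorphisms of `W` that are induced by an element of `E`. -/
def inducedUnits (E : Submonoid (End K V)) [Finite E] (W : Submodule K V) :
    Subgroup (End K W)ˣ where
  carrier := {γ | ∃ e ∈ E, ∀ w : W, (γ.1 w : V) = e w}
  mul_mem' := by
    rintro γ γ' ⟨e, he, h⟩ ⟨e', he', h'⟩
    exact ⟨e * e', E.mul_mem he he', fun w => by
      rw [Units.val_mul, Module.End.mul_apply, h, h', Module.End.mul_apply]⟩
  one_mem' := ⟨1, E.one_mem, fun w => rfl⟩
  inv_mem' := by
    rintro γ ⟨e, he, h⟩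
    -- Finiteness of `E` gives `γ` finite order, so its inverse is one of its natural powers, and
    -- these are induced by `E`.
    have hpow : ∀ n : ℕ, ∃ e' ∈ E, ∀ w : W, ((γ ^ n).1 w : V) = e' w := by
      intro n
      induction n with
      | zero => exact ⟨1, E.one_mem, fun w => by simp⟩
      | succ n ih =>
        obtain ⟨e', he', h'⟩ := ih
        exact ⟨e' * e, E.mul_mem he' he, fun w => by
          rw [pow_succ, Units.val_mul, Module.End.mul_apply, h', Module.End.mul_apply, h]⟩
    choose e' he' h' using hpow
    obtain ⟨i, j, hij, heq⟩ := Finite.exists_ne_map_eq_of_infinite fun n => (⟨e' n, he' n⟩ : E)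
    have hpow_eq : γ ^ i = γ ^ j := by
      ext w
      rw [h', h']
      exact LinearMap.congr_fun (congrArg Subtype.val heq) w.1
    have hfin : IsOfFinOrder γ := isOfFinOrder_iff_pow_eq_one.2 (by
      rcases lt_or_gt_of_ne hij with hlt | hlt
      · exact ⟨j - i, Nat.sub_pos_of_lt hlt, by
          rw [pow_sub _ hlt.le, hpow_eq, mul_inv_cancel]⟩
      · exact ⟨i - j, Nat.sub_pos_of_lt hlt, by
          rw [pow_sub _ hlt.le, hpow_eq, mul_inv_cancel]⟩)
    have hmem : γ⁻¹ ∈ Submonoid.powers γ := by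
      rw [← SetLike.mem_coe, hfin.powers_eq_zpowers]
      exact (Subgroup.zpowers γ).inv_mem (Subgroup.mem_zpowers γ)
    obtain ⟨n, hn⟩ := hmem
    dsimp only at hn
    exact ⟨e' n, he' n, hn ▸ h' n⟩

instance (E : Submonoid (End K V)) [Finite E] (W : Submodule K V) : Finite (inducedUnits E W) := by
  choose e he h using fun γ : inducedUnits E W => γ.2
  refine Finite.of_injective (fun γ => (⟨e γ, he γ⟩ : E)) fun γ γ' heq => ?_
  apply Subtype.ext
  ext w
  rw [h γ, h γ']
  exact LinearMap.congr_fun (congrArg Subtype.val heq) w.1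

/-- An irreducible finite monoid of endomorphisms contains the projection to a nonzero subspace on
which the induced group of automorphisms acts irreducibly. -/
lemma exists_projection_of_finite_submonoid [Nontrivial V] (E : Submonoid (End K V)) [Finite E]
    (hE : ∀ W : Submodule K V, (∀ e ∈ E, ∀ w ∈ W, e w ∈ W) → W = ⊥ ∨ W = ⊤) :
    ∃ (W : Submodule K V) (g : End K V), g ∈ E ∧ LinearMap.range g = W ∧ (∀ w ∈ W, g w = w) ∧
      IsIrr ((Units.coeHom (End K W)).comp (inducedUnits E W).subtype) := by
  classical
  have hspan : ∀ m : V, m ≠ 0 → Submodule.span K {v | ∃ e ∈ E, v = e m} = ⊤ := by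
    intro m hm
    refine (hE _ fun e he w hw => ?_).resolve_left fun h => hm ?_
    · have : Submodule.span K {v | ∃ e ∈ E, v = e m} ≤
          (Submodule.span K {v | ∃ e ∈ E, v = e m}).comap e := by
        rw [Submodule.span_le]
        rintro _ ⟨e', he', rfl⟩
        exact Submodule.subset_span ⟨e * e', E.mul_mem he he', rfl⟩
      exact this hw
    · rw [← Submodule.mem_bot K, ← h]
      exact Submodule.subset_span ⟨1, E.one_mem, rfl⟩
  -- Let `x` be nonzero of minimal rank, with range `W`. Some `x * e * x` is nonzero, so `c = x * e`
  -- maps `W` onto itself. Two powers of `c` agree, hence a positive power fixes `W` pointwise and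
  -- is the projection sought.
  let P : ℕ → Prop := fun n => ∃ x ∈ E, x ≠ 0 ∧ Module.finrank K (LinearMap.range x) = n
  have hP : ∃ n, P n := ⟨_, 1, E.one_mem, one_ne_zero, rfl⟩
  obtain ⟨x, hx, hx0, hn⟩ := Nat.find_spec hP
  have hmin : ∀ y ∈ E, y ≠ 0 → Module.finrank K (LinearMap.range x) ≤
      Module.finrank K (LinearMap.range y) := fun y hy hy0 => by
    rw [hn]
    exact Nat.find_min' hP ⟨y, hy, hy0, rfl⟩
  let W := LinearMap.range x
  have hle : ∀ y ∈ E, y ≠ 0 → LinearMap.range y ≤ W → LinearMap.range y = W :=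
    fun y hy hy0 h => Submodule.eq_of_le_of_finrank_le h (hmin y hy hy0)
  obtain ⟨e, he, hxex⟩ : ∃ e ∈ E, x * e * x ≠ 0 := by
    by_contra! h
    obtain ⟨m, hm⟩ : ∃ m, x m ≠ 0 := by
      by_contra! h
      exact hx0 (LinearMap.ext h)
    have h1 : Submodule.span K {v | ∃ e ∈ E, v = e (x m)} ≤ LinearMap.ker x := by
      rw [Submodule.span_le]
      rintro _ ⟨e, he, rfl⟩
      exact LinearMap.congr_fun (h e he) m
    rw [hspan _ hm, top_le_iff, LinearMap.ker_eq_top] at h1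
    exact hx0 h1
  let c := x * e
  have hc : c ∈ E := E.mul_mem hx he
  have hcW : W.map c = W := by
    have h1 : LinearMap.range (c * x) = W.map c := LinearMap.range_comp x c
    rw [← h1]
    exact hle _ (E.mul_mem hc hx) hxex (by
      rintro _ ⟨v, rfl⟩
      exact ⟨_, rfl⟩)
  have hcn : ∀ n : ℕ, W.map (c ^ n) = W := by
    intro n
    induction n with
    | zero => rw [pow_zero]; exact Submodule.map_id W
    | succ n ih =>
      rw [pow_succ]
      have : W.map (c ^ n * c) = (W.map c).map (c ^ n) := Submodule.map_comp c (c ^ n) W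
      rw [this, hcW, ih]
  obtain ⟨N, hN, hfix⟩ : ∃ N : ℕ, 0 < N ∧ ∀ w ∈ W, (c ^ N) w = w := by
    obtain ⟨i, j, hij, heq⟩ := Finite.exists_ne_map_eq_of_infinite
      fun n : ℕ => (⟨c ^ n, E.pow_mem hc n⟩ : E)
    replace heq : c ^ i = c ^ j := congrArg Subtype.val heq
    wlog hlt : i < j generalizing i j
    · exact this j i hij.symm heq.symm (lt_of_le_of_ne (not_lt.1 hlt) hij.symm)
    refine ⟨j - i, Nat.sub_pos_of_lt hlt, fun w hw => ?_⟩
    obtain ⟨w', hw', rfl⟩ : w ∈ W.map (c ^ i) := (hcn i).symm ▸ hw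
    rw [← Module.End.mul_apply, ← pow_add, Nat.sub_add_cancel hlt.le]
    exact (LinearMap.congr_fun heq w').symm
  let g := c ^ N
  have hg : g ∈ E := E.pow_mem hc N
  have hgW : LinearMap.range g = W := by
    apply le_antisymm
    · rintro _ ⟨v, rfl⟩
      obtain ⟨n, rfl⟩ := Nat.exists_eq_succ_of_ne_zero hN.ne'
      refine ⟨(e * c ^ n) v, ?_⟩
      change _ = (c ^ (n + 1)) v
      rw [pow_succ']
      rfl
    · exact fun w hw => ⟨w, hfix w hw⟩
  have hWbot : W ≠ ⊥ := fun h => hx0 (LinearMap.range_eq_bot.1 h)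
  refine ⟨W, g, hg, hgW, hfix, (Submodule.nontrivial_iff_ne_bot).2 hWbot, fun N hN => ?_⟩
  by_cases hNbot : N = ⊥
  · exact Or.inl hNbot
  right
  obtain ⟨m, hm, hm0⟩ := Submodule.exists_mem_ne_zero_of_ne_bot hNbot
  -- By minimality of rank, `g * y * g` is zero or invertible on `W`, and in the latter case it
  -- belongs to the induced group.
  have key : ∀ y ∈ E, ∀ w ∈ N, ∃ w' ∈ N, (w' : V) = g (y w) := by
    intro y hy w hw
    by_cases h0 : g * y * g = 0
    · refine ⟨0, N.zero_mem, ?_⟩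
      have := LinearMap.congr_fun h0 w.1
      rw [Module.End.mul_apply, Module.End.mul_apply, hfix _ w.2] at this
      exact this.symm
    · have hz := hle (g * y * g) (E.mul_mem (E.mul_mem hg hy) hg) h0 (by
        rw [← hgW]
        rintro _ ⟨v, rfl⟩
        exact ⟨_, rfl⟩)
      have hmem : ∀ w ∈ W, (g * y * g) w ∈ W := fun w _ => hz ▸ ⟨w, rfl⟩
      have hsurj : Function.Surjective ((g * y * g).restrict hmem) := by
        rintro ⟨w, hw⟩
        obtain ⟨v, rfl⟩ : w ∈ LinearMap.range (g * y * g) := hz.symm ▸ hw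
        have hgv : g v ∈ W := hgW ▸ ⟨v, rfl⟩
        refine ⟨⟨g v, hgv⟩, Subtype.ext ?_⟩
        change (g * y * g) (g v) = (g * y * g) v
        rw [Module.End.mul_apply, hfix _ hgv, ← Module.End.mul_apply]
      have hunit : IsUnit ((g * y * g).restrict hmem) := by
        rw [Module.End.isUnit_iff]
        exact ⟨LinearMap.injective_iff_surjective.2 hsurj, hsurj⟩
      refine ⟨_, hN ⟨hunit.unit, g * y * g, E.mul_mem (E.mul_mem hg hy) hg, fun w => rfl⟩ w hw, ?_⟩
      change (g * y * g) w.1 = _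
      rw [Module.End.mul_apply, Module.End.mul_apply, hfix _ w.2]
  rw [eq_top_iff]
  rintro w -
  have h1 : Submodule.span K {v | ∃ e ∈ E, v = e m.1} ≤ (N.map W.subtype).comap g := by
    rw [Submodule.span_le]
    rintro _ ⟨y, hy, rfl⟩
    obtain ⟨w', hw', h⟩ := key y hy m hm
    exact ⟨w', hw', h⟩
  rw [hspan _ fun h => hm0 (Subtype.ext h)] at h1
  obtain ⟨w', hw', h⟩ := h1 (Submodule.mem_top : w.1 ∈ ⊤)
  rw [hfix _ w.2] at h
  rwa [← Subtype.ext h]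

end MonoidAction

end TensorDecomposition

namespace TensorDecomposition

/-! ### Characters of representations linear over a division algebra -/

section TraceExact

variable {K X W Y : Type*} [Field K] [AddCommGroup X] [Module K X] [FiniteDimensional K X]
  [AddCommGroup W] [Module K W] [FiniteDimensional K W]
  [AddCommGroup Y] [Module K Y] [FiniteDimensional K Y]

/-- Splitting the sequence linearly writes the identity as `i ∘ p' + s ∘ q`; cyclicity of the trace
does the rest, without the splitting being equivariant. -/
lemma trace_eq_add_of_exact {i : X →ₗ[K] W} {q : W →ₗ[K] Y} (hi : Function.Injective i)
    (hq : Function.Surjective q) (hiq : LinearMap.ker q = LinearMap.range i)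
    {f : W →ₗ[K] W} {f₁ : X →ₗ[K] X} {f₂ : Y →ₗ[K] Y} (h₁ : f ∘ₗ i = i ∘ₗ f₁)
    (h₂ : q ∘ₗ f = f₂ ∘ₗ q) :
    LinearMap.trace K W f = LinearMap.trace K X f₁ + LinearMap.trace K Y f₂ := by
  obtain ⟨s, hs⟩ := q.exists_rightInverse_of_surjective (LinearMap.range_eq_top.2 hq)
  obtain ⟨p, hp⟩ := i.exists_leftInverse_of_injective (LinearMap.ker_eq_bot.2 hi)
  have hid : i ∘ₗ p ∘ₗ (LinearMap.id - s ∘ₗ q) + s ∘ₗ q = LinearMap.id := by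
    ext w
    have hw : w - s (q w) ∈ LinearMap.range i := by
      rw [← hiq, LinearMap.mem_ker, map_sub, sub_eq_zero]
      exact (LinearMap.congr_fun hs (q w)).symm
    obtain ⟨x, hx⟩ := hw
    have h3 : p (i x) = x := LinearMap.congr_fun hp x
    simp only [LinearMap.add_apply, LinearMap.comp_apply, LinearMap.sub_apply, LinearMap.id_apply]
    rw [← hx, h3, hx, sub_add_cancel]
  set p' := p ∘ₗ (LinearMap.id - s ∘ₗ q) with hp'
  have hqi : q ∘ₗ i = 0 := by
    ext x
    exact LinearMap.mem_ker.1 (hiq.ge ⟨x, rfl⟩)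
  have hpi : p' ∘ₗ i = LinearMap.id := by
    rw [hp', LinearMap.comp_assoc, LinearMap.sub_comp, LinearMap.comp_assoc, hqi,
      LinearMap.comp_zero, sub_zero, LinearMap.id_comp, hp]
  clear_value p'
  calc LinearMap.trace K W f = LinearMap.trace K W (f ∘ₗ (i ∘ₗ p' + s ∘ₗ q)) := by
        rw [hid, LinearMap.comp_id]
    _ = LinearMap.trace K W ((f ∘ₗ i) ∘ₗ p') + LinearMap.trace K W ((f ∘ₗ s) ∘ₗ q) := by
        rw [LinearMap.comp_add, map_add]
        rfl
    _ = _ := by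
        rw [LinearMap.trace_comp_comm' p' (f ∘ₗ i), LinearMap.trace_comp_comm' q (f ∘ₗ s), h₁, ← LinearMap.comp_assoc,
          ← LinearMap.comp_assoc, hpi, h₂, LinearMap.comp_assoc, hs, LinearMap.id_comp,
          LinearMap.comp_id]

end TraceExact

section TensorInjective

variable {K : Type w} [Field K]

/-- A representation as a functor. -/
def repFunctor {Q : Type v} [Group Q] {U : Type w} [AddCommGroup U] [Module K U]
    (τ : Q →* Module.End K U) : SingleObj Q ⥤ ModuleCat.{w} K where
  obj _ := ModuleCat.of K U
  map q := ModuleCat.ofHom (τ q)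
  map_id _ := by
    ext u
    exact LinearMap.congr_fun (map_one τ) u
  map_comp q q' := by
    ext u
    exact LinearMap.congr_fun (map_mul τ q' q) u

lemma isAbsolutelySimple_repFunctor {Q : Type v} [Group Q] {U : Type w} [AddCommGroup U]
    [Module K U] {τ : Q →* Module.End K U} (hτ : IsIrr τ)
    (hsc : ∀ φ : Module.End K U, (∀ g, Commute φ (τ g)) → ∃ c : K, φ = c • 1) :
    IsAbsolutelySimple (repFunctor τ) := by
  have := hτ.nontrivial
  refine ⟨(simple_iff_subfamily _).2 ⟨⟨SingleObj.star Q, this⟩, fun G => ?_⟩, fun a b h => ?_,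
    fun η => ?_⟩
  · rcases hτ.eq_bot_or_eq_top (G.obj (SingleObj.star Q)) fun g w hw =>
      G.map_mem (x := SingleObj.star Q) (y := SingleObj.star Q) g hw with h | h
    · exact Or.inl fun _ => h
    · exact Or.inr fun _ => h
  · obtain ⟨u, hu⟩ := exists_ne (0 : U)
    have h1 : a • u = b • u := congrArg
      (fun η : repFunctor τ ⟶ repFunctor τ => (η.app (SingleObj.star Q)).hom u) h
    exact smul_left_injective K hu h1
  · obtain ⟨c, hc⟩ := hsc (η.app (SingleObj.star Q)).hom fun g => by
      ext u
      exact NatTrans.naturality_apply η (X := SingleObj.star Q) (Y := SingleObj.star Q) g u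
    refine ⟨c, ?_⟩
    ext x u
    exact (LinearMap.congr_fun hc u).symm

end TensorInjective

section DivisionRing

variable {K : Type w} [Field K] {D : Type*} [DivisionRing D] [Algebra K D]
  {Q : Type*} [Group Q]

/-- The underlying `K`-linear representation of a `D`-linear one. -/
def resRep (K : Type*) [Field K] {D : Type*} [DivisionRing D] [Algebra K D] {Q : Type*} [Group Q]
    {W : Type*} [AddCommGroup W] [Module K W] [Module D W] [IsScalarTower K D W]
    (ρ : Q →* Module.End D W) : Representation K Q W where
  toFun u := (ρ u).restrictScalars K
  map_one' := by
    rw [map_one]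
    rfl
  map_mul' u v := by
    rw [map_mul]
    rfl

/-- Since the action on `W` is `D`-linear, intertwining maps into `W` form a vector space over `D`.
-/
lemma finrank_dvd_finrank_intertwiningMap {U : Type*} [AddCommGroup U] [Module K U]
    (τ : Representation K Q U) {W : Type*} [AddCommGroup W] [Module K W] [Module D W]
    [IsScalarTower K D W] (ρ : Q →* Module.End D W) :
    Module.finrank K D ∣ Module.finrank K (Representation.IntertwiningMap τ (resRep K ρ)) := by
  let H : Submodule D (U →ₗ[K] W) :=
    { carrier := {φ | ∀ (u : Q) (x : U), φ (τ u x) = ρ u (φ x)}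
      add_mem' := fun h h' u x => by
        rw [LinearMap.add_apply, LinearMap.add_apply, map_add, h, h']
      zero_mem' := fun u x => by simp
      smul_mem' := fun d φ h u x => by
        rw [LinearMap.smul_apply, LinearMap.smul_apply, map_smul, h] }
  let e : Representation.IntertwiningMap τ (resRep K ρ) ≃ₗ[K] H :=
    { toFun := fun φ => ⟨φ.toLinearMap, fun u x => LinearMap.congr_fun (φ.isIntertwining' u) x⟩
      invFun := fun φ => ⟨φ.1, fun u => LinearMap.ext fun x => φ.2 u x⟩
      map_add' := fun _ _ => rfl
      map_smul' := fun _ _ => rfl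
      left_inv := fun _ => rfl
      right_inv := fun _ => rfl }
  rw [e.finrank_eq, ← Module.finrank_mul_finrank K D H]
  exact Dvd.intro _ rfl

lemma exists_irr_submodule {V : Type*} [AddCommGroup V] [Module K V] [FiniteDimensional K V]
    [Nontrivial V] {G : Type*} [Monoid G] (ρ : G →* Module.End K V) :
    ∃ (U : Submodule K V) (hU : ∀ g, ∀ w ∈ U, ρ g w ∈ U), IsIrr (restrictHom ρ U hU) := by
  classical
  let P : ℕ → Prop := fun n => ∃ U : Submodule K V, (∀ g, ∀ w ∈ U, ρ g w ∈ U) ∧ U ≠ ⊥ ∧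
    Module.finrank K U = n
  have hP : ∃ n, P n := ⟨_, ⊤, fun _ _ _ => trivial, top_ne_bot, rfl⟩
  obtain ⟨U, hU, hU0, hn⟩ := Nat.find_spec hP
  refine ⟨U, hU, (Submodule.nontrivial_iff_ne_bot).2 hU0, fun N hN => ?_⟩
  by_cases hNbot : N = ⊥
  · exact Or.inl hNbot
  right
  have h1 : N.map U.subtype = U := by
    refine Submodule.eq_of_le_of_finrank_le (Submodule.map_subtype_le U N) ?_
    rw [hn]
    refine Nat.find_min' hP ⟨N.map U.subtype, ?_, ?_, rfl⟩
    · rintro g _ ⟨w, hw, rfl⟩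
      exact ⟨_, hN g w hw, rfl⟩
    · rw [Ne, ← LinearMap.le_ker_iff_map, Submodule.ker_subtype, le_bot_iff]
      exact hNbot
  rw [eq_top_iff]
  rintro w -
  obtain ⟨w', hw', h⟩ : (w : V) ∈ N.map U.subtype := h1.symm ▸ w.2
  rwa [← Subtype.ext h]

/-- The map `D ⊗ U → W` for an irreducible subrepresentation `U` of `W`. -/
noncomputable def smulMap (K : Type*) [Field K] (D : Type*) [DivisionRing D] [Algebra K D]
    {W : Type*} [AddCommGroup W] [Module K W] [Module D W] [IsScalarTower K D W]
    (U : Submodule K W) : D ⊗[K] U →ₗ[K] W :=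
  TensorProduct.lift (LinearMap.mk₂ K (fun (d : D) (u : U) => d • (u : W))
    (fun _ _ _ => add_smul _ _ _) (fun _ _ _ => smul_assoc _ _ _)
    (fun _ _ _ => smul_add _ _ _) (fun c d u => by rw [Submodule.coe_smul, smul_comm]))

lemma smulMap_tmul {K D W : Type*} [Field K] [DivisionRing D] [Algebra K D]
    [AddCommGroup W] [Module K W] [Module D W] [IsScalarTower K D W]
    (U : Submodule K W) (d : D) (u : U) :
    smulMap K D U (d ⊗ₜ u) = d • (u : W) := rfl

section

variable {W : Type w} [AddCommGroup W] [Module K W] [Module D W] [IsScalarTower K D W]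

lemma smulMap_natural (ρ : Q →* Module.End D W) {U : Submodule K W}
    (hU : ∀ g, ∀ w ∈ U, resRep K ρ g w ∈ U) (g : Q) (z : D ⊗[K] U) :
    smulMap K D U ((restrictHom (resRep K ρ) U hU g).lTensor D z) = ρ g (smulMap K D U z) := by
  induction z using TensorProduct.induction_on with
  | zero => simp only [map_zero]
  | add a b ha hb => rw [map_add, map_add, map_add, map_add, ha, hb]
  | tmul d u =>
    rw [LinearMap.lTensor_tmul, smulMap_tmul, smulMap_tmul, map_smul]
    rfl

/-- With scalar endomorphisms of `U`, a nonzero kernel would contain a pure tensor `d ⊗ u` with `d`,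
`u` nonzero, but `d • u ≠ 0` in a `D`-vector space. -/
lemma smulMap_injective (ρ : Q →* Module.End D W) {U : Submodule K W}
    (hU : ∀ g, ∀ w ∈ U, resRep K ρ g w ∈ U) (hirr : IsIrr (restrictHom (resRep K ρ) U hU))
    (hsc : ∀ φ : Module.End K U, (∀ g, Commute φ (restrictHom (resRep K ρ) U hU g)) →
      ∃ c : K, φ = c • 1) : Function.Injective (smulMap K D U) := by
  rw [← LinearMap.ker_eq_bot]
  by_contra hne
  obtain ⟨x', d, t, hd, ht, h⟩ := exists_tmul_mem_of_absolutelySimple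
    (isAbsolutelySimple_repFunctor hirr hsc) D (fun _ => LinearMap.ker (smulMap K D U))
    (fun {x y} f z hz => by
      exact LinearMap.mem_ker.2 ((smulMap_natural ρ hU f z).trans
        ((congrArg (ρ f) (LinearMap.mem_ker.1 hz)).trans (map_zero _)))) ⟨SingleObj.star Q, hne⟩
  exact (smul_ne_zero hd fun h => ht (Subtype.ext h)) h

/-- The image of `D ⊗ U` as a subspace over `D`. -/
noncomputable def smulRange (K : Type*) [Field K] (D : Type*) [DivisionRing D] [Algebra K D]
    {W : Type*} [AddCommGroup W] [Module K W] [Module D W] [IsScalarTower K D W]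
    (U : Submodule K W) : Submodule D W where
  carrier := Set.range (smulMap K D U)
  add_mem' := by
    rintro _ _ ⟨a, rfl⟩ ⟨b, rfl⟩
    exact ⟨a + b, map_add _ _ _⟩
  zero_mem' := ⟨0, map_zero _⟩
  smul_mem' := by
    rintro d _ ⟨z, rfl⟩
    refine ⟨(LinearMap.mulLeft K d).rTensor U z, ?_⟩
    induction z using TensorProduct.induction_on with
    | zero => simp only [map_zero, smul_zero]
    | add a b ha hb => rw [map_add, map_add, map_add, smul_add, ha, hb]
    | tmul d' u => rw [LinearMap.rTensor_tmul, smulMap_tmul, smulMap_tmul, LinearMap.mulLeft_apply,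
        mul_smul]

/-- The representation on the quotient by a stable subspace. -/
def quotHom (ρ : Q →* Module.End D W) (X : Submodule D W) (hX : ∀ g, X ≤ X.comap (ρ g)) :
    Q →* Module.End D (W ⧸ X) where
  toFun g := X.mapQ X (ρ g) (hX g)
  map_one' := by
    ext w
    simp
  map_mul' g h := by
    ext w
    simp

end

/-- The scalar product of the characters of two `D`-linear representations of a `p`-group is a
multiple of the square of the dimension of `D`. -/
lemma exists_sum_character_mul_character [FiniteDimensional K D] [CharZero K] {p : ℕ} [Fact p.Prime] [Fintype Q]
    (hK : ContainsAllRootsOfUnity K) (hQ : IsPGroup p Q)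
    {W W' : Type w} [AddCommGroup W] [Module K W] [Module D W] [IsScalarTower K D W]
    [FiniteDimensional K W] [AddCommGroup W'] [Module K W'] [Module D W'] [IsScalarTower K D W']
    [FiniteDimensional K W'] (ρ : Q →* Module.End D W) (ρ' : Q →* Module.End D W') :
    ∃ m : ℕ, ∑ u, (resRep K ρ').character u * (resRep K ρ).character u⁻¹ =
      (Nat.card Q * Module.finrank K D ^ 2 * m : ℕ) := by
  induction hn : Module.finrank K W using Nat.strong_induction_on generalizing W with
  | _ n ih =>
  rcases subsingleton_or_nontrivial W with hW | hW
  · refine ⟨0, ?_⟩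
    have : ∀ u, (resRep K ρ).character u = 0 := fun u => by
      rw [Representation.character, Subsingleton.elim (resRep K ρ u) 0, map_zero]
    simp [this]
  -- The submodule `D ⊗ U` of `W` contributes one factor `dim D` to the character. The scalar
  -- product of `χ_U` with the character of `W'` is `|Q| dim Hom(U, W')`, which contributes the
  -- second. Induction handles the quotient.
  obtain ⟨U, hU, hirr⟩ := exists_irr_submodule (resRep K ρ)
  have hinj := smulMap_injective ρ hU hirr fun φ hφ => exists_smul_of_isPGroup hK hQ hirr hφ
  let X := smulRange K D U
  have hX : ∀ g, X ≤ X.comap (ρ g) := by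
    rintro g _ ⟨z, rfl⟩
    exact ⟨_, smulMap_natural ρ hU g z⟩
  let q : W →ₗ[K] W ⧸ X := X.mkQ.restrictScalars K
  have hq : Function.Surjective q := X.mkQ_surjective
  have hker : LinearMap.ker q = LinearMap.range (smulMap K D U) := by
    ext w
    exact Submodule.Quotient.mk_eq_zero X
  have : FiniteDimensional K (W ⧸ X) := Module.Finite.of_surjective q hq
  have hchar : ∀ u, (resRep K ρ).character u =
      Module.finrank K D * Representation.character (restrictHom (resRep K ρ) U hU) u +
        (resRep K (quotHom ρ X hX)).character u := by
    intro u
    refine (trace_eq_add_of_exact (f₁ := (restrictHom (resRep K ρ) U hU u).lTensor D)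
      (f₂ := resRep K (quotHom ρ X hX) u) hinj hq hker ?_ ?_).trans ?_
    · refine LinearMap.ext fun z => ?_
      exact (smulMap_natural ρ hU u z).symm
    · rfl
    · rw [LinearMap.lTensor, LinearMap.trace_tensorProduct', LinearMap.trace_id]
      rfl
  have hlt : Module.finrank K (W ⧸ X) < n := by
    have h1 := q.finrank_range_add_finrank_ker
    rw [LinearMap.range_eq_top.2 hq, finrank_top, hn, hker] at h1
    have h2 : 0 < Module.finrank K (LinearMap.range (smulMap K D U)) := by
      have := hirr.nontrivial
      rw [LinearMap.finrank_range_of_inj hinj, Module.finrank_tensorProduct]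
      exact Nat.mul_pos Module.finrank_pos Module.finrank_pos
    omega
  obtain ⟨m, hm⟩ := ih _ hlt (quotHom ρ X hX) rfl
  have hcard : (Nat.card Q : K) ≠ 0 := Nat.cast_ne_zero.2 Nat.card_pos.ne'
  have : Invertible (Nat.card Q : K) := invertibleOfNonzero hcard
  have h1 := Representation.card_inv_mul_sum_char_mul_char_eq_finrank
    (restrictHom (resRep K ρ) U hU) (resRep K ρ')
  rw [inv_mul_eq_iff_eq_mul₀ hcard] at h1
  obtain ⟨a, ha⟩ := finrank_dvd_finrank_intertwiningMap (K := K)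
    (restrictHom (resRep K ρ) U hU) ρ'
  refine ⟨a + m, ?_⟩
  calc ∑ u, (resRep K ρ').character u * (resRep K ρ).character u⁻¹ =
      Module.finrank K D * ∑ u, (resRep K ρ').character u *
        Representation.character (restrictHom (resRep K ρ) U hU) u⁻¹ +
      ∑ u, (resRep K ρ').character u * (resRep K (quotHom ρ X hX)).character u⁻¹ := by
        rw [Finset.mul_sum, ← Finset.sum_add_distrib]
        refine Finset.sum_congr rfl fun u _ => ?_
        rw [hchar]
        ring
    _ = _ := by
        rw [h1, hm, ha]
        push_cast
        ring

end DivisionRing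

end TensorDecomposition

namespace TensorDecomposition

/-! ### Character sums over cosets of `p`-subgroups -/

section Eigenspaces

open Polynomial

lemma ker_aeval_prod_le_iSup_eigenspace {K V : Type*} [Field K] [AddCommGroup V] [Module K V]
    (T : Module.End K V) (R : Finset K) :
    LinearMap.ker (aeval T (∏ c ∈ R, (X - C c))) ≤ ⨆ c : R, T.eigenspace c := by
  classical
  induction R using Finset.induction_on with
  | empty =>
    rw [Finset.prod_empty, map_one]
    exact (LinearMap.ker_id).le.trans bot_le
  | insert c R hc ih =>
    rw [Finset.prod_insert hc, ← sup_ker_aeval_eq_ker_aeval_mul_of_coprime]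
    · refine sup_le ?_ (ih.trans ?_)
      · refine le_trans ?_ (le_iSup (fun c : ↥(insert c R) => T.eigenspace c)
          ⟨c, Finset.mem_insert_self c R⟩)
        intro v hv
        rw [Module.End.mem_eigenspace_iff]
        simpa [sub_eq_zero] using hv
      · exact iSup_le fun d => le_iSup (fun c : ↥(insert c R) => T.eigenspace c)
          ⟨d, Finset.mem_insert_of_mem d.2⟩
    · exact IsCoprime.prod_right fun d hd => pairwise_coprime_X_sub_C Function.injective_id
        fun h => hc (h ▸ hd)

lemma exists_finset_prod_eq {K : Type*} [Field K] [CharZero K] (hK : ContainsAllRootsOfUnity K)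
    {n : ℕ} (hn : 0 < n) :
    ∃ R : Finset K, (∀ c ∈ R, c ^ n = 1) ∧ ∏ c ∈ R, (X - C c) = (X ^ n - 1 : K[X]) := by
  classical
  have hsep : (X ^ n - 1 : K[X]).Separable :=
    X_pow_sub_one_separable_iff.2 (Nat.cast_ne_zero.2 hn.ne')
  refine ⟨(X ^ n - 1 : K[X]).roots.toFinset, fun c hc => ?_, ?_⟩
  · have := (mem_roots'.1 (Multiset.mem_toFinset.1 hc)).2
    simpa [sub_eq_zero] using this
  · rw [Finset.prod, Multiset.toFinset_val, Multiset.dedup_eq_self.2 (nodup_roots hsep)]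
    exact ((hK n hn).eq_prod_roots_of_monic (monic_X_pow_sub_C 1 hn.ne')).symm

variable {K : Type w} [Field K] {D : Type*} [DivisionRing D] [Algebra K D]
  {V : Type w} [AddCommGroup V] [Module K V] [Module D V] [IsScalarTower K D V]
  [FiniteDimensional K V] {G : Type*} [Group G]

/-- The eigenspaces of a `D`-linear endomorphism for eigenvalues in `K`. -/
def eigenspaceOver (T : Module.End D V) (c : K) : Submodule D V where
  carrier := {v | T v = c • v}
  add_mem' {v w} hv hw := by
    have hv : T v = c • v := hv
    have hw : T w = c • w := hw
    exact (map_add T v w).trans (by rw [hv, hw, smul_add])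
  zero_mem' := (map_zero T).trans (smul_zero c).symm
  smul_mem' d v hv := by
    have hv : T v = c • v := hv
    exact (map_smul T d v).trans (by rw [hv, smul_comm])

instance (T : Module.End D V) (c : K) : FiniteDimensional K (eigenspaceOver T c) :=
  FiniteDimensional.of_injective ((eigenspaceOver T c).subtype.restrictScalars K)
    Subtype.val_injective

/-- The action on the eigenspaces of the elements of the centralizer. -/
def eigenRep (ρ : G →* Module.End D V) (s : G) (Q : Subgroup G) (hQ : ∀ u ∈ Q, Commute u s)
    (c : K) : Q →* Module.End D (eigenspaceOver (ρ s) c) where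
  toFun u := (ρ u).restrict fun v hv => by
    have hv : ρ s v = c • v := hv
    change ρ s (ρ u v) = c • ρ u v
    rw [← Module.End.mul_apply, ← map_mul, ← (hQ u u.2).eq, map_mul, Module.End.mul_apply, hv]
    exact LinearMap.map_smul_of_tower _ c v
  map_one' := by
    ext v
    simp
  map_mul' u u' := by
    ext v
    simp

/-- The polynomial `X ^ n - 1` is a product of distinct linear factors, so `V` is the sum of the
eigenspaces of `s`. They are stable under `Q`, and `x` acts on each by a scalar. The lemma is
applied with `x = s` and with `x = s⁻¹`. -/
lemma character_mul_eq_sum (ρ : G →* Module.End D V) (s : G) (Q : Subgroup G)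
    (hQ : ∀ u ∈ Q, Commute u s) {n : ℕ} (hs : s ^ n = 1) {R : Finset K}
    (hR : ∏ c ∈ R, (X - C c) = (X ^ n - 1 : K[X])) (x : G) (a : K → K)
    (ha : ∀ (c : K) (v : V), ρ s v = c • v → ρ x v = a c • v) (u : Q) :
    (resRep K ρ).character (x * u) =
      ∑ c ∈ R, a c * (resRep K (eigenRep ρ s Q hQ c)).character u := by
  classical
  let N : R → Submodule K V := fun c => (eigenspaceOver (ρ s) (c : K)).restrictScalars K
  have hN : ∀ c : R, N c = Module.End.eigenspace (resRep K ρ s) c := fun c => by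
    ext v
    rw [Module.End.mem_eigenspace_iff]
    rfl
  have hint : DirectSum.IsInternal N := by
    refine DirectSum.isInternal_submodule_of_iSupIndep_of_iSup_eq_top ?_ ?_
    · rw [funext hN]
      exact (Module.End.eigenspaces_iSupIndep (resRep K ρ s)).comp Subtype.val_injective
    · rw [funext hN, eq_top_iff]
      refine le_trans ?_ (ker_aeval_prod_le_iSup_eigenspace (resRep K ρ s) R)
      rw [hR, map_sub, map_pow, aeval_X, map_one, ← map_pow, hs, map_one, sub_self]
      exact LinearMap.ker_zero.ge
  have hmem : ∀ c : R, ∀ v ∈ N c, ρ (x * u) v = a c • ρ u v ∧ ρ u v ∈ N c := by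
    intro c v hv
    have h1 := (eigenRep ρ s Q hQ (c : K) u ⟨v, hv⟩).2
    refine ⟨?_, h1⟩
    rw [map_mul, Module.End.mul_apply]
    exact ha c _ h1
  have hmaps : ∀ c : R, Set.MapsTo (resRep K ρ (x * u)) (N c) (N c) := by
    intro c v hv
    obtain ⟨h1, h2⟩ := hmem c v hv
    have h3 : resRep K ρ (x * u) v = a c • ρ u v := h1
    rw [h3]
    exact (N c).smul_mem _ h2
  rw [Representation.character, LinearMap.trace_eq_sum_trace_restrict hint hmaps,
    ← Finset.sum_coe_sort R]
  refine Finset.sum_congr rfl fun c _ => ?_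
  have h4 : (resRep K ρ (x * u)).restrict (hmaps c) =
      a c • (resRep K (eigenRep ρ s Q hQ (c : K)) u : N c →ₗ[K] N c) := by
    ext v
    exact (hmem c v.1 v.2).1
  exact (congrArg (LinearMap.trace K (N c)) h4).trans ((LinearMap.trace K (N c)).map_smul _ _)

/-- The characters of a finite group have integral values. -/
lemma isIntegral_character [CharZero K] (hK : ContainsAllRootsOfUnity K) [Finite G] (ρ : G →* Module.End D V)
    (g : G) : IsIntegral ℤ ((resRep K ρ).character g) := by
  obtain ⟨R, hR1, hR⟩ := exists_finset_prod_eq hK (orderOf_pos g)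
  have h := character_mul_eq_sum ρ g ⊥ (fun u hu => by
    rw [Subgroup.mem_bot.1 hu]
    exact Commute.one_left g) (pow_orderOf_eq_one g) hR g id (fun c v h => h) 1
  rw [OneMemClass.coe_one, mul_one] at h
  rw [h]
  refine IsIntegral.sum _ fun c hc => ?_
  refine IsIntegral.mul ?_ ?_
  · exact IsIntegral.of_pow (orderOf_pos g) (by rw [id, hR1 c hc]; exact isIntegral_one)
  · rw [Representation.char_one]
    exact isIntegral_natCast _

/-- The average of `χ(g) χ(g⁻¹)` over a coset `s Q`, for a `p`-group `Q` centralizing `s`. -/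
lemma exists_sum_character_coset [CharZero K] [FiniteDimensional K D]
    (hK : ContainsAllRootsOfUnity K)
    {p : ℕ} [Fact p.Prime] [Finite G] (ρ : G →* Module.End D V) (s : G) (Q : Subgroup G)
    [Fintype Q] (hp : IsPGroup p Q) (hQ : ∀ u ∈ Q, Commute u s) :
    ∃ α : K, IsIntegral ℤ α ∧
      ∑ u : Q, (resRep K ρ).character (s * u) * (resRep K ρ).character (s * u)⁻¹ =
        Nat.card Q * (Module.finrank K D ^ 2 * α) := by
  obtain ⟨R, hR1, hR⟩ := exists_finset_prod_eq hK (orderOf_pos s)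
  have hR0 : ∀ c ∈ R, c ≠ 0 := fun c hc h => by
    have := hR1 c hc
    rw [h, zero_pow (orderOf_pos s).ne'] at this
    exact zero_ne_one this
  have h1 := character_mul_eq_sum ρ s Q hQ (pow_orderOf_eq_one s) hR s id
    fun c v h => h
  have h2 := character_mul_eq_sum ρ s Q hQ (pow_orderOf_eq_one s) hR s⁻¹
    (fun c => c⁻¹) fun c v h => by
      have h3 : ρ s⁻¹ (ρ s v) = v := by
        rw [← Module.End.mul_apply, ← map_mul, inv_mul_cancel, map_one]
        rfl
      by_cases hc : c = 0
      · rw [hc, zero_smul] at h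
        rw [h, map_zero] at h3
        rw [← h3, map_zero, smul_zero]
      · rw [h, LinearMap.map_smul_of_tower] at h3
        conv_rhs => rw [← h3]
        rw [smul_smul, inv_mul_cancel₀ hc, one_smul]
  have h3 : ∀ u : Q, (s * u)⁻¹ = s⁻¹ * ((u⁻¹ : Q) : G) := fun u => by
    rw [mul_inv_rev, Subgroup.coe_inv]
    exact ((hQ u u.2).inv_inv).eq
  choose m hm using fun c d : K => exists_sum_character_mul_character (K := K) hK hp
    (eigenRep ρ s Q hQ d) (eigenRep ρ s Q hQ c)
  -- The eigenspaces for `c` and `d` contribute `c * d⁻¹`, a root of unity, times the scalar product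
  -- of two `D`-linear characters of `Q`.
  refine ⟨∑ c ∈ R, ∑ d ∈ R, c * d⁻¹ * m c d, ?_, ?_⟩
  · refine IsIntegral.sum _ fun c hc => IsIntegral.sum _ fun d hd => ?_
    refine IsIntegral.mul (IsIntegral.of_pow (orderOf_pos s) ?_) (isIntegral_natCast _)
    rw [mul_pow, inv_pow, hR1 c hc, hR1 d hd, inv_one, mul_one]
    exact isIntegral_one
  · calc _ = ∑ u : Q, ∑ c ∈ R, ∑ d ∈ R, c * d⁻¹ *
        ((resRep K (eigenRep ρ s Q hQ c)).character u *
          (resRep K (eigenRep ρ s Q hQ d)).character u⁻¹) := by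
          refine Finset.sum_congr rfl fun u _ => ?_
          rw [h1, h3, h2, Finset.sum_mul_sum]
          refine Finset.sum_congr rfl fun c _ => Finset.sum_congr rfl fun d _ => ?_
          rw [id]
          ring
      _ = ∑ c ∈ R, ∑ d ∈ R, c * d⁻¹ * ∑ u : Q,
        ((resRep K (eigenRep ρ s Q hQ c)).character u *
          (resRep K (eigenRep ρ s Q hQ d)).character u⁻¹) := by
          rw [Finset.sum_comm]
          refine Finset.sum_congr rfl fun c _ => ?_
          rw [Finset.sum_comm]
          exact Finset.sum_congr rfl fun d _ => (Finset.mul_sum _ _ _).symm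
      _ = _ := by
          simp_rw [hm, Finset.mul_sum]
          refine Finset.sum_congr rfl fun c _ => Finset.sum_congr rfl fun d _ => ?_
          push_cast
          ring

end Eigenspaces

end TensorDecomposition

namespace TensorDecomposition

/-! ### A congruence for sums of class functions -/

section Counting

variable {K : Type*} [Field K] {G : Type*} [Group G] [Fintype G]

omit [Fintype G] in
-- An orbit contributes its length times the order of a stabilizer, that is `|G|`, times `c * α`.
lemma exists_sum_of_stabilizer {X : Type*} [Fintype X] [MulAction G X] {F : X → K}
    (hF : ∀ (g : G) x, F (g • x) = F x) (c : K)
    (h : ∀ x, ∃ α : K, IsIntegral ℤ α ∧ F x = Nat.card (MulAction.stabilizer G x) * (c * α)) :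
    ∃ α : K, IsIntegral ℤ α ∧ ∑ x, F x = Nat.card G * (c * α) := by
  classical
  choose α hα hFα using h
  refine ⟨∑ ω : MulAction.orbitRel.Quotient G X, α ω.out, IsIntegral.sum _ fun _ _ => hα _, ?_⟩
  rw [← Finset.sum_fiberwise Finset.univ (fun x => (Quotient.mk'' x : MulAction.orbitRel.Quotient G X)),
    Finset.mul_sum, Finset.mul_sum]
  refine Finset.sum_congr rfl fun ω _ => ?_
  have hmem : ∀ x, x ∈ Finset.univ.filter (fun x => (Quotient.mk'' x :
      MulAction.orbitRel.Quotient G X) = ω) ↔ x ∈ MulAction.orbit G ω.out := by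
    intro x
    rw [Finset.mem_filter, ← MulAction.orbitRel_apply, ← Quotient.eq'', Quotient.out_eq']
    simp
  have h1 : ∀ x ∈ Finset.univ.filter (fun x => (Quotient.mk'' x :
      MulAction.orbitRel.Quotient G X) = ω), F x = F ω.out := by
    intro x hx
    obtain ⟨g, rfl⟩ := (hmem x).1 hx
    exact hF g _
  rw [Finset.sum_congr rfl h1, Finset.sum_const, nsmul_eq_mul, hFα]
  have h2 : (Finset.univ.filter (fun x => (Quotient.mk'' x :
      MulAction.orbitRel.Quotient G X) = ω)).card = Nat.card (MulAction.orbit G ω.out) := by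
    rw [Nat.card_coe_set_eq, ← Set.ncard_coe_finset]
    congr 1
    ext x
    exact hmem x
  have h3 : Nat.card (MulAction.orbit G ω.out) * Nat.card (MulAction.stabilizer G ω.out) =
      Nat.card G := by
    rw [Nat.card_congr (MulAction.orbitEquivQuotientStabilizer G ω.out), mul_comm]
    exact Subgroup.card_mul_index _
  rw [h2, ← h3, Nat.cast_mul, mul_assoc]

/-- The elements of a group whose order divides `n`. -/
def RootSet (G : Type*) [Group G] (n : ℕ) : Type _ := {s : G // s ^ n = 1}

instance (n : ℕ) : MulAction G (RootSet G n) where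
  smul g s := ⟨g * s.1 * g⁻¹, by rw [conj_pow, s.2, mul_one, mul_inv_cancel]⟩
  one_smul s := Subtype.ext (by
    change 1 * s.1 * 1⁻¹ = s.1
    simp)
  mul_smul g h s := Subtype.ext (by
    change g * h * s.1 * (g * h)⁻¹ = g * (h * s.1 * h⁻¹) * g⁻¹
    group)

noncomputable instance (n : ℕ) : Fintype (RootSet G n) :=
  Fintype.ofFinite {s : G // s ^ n = 1}

omit [Fintype G] in
lemma RootSet.smul_val {n : ℕ} (g : G) (s : RootSet G n) : (g • s).1 = g * s.1 * g⁻¹ := rfl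

lemma RootSet.sum_eq [DecidableEq G] (n : ℕ) (f : G → K) :
    (∑ s : G, if s ^ n = 1 then f s else 0) = ∑ s : RootSet G n, f s.1 := by
  rw [← Finset.sum_filter]
  exact Finset.sum_subtype (p := fun s : G => s ^ n = 1) (F := Fintype.ofFinite _) _
    (fun s => by simp) _

/-- The decomposition of the elements of a group as products of commuting elements of coprime
orders. -/
lemma sum_eq_sum_commuting [DecidableEq G] {m n : ℕ} (hmn : m.Coprime n)
    (hG : Nat.card G = m * n) (f : G → K) :
    ∑ g, f g = ∑ s : G, if s ^ n = 1 then
      ∑ u : G, (if u * s * u⁻¹ = s then (if u ^ m = 1 then f (s * u) else 0) else 0) else 0 := by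
  -- With `a ≡ 1` modulo `n` and `0` modulo `m`, and `b` the reverse, `g ^ a` and `g ^ b` are the
  -- components of `g` of order dividing `n` and `m`.
  obtain ⟨a, ha, ha'⟩ := Nat.chineseRemainder hmn.symm 1 0
  obtain ⟨b, hb, hb'⟩ := Nat.chineseRemainder hmn.symm 0 1
  have hab : a + b ≡ 1 [MOD Nat.card G] := by
    rw [hG, mul_comm, ← Nat.modEq_and_modEq_iff_modEq_mul hmn.symm]
    exact ⟨ha.add hb, ha'.add hb'⟩
  have hpow : ∀ {g : G} {i j k : ℕ}, g ^ k = 1 → i ≡ j [MOD k] → g ^ i = g ^ j := by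
    intro g i j k hg hij
    exact pow_eq_pow_iff_modEq.2 (hij.of_dvd (orderOf_dvd_of_pow_eq_one hg))
  have hsum : ∀ g : G, g ^ a * g ^ b = g := fun g => by
    rw [← pow_add, hpow (pow_card_eq_one' (x := g)) hab, pow_one]
  have hrhs : (∑ s : G, if s ^ n = 1 then
      ∑ u : G, (if u * s * u⁻¹ = s then (if u ^ m = 1 then f (s * u) else 0) else 0) else 0) =
      ∑ x ∈ (Finset.univ : Finset (G × G)).filter
        (fun x => x.1 ^ n = 1 ∧ x.2 * x.1 * x.2⁻¹ = x.1 ∧ x.2 ^ m = 1), f (x.1 * x.2) := by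
    rw [Finset.sum_filter, ← Finset.univ_product_univ, Finset.sum_product]
    refine Finset.sum_congr rfl fun s _ => ?_
    by_cases hs : s ^ n = 1
    · rw [if_pos hs]
      refine Finset.sum_congr rfl fun u _ => ?_
      by_cases h1 : u * s * u⁻¹ = s <;> by_cases h2 : u ^ m = 1 <;> simp [hs, h1, h2]
    · simp [hs]
  rw [hrhs]
  have hcard : ∀ g : G, g ^ (m * n) = 1 := fun g => by rw [← hG]; exact pow_card_eq_one'
  refine Finset.sum_nbij' (fun g => (g ^ a, g ^ b)) (fun x => x.1 * x.2) ?_ ?_ ?_ ?_ ?_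
  · intro g _
    rw [Finset.mem_filter]
    refine ⟨Finset.mem_univ _, ?_, ?_, ?_⟩
    · obtain ⟨t, rfl⟩ := (Nat.modEq_zero_iff_dvd).1 ha'
      dsimp only
      rw [← pow_mul, mul_right_comm, pow_mul, hcard, one_pow]
    · exact mul_inv_eq_of_eq_mul (Commute.pow_pow_self g b a).eq
    · obtain ⟨t, rfl⟩ := (Nat.modEq_zero_iff_dvd).1 hb
      dsimp only
      rw [← pow_mul, mul_right_comm, mul_comm n m, pow_mul, hcard, one_pow]
  · intro _ _
    exact Finset.mem_univ _
  · intro g _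
    exact hsum g
  · rintro ⟨s, u⟩ hx
    rw [Finset.mem_filter] at hx
    obtain ⟨-, hs, hsu, hu⟩ := hx
    have hc : Commute s u := (mul_inv_eq_iff_eq_mul.1 hsu).symm
    refine Prod.ext ?_ ?_
    · change (s * u) ^ a = s
      rw [hc.mul_pow, hpow hs ha, hpow hu ha', pow_one, pow_zero, mul_one]
    · change (s * u) ^ b = u
      rw [hc.mul_pow, hpow hs hb, hpow hu hb', pow_one, pow_zero, one_mul]
  · intro g _
    rw [hsum]

omit [Fintype G] in
lemma pow_card_eq_one_of_smul_eq (P : Subgroup G) {u : G} {y : G ⧸ P} (h : u • y = y) :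
    u ^ Nat.card P = 1 := by
  induction y using QuotientGroup.induction_on with
  | H g =>
    have h1 : g⁻¹ * (u * g) ∈ P := QuotientGroup.eq.1 h.symm
    have h2 : (⟨_, h1⟩ : P) ^ Nat.card P = 1 := pow_card_eq_one'
    have h3 : (g⁻¹ * (u * g)) ^ Nat.card P = 1 := congrArg Subtype.val h2
    have h4 : g⁻¹ * (u * g) = g⁻¹ * u * g⁻¹⁻¹ := by group
    rw [h4, conj_pow, mul_inv_eq_one] at h3
    exact mul_eq_left.1 h3

/-- The number of fixed points of an element on the cosets of a Sylow subgroup. -/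
lemma exists_fixed_pow {p : ℕ} [Fact p.Prime] (P : Sylow p G) [DecidableEq G]
    [Fintype (G ⧸ (P : Subgroup G))] [DecidableEq (G ⧸ (P : Subgroup G))] (j : ℕ) (u : G) :
    ∃ b : ℤ, ((∑ y : G ⧸ (P : Subgroup G), if u • y = y then (1 : ℤ) else 0)) ^ (p ^ j).totient =
      (if u ^ Nat.card P = 1 then 1 else 0) + p ^ j * b := by
  have hpp : p.Prime := Fact.out
  by_cases hu : u ^ Nat.card P = 1
  · have hQ : IsPGroup p (Subgroup.zpowers u) := by
      obtain ⟨k, hk⟩ := IsPGroup.iff_card.1 P.isPGroup'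
      rintro ⟨_, i, rfl⟩
      refine ⟨k, Subtype.ext ?_⟩
      change (u ^ i) ^ p ^ k = 1
      rw [← hk, ← zpow_natCast, zpow_comm, zpow_natCast]
      exact (congrArg (· ^ i) hu).trans (one_zpow i)
    -- The number of fixed points of a `p`-element is congruent modulo `p` to the index of `P`, so
    -- it is prime to `p`, and Euler's theorem makes its `φ(p ^ j)`-th power congruent to `1`. Other
    -- elements have no fixed points.
    have h1 := hQ.card_modEq_card_fixedPoints (G ⧸ (P : Subgroup G))
    have h2 : Nat.card (MulAction.fixedPoints (Subgroup.zpowers u) (G ⧸ (P : Subgroup G))) =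
        (Finset.univ.filter fun y : G ⧸ (P : Subgroup G) => u • y = y).card := by
      rw [Nat.card_coe_set_eq, ← Set.ncard_coe_finset]
      congr 1
      ext y
      rw [Finset.mem_coe, Finset.mem_filter, MulAction.mem_fixedPoints]
      refine ⟨fun h => ⟨Finset.mem_univ _, h ⟨u, Subgroup.mem_zpowers u⟩⟩, fun h g => ?_⟩
      have h3 : Subgroup.zpowers u ≤ MulAction.stabilizer G y :=
        Subgroup.zpowers_le.2 h.2
      exact h3 g.2
    have h3 : ¬ p ∣ (Finset.univ.filter fun y : G ⧸ (P : Subgroup G) => u • y = y).card := by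
      rw [← h2, ← h1.dvd_iff dvd_rfl]
      exact Sylow.not_dvd_index P
    have h4 := Nat.ModEq.pow_totient
      (((Nat.Prime.coprime_iff_not_dvd hpp).2 h3).symm.pow_right j)
    rw [if_pos hu]
    obtain ⟨b, hb⟩ := (Int.natCast_modEq_iff.2 h4).symm.dvd
    refine ⟨b, ?_⟩
    rw [Finset.sum_boole]
    push_cast at hb ⊢
    linarith
  · refine ⟨0, ?_⟩
    rw [if_neg hu, Finset.sum_eq_zero, zero_pow (Nat.totient_pos.2 (pow_pos hpp.pos j)).ne']
    · simp
    · intro y _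
      exact if_neg fun h => hu (pow_card_eq_one_of_smul_eq _ h)

/-- A congruence for the sum of a class function from its sums over cosets of `p`-subgroups. -/
lemma exists_sum_eq_add {p : ℕ} [Fact p.Prime] (f : G → K) (hf : ∀ g x, f (g * x * g⁻¹) = f x)
    (hint : ∀ g, IsIntegral ℤ (f g)) (c : K)
    (h : ∀ (s : G) (Q : Subgroup G) [Fintype Q], IsPGroup p Q → (∀ u ∈ Q, Commute u s) →
      ∃ α : K, IsIntegral ℤ α ∧ ∑ u : Q, f (s * u) = Nat.card Q * (c * α)) (j : ℕ) :
    ∃ α β : K, IsIntegral ℤ α ∧ IsIntegral ℤ β ∧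
      ∑ g, f g = Nat.card G * (c * α) + p ^ j * β := by
  classical
  have hpp : p.Prime := Fact.out
  obtain ⟨P⟩ : Nonempty (Sylow p G) := inferInstance
  obtain ⟨k, hk⟩ := IsPGroup.iff_card.1 P.isPGroup'
  have hE : 0 < (p ^ j).totient := Nat.totient_pos.2 (pow_pos hpp.pos j)
  have hmn : (Nat.card P).Coprime (P : Subgroup G).index := by
    rw [hk]
    exact ((Nat.Prime.coprime_iff_not_dvd hpp).2 P.not_dvd_index).pow_left k
  have hcard : Nat.card G = Nat.card P * (P : Subgroup G).index :=
    (Subgroup.card_mul_index _).symm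
  generalize hn : (P : Subgroup G).index = n at hmn hcard
  -- Sum `f(s u)` over pairs of `x = (s, ω)` in `X` and `u` fixing `x`. The number of `ω` fixed by
  -- `u` is congruent modulo `p ^ j` to the indicator of `p`-elements, so by the `p`-decomposition
  -- the total is `∑ f` up to `p ^ j β`. Summed over `u` first, it involves only stabilizers. These
  -- are `p`-groups because there is at least one coordinate in `G ⧸ P`, and they centralize `s`.
  let X := RootSet G n × (Fin (p ^ j).totient → G ⧸ (P : Subgroup G))
  let F : X → K := fun x => ∑ u : G, if u • x = x then f (x.1.1 * u) else 0
  obtain ⟨α, hα, hFα⟩ := exists_sum_of_stabilizer (G := G) (F := F) (fun g x => by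
    refine Fintype.sum_equiv (MulAut.conj g⁻¹).toEquiv _ _ fun u => ?_
    have h1 : u • g • x = g • x ↔ (g⁻¹ * u * g) • x = x := by
      rw [← smul_left_cancel_iff g⁻¹, inv_smul_smul, smul_smul, smul_smul]
    have h2 : f ((g • x).1.1 * u) = f (x.1.1 * (g⁻¹ * u * g)) := by
      rw [← hf g (x.1.1 * (g⁻¹ * u * g)), Prod.smul_fst, RootSet.smul_val]
      congr 1
      group
    simp only [MulEquiv.toEquiv_eq_coe, EquivLike.coe_coe, MulAut.conj_apply, inv_inv, h1, h2])
    c (fun x => by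
      have hQp : IsPGroup p (MulAction.stabilizer G x) := by
        rintro ⟨u, hu⟩
        refine ⟨k, Subtype.ext ?_⟩
        change u ^ p ^ k = 1
        rw [← hk]
        exact pow_card_eq_one_of_smul_eq (P : Subgroup G)
          (congrFun (congrArg Prod.snd (MulAction.mem_stabilizer_iff.1 hu)) ⟨0, hE⟩)
      obtain ⟨α, hα, h1⟩ := h x.1.1 (MulAction.stabilizer G x) hQp (fun u hu => by
        have h2 : u * x.1.1 * u⁻¹ = x.1.1 :=
          congrArg (fun y : X => y.1.1) (MulAction.mem_stabilizer_iff.1 hu)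
        exact mul_inv_eq_iff_eq_mul.1 h2)
      refine ⟨α, hα, Eq.trans ?_ h1⟩
      refine (Finset.sum_filter (fun u : G => u • x = x) (fun u => f (x.1.1 * u))).symm.trans ?_
      refine Finset.sum_subtype _ (fun u => ?_) (fun u => f (x.1.1 * u))
      rw [Finset.mem_filter, MulAction.mem_stabilizer_iff]
      simp)
  choose b hb using exists_fixed_pow P j
  have hω : ∀ u : G, (∑ ω : Fin (p ^ j).totient → G ⧸ (P : Subgroup G),
      if u • ω = ω then (1 : K) else 0) =
        (if u ^ Nat.card P = 1 then 1 else 0) + p ^ j * (b u : K) := by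
    intro u
    have h1 := congrArg (Int.cast : ℤ → K) (hb u)
    push_cast at h1
    rw [← h1, Fintype.sum_pow]
    refine Finset.sum_congr rfl fun ω _ => ?_
    rw [Finset.prod_ite_zero]
    simp [funext_iff]
  let β : K := ∑ s : RootSet G n, ∑ u : G, if u • s = s then f (s.1 * u) * (b u : K) else 0
  have hβ : IsIntegral ℤ β := IsIntegral.sum _ fun s _ => IsIntegral.sum _ fun u _ => by
    split_ifs
    · exact (hint _).mul (isIntegral_algebraMap (R := ℤ) (x := b u))
    · exact isIntegral_zero
  refine ⟨α, -β, hα, hβ.neg, ?_⟩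
  rw [← hFα, sum_eq_sum_commuting hmn hcard f, mul_neg, ← sub_eq_add_neg, eq_sub_iff_add_eq]
  have h1 : (∑ s : G, if s ^ n = 1 then ∑ u : G, (if u * s * u⁻¹ = s then
      (if u ^ Nat.card P = 1 then f (s * u) else 0) else 0) else 0) =
      ∑ s : RootSet G n, ∑ u : G, if u • s = s then
        f (s.1 * u) * (if u ^ Nat.card P = 1 then 1 else 0) else 0 := by
    rw [RootSet.sum_eq]
    refine Finset.sum_congr rfl fun s _ => Finset.sum_congr rfl fun u _ => ?_
    have h2 : u • s = s ↔ u * s.1 * u⁻¹ = s.1 := Subtype.ext_iff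
    simp only [mul_ite, mul_one, mul_zero]
    exact (if_congr h2 rfl rfl).symm
  rw [h1, Finset.mul_sum, ← Finset.sum_add_distrib, Fintype.sum_prod_type]
  refine Finset.sum_congr rfl fun s _ => ?_
  rw [Finset.sum_comm, Finset.mul_sum, ← Finset.sum_add_distrib]
  refine Finset.sum_congr rfl fun u _ => ?_
  have h3 : ∀ ω : Fin (p ^ j).totient → G ⧸ (P : Subgroup G),
      (if u • ((s, ω) : X) = (s, ω) then f (s.1 * u) else 0) =
      (if u • s = s then f (s.1 * u) else 0) * (if u • ω = ω then 1 else 0) := by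
    intro ω
    by_cases h5 : u • s = s <;> by_cases h6 : u • ω = ω <;> simp [h5, h6]
  rw [Finset.sum_congr rfl fun ω _ => h3 ω, ← Finset.mul_sum, hω]
  split_ifs <;> ring

end Counting

end TensorDecomposition

namespace TensorDecomposition

/-! ### The Schur index in characteristic zero -/

section Schur

variable {K : Type w} [Field K] [CharZero K]

/-- The element `α` is the rational number `b / a`, and an integral rational number is an integer.
-/
lemma exists_int_of_isIntegral {α : K} (hα : IsIntegral ℤ α) {a b : ℤ} (ha : a ≠ 0)
    (h : (a : K) * α = b) : a ∣ b := by
  have h1 : α = algebraMap ℚ K (b / a) := by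
    have : (a : K) ≠ 0 := Int.cast_ne_zero.2 ha
    rw [map_div₀, map_intCast, map_intCast, eq_div_iff this, mul_comm, h]
  rw [h1, isIntegral_algebraMap_iff (algebraMap ℚ K).injective] at hα
  obtain ⟨z, hz⟩ := IsIntegrallyClosed.isIntegral_iff.1 hα
  refine ⟨z, ?_⟩
  have : (a : ℚ) ≠ 0 := Int.cast_ne_zero.2 ha
  rw [eq_div_iff this] at hz
  have h2 : ((z * a : ℤ) : ℚ) = (b : ℤ) := by
    rw [Int.cast_mul]
    exact hz
  rw [mul_comm]
  exact (Int.cast_injective h2).symm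

variable {D : Type*} [DivisionRing D] [Algebra K D] [FiniteDimensional K D]
  {V : Type w} [AddCommGroup V] [Module K V] [Module D V] [IsScalarTower K D V]
  [FiniteDimensional K V] {G : Type*} [Group G] [Finite G]

/-- The Schur index of a finite group is one over a field with enough roots of unity. -/
lemma finrank_eq_one_of_intertwiningMap (hK : ContainsAllRootsOfUnity K)
    (ρ : G →* Module.End D V)
    (h : Module.finrank K (Representation.IntertwiningMap (resRep K ρ) (resRep K ρ)) =
      Module.finrank K D) : Module.finrank K D = 1 := by
  classical
  have := Fintype.ofFinite G
  set δ := Module.finrank K D with hδ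
  have hδ0 : δ ≠ 0 := (Module.finrank_pos (R := K) (M := D)).ne'
  have hG0 : (Nat.card G : K) ≠ 0 := Nat.cast_ne_zero.2 Nat.card_pos.ne'
  let χ := (resRep K ρ).character
  have hsum : ∑ g, χ g * χ g⁻¹ = Nat.card G * δ := by
    have := invertibleOfNonzero hG0
    have h1 := Representation.card_inv_mul_sum_char_mul_char_eq_finrank (resRep K ρ) (resRep K ρ)
    rw [h, inv_mul_eq_iff_eq_mul₀ hG0] at h1
    exact h1
  by_contra hne
  obtain ⟨p, hp, hpd⟩ := Nat.exists_prime_and_dvd hne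
  have := Fact.mk hp
  obtain ⟨a, δ', hpδ, hδ'⟩ := Nat.exists_eq_pow_mul_and_not_dvd hδ0 p hp.ne_one
  obtain ⟨k, n, hpn, hn⟩ := Nat.exists_eq_pow_mul_and_not_dvd (Nat.card_pos (α := G)).ne' p hp.ne_one
  have hp0 : (p : K) ≠ 0 := Nat.cast_ne_zero.2 hp.ne_zero
  have ha : 0 < a := by
    rcases Nat.eq_zero_or_pos a with rfl | ha
    · rw [hδ', pow_zero, one_mul] at hpd
      exact absurd hpd hpδ
    · exact ha
  obtain ⟨α, β, hα, hβ, hαβ⟩ := exists_sum_eq_add (p := p) (fun g => χ g * χ g⁻¹) (fun g x => by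
      have h1 : (g * x * g⁻¹)⁻¹ = g * x⁻¹ * g⁻¹ := by group
      simp only [χ, h1, Representation.char_conj])
    (fun g => (isIntegral_character hK ρ g).mul (isIntegral_character hK ρ g⁻¹))
    ((δ : K) ^ 2)
    (fun s Q _ hQp hQ => exists_sum_character_coset hK ρ s Q hQp hQ) (k + 2 * a)
  -- With `|G| = p ^ k n` and `δ = p ^ a δ'`, the relation `|G| δ = |G| δ ^ 2 α + p ^ (k + 2 a) β`
  -- is divided by `p ^ (k + a)`. The exponent `k + 2 a` was chosen to leave `p ^ a` on the right,
  -- so `p` would divide `n δ'`.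
  have h2 : ((p ^ a : ℤ) : K) * (n * δ' ^ 2 * α + β) = ((n * δ' : ℤ) : K) := by
    have h3 := hsum.symm.trans hαβ
    rw [hδ', hn] at h3
    push_cast at h3 ⊢
    have h4 : (p : K) ^ (k + a) ≠ 0 := pow_ne_zero _ hp0
    refine mul_left_cancel₀ h4 ?_
    linear_combination (exp := 1) -h3
  have h5 := exists_int_of_isIntegral (((((isIntegral_natCast n).mul
    ((isIntegral_natCast δ').pow 2)).mul hα)).add hβ)
    (pow_ne_zero a (Int.natCast_ne_zero.2 hp.ne_zero)) h2
  have h6 : p ∣ n * δ' := by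
    have := (dvd_pow_self (p : ℤ) ha.ne').trans h5
    exact_mod_cast this
  rcases hp.dvd_mul.1 h6 with h7 | h7
  · exact hpn h7
  · exact hpδ h7

end Schur

section Adjoin

variable {K : Type w} [Field K] [CharZero K] {V : Type w} [AddCommGroup V] [Module K V]
  [FiniteDimensional K V] {G : Type*} [Group G] [Finite G]

/-- Irreducible representations of finite groups over a field of characteristic zero containing all
roots of unity have scalar endomorphisms. -/
theorem exists_smul_of_finite (hK : ContainsAllRootsOfUnity K) {ρ : G →* Module.End K V}
    (hρ : IsIrr ρ) {φ : Module.End K V} (hφ : ∀ g, Commute φ (ρ g)) : ∃ c : K, φ = c • 1 := by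
  classical
  let R : Subalgebra K (Module.End K V) := Algebra.adjoin K (Set.range ρ)
  have hcomm : ∀ ψ : Module.End K V, (∀ g, Commute ψ (ρ g)) → ∀ r ∈ R, Commute ψ r := by
    intro ψ hψ r hr
    induction hr using Algebra.adjoin_induction with
    | mem x hx =>
      obtain ⟨g, rfl⟩ := hx
      exact hψ g
    | algebraMap c => exact (Algebra.commutes c ψ).symm
    | add x y _ _ h1 h2 => exact h1.add_right h2
    | mul x y _ _ h1 h2 => exact h1.mul_right h2
  have := hρ.nontrivial
  have : IsSimpleModule R V := by
    rw [isSimpleModule_iff]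
    refine { eq_bot_or_eq_top := fun W => ?_ }
    have h1 := hρ.eq_bot_or_eq_top (W.restrictScalars K) fun g w hw =>
      W.smul_mem (⟨ρ g, Algebra.subset_adjoin ⟨g, rfl⟩⟩ : R) hw
    rwa [Submodule.restrictScalars_eq_bot_iff, Submodule.restrictScalars_eq_top_iff] at h1
  -- By Schur's lemma the commutant `D` is a division algebra. The representation is `D`-linear, and
  -- its self-intertwining maps are `D` again, so the preceding theorem gives `dim D = 1`.
  let D := Module.End R V
  let : DivisionRing D := inferInstanceAs (DivisionRing (Module.End R V))
  let : Algebra K D := inferInstanceAs (Algebra K (Module.End R V))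
  let mk : (ψ : Module.End K V) → (∀ g, Commute ψ (ρ g)) → D := fun ψ hψ =>
    { toFun := ψ
      map_add' := map_add ψ
      map_smul' := fun r v => LinearMap.congr_fun (hcomm ψ hψ r.1 r.2).eq v }
  have hinj : Function.Injective (LinearMap.restrictScalarsₗ K R V V K) :=
    LinearMap.restrictScalars_injective K
  have : FiniteDimensional K D := FiniteDimensional.of_injective _ hinj
  let ρD : G →* Module.End D V :=
    { toFun := fun g =>
        { toFun := ρ g
          map_add' := map_add (ρ g)
          map_smul' := fun d v =>
            (d.map_smul (⟨ρ g, Algebra.subset_adjoin ⟨g, rfl⟩⟩ : R) v).symm }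
      map_one' := LinearMap.ext fun v => LinearMap.congr_fun ρ.map_one v
      map_mul' := fun g h => LinearMap.ext fun v => LinearMap.congr_fun (ρ.map_mul g h) v }
  let e : Representation.IntertwiningMap (resRep K ρD) (resRep K ρD) ≃ₗ[K] D :=
    { toFun := fun ψ => mk ψ.toLinearMap fun g => ψ.isIntertwining' g
      invFun := fun d => ⟨d.restrictScalars K, fun g => LinearMap.ext fun v =>
        d.map_smul (⟨ρ g, Algebra.subset_adjoin ⟨g, rfl⟩⟩ : R) v⟩
      map_add' := fun _ _ => rfl
      map_smul' := fun _ _ => rfl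
      left_inv := fun _ => rfl
      right_inv := fun _ => rfl }
  have h1 := finrank_eq_one_of_intertwiningMap hK ρD e.finrank_eq
  obtain ⟨c, hc⟩ := (finrank_eq_one_iff_of_nonzero' (1 : D) one_ne_zero).1 h1 (mk φ hφ)
  exact ⟨c, LinearMap.ext fun v => (LinearMap.congr_fun hc v).symm⟩

end Adjoin

end TensorDecomposition

namespace TensorDecomposition

/-! ### Absolute simplicity over a field containing all roots of unity -/

section SplittingField

variable {C : Type u} [Category.{v} C] {K : Type w} [Field K]

/-- The endomorphisms of `x₀` induce a finite irreducible monoid on `S x₀`. An endomorphism `η` of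
`S` commutes with the projection found there, so it preserves its image, on which a finite group
acts irreducibly and `η` is a scalar. One nonzero vector then determines `η`. -/
lemma exists_smul_of_charZero [CharZero K] (hK : ContainsAllRootsOfUnity K)
    [∀ x y : C, Finite (x ⟶ y)] {S : C ⥤ ModuleCat.{w} K} (hS : Simple S) (hfd : FiniteDimValued S)
    (η : S ⟶ S) : ∃ c : K, c • 𝟙 S = η := by
  obtain ⟨x₀, hx₀⟩ := exists_nontrivial hS
  have := hfd x₀
  let E : Submonoid (Module.End K (S.obj x₀)) :=
    { carrier := Set.range fun f : x₀ ⟶ x₀ => (S.map f).hom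
      mul_mem' := by
        rintro _ _ ⟨f, rfl⟩ ⟨g, rfl⟩
        exact ⟨g ≫ f, congrArg ModuleCat.Hom.hom (S.map_comp g f)⟩
      one_mem' := ⟨𝟙 x₀, congrArg ModuleCat.Hom.hom (S.map_id x₀)⟩ }
  have hfin : Finite E := Set.finite_range fun f : x₀ ⟶ x₀ => (S.map f).hom
  obtain ⟨W, g, ⟨f, hf⟩, hgW, hg, hirr⟩ := exists_projection_of_finite_submonoid E (fun U hU => by
    by_cases h0 : U = ⊥
    · exact Or.inl h0
    · right
      obtain ⟨m, hm, hm0⟩ := Submodule.exists_mem_ne_zero_of_ne_bot h0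
      rw [eq_top_iff, ← span_map_eq_top hS hm0 x₀, Submodule.span_le]
      rintro _ ⟨f, rfl⟩
      exact hU _ ⟨f, rfl⟩ m hm)
  have hη : ∀ (f : x₀ ⟶ x₀) (m : S.obj x₀),
      (η.app x₀).hom ((S.map f).hom m) = (S.map f).hom ((η.app x₀).hom m) :=
    fun f m => NatTrans.naturality_apply η f m
  have hW : ∀ m ∈ W, (η.app x₀).hom m ∈ W := fun m hm => by
    have hf : (S.map f).hom = g := hf
    have h1 := hη f m
    rw [hf, hg m hm] at h1
    rw [h1, ← hgW]
    exact ⟨_, rfl⟩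
  obtain ⟨c, hc⟩ := exists_smul_of_finite hK hirr (φ := (η.app x₀).hom.restrict hW) (by
    rintro ⟨γ, e, ⟨f', rfl⟩, hγ⟩
    refine LinearMap.ext fun m => Subtype.ext ?_
    change (η.app x₀).hom (γ.1 m) = (γ.1 ⟨(η.app x₀).hom m, hW m m.2⟩ : W)
    rw [hγ, hγ, hη])
  have := hirr.nontrivial
  obtain ⟨m, hm⟩ := exists_ne (0 : W)
  refine ⟨c, natTrans_ext_of_simple hS (t := m.1) (fun h => hm (Subtype.ext h)) ?_⟩
  exact (congrArg Subtype.val (LinearMap.congr_fun hc m)).symm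

lemma isAbsolutelySimple_of_containsAllRootsOfUnity (hK : ContainsAllRootsOfUnity K)
    [∀ x y : C, Finite (x ⟶ y)] {S : C ⥤ ModuleCat.{w} K} (hS : Simple S)
    (hfd : FiniteDimValued S) : IsAbsolutelySimple S := by
  refine ⟨hS, fun c c' h => ?_, fun η => ?_⟩
  · obtain ⟨x, hx⟩ := exists_nontrivial hS
    obtain ⟨m, hm⟩ := exists_ne (0 : S.obj x)
    have h1 : c • m = c' • m := congrArg (fun η : S ⟶ S => (η.app x).hom m) h
    exact smul_left_injective K hm h1
  · obtain ⟨p, hp⟩ := CharP.exists K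
    rcases CharP.char_is_prime_or_zero K p with h | h
    · have := Fact.mk h
      exact exists_smul_of_charP p hK hS η
    · subst h
      have := CharP.charP_to_charZero K
      exact exists_smul_of_charZero hK hS hfd η

/-- A field containing all roots of unity is a splitting field of the quotients by cotrivial
ideals. -/
theorem isNonadditiveSplittingField_quot {A : Type u} [Category.{v} A] [Preadditive A]
    (hK : ContainsAllRootsOfUnity K) {I : CatIdeal A} (hI : I.IsCotrivial K) :
    IsNonadditiveSplittingField K I.Quot := by
  intro S hS hfd
  have : ∀ x y : I.Quot, Finite (x ⟶ y) := fun x y => by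
    have := (hI x.as y.as).1
    refine Finite.of_surjective (fun q : (x.as ⟶ y.as) ⧸ I.hom x.as y.as => I.proj.map q.out)
      fun f => ?_
    obtain ⟨f, rfl⟩ := I.proj.map_surjective f
    refine ⟨(f : (x.as ⟶ y.as) ⧸ I.hom x.as y.as), CategoryTheory.Quotient.sound _ ?_⟩
    change _ - f ∈ I.hom x.as y.as
    rw [← neg_sub, ← neg_add_eq_sub]
    exact (I.hom x.as y.as).neg_mem (QuotientAddGroup.eq.1 (QuotientAddGroup.out_eq' _))
  exact isAbsolutelySimple_of_containsAllRootsOfUnity hK hS hfd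

end SplittingField

end TensorDecomposition

theorem mainTheorem2 (A : Type u) [Category.{v} A] [Preadditive A] [HasFiniteBiproducts A]
    [EssentiallySmall.{w} A] (K : Type w) [Field K] :
    -- simple functors as diagonals of simple bifunctors (no assumption on the field)
    ((∀ F : A ⥤ ModuleCat.{w} K, TensorDecomposition.FiniteDimValued F →
        (Simple F ↔ ∃ B : A × A ⥤ ModuleCat.{w} K,
          Simple B ∧ TensorDecomposition.FiniteDimValued B ∧
          TensorDecomposition.IsAntipolynomialFst B ∧ TensorDecomposition.IsPolynomialSnd B ∧
          Nonempty (F ≅ Functor.diag A ⋙ B))) ∧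
      (∀ B B' : A × A ⥤ ModuleCat.{w} K,
        Simple B → TensorDecomposition.FiniteDimValued B →
        TensorDecomposition.IsAntipolynomialFst B → TensorDecomposition.IsPolynomialSnd B →
        Simple B' → TensorDecomposition.FiniteDimValued B' →
        TensorDecomposition.IsAntipolynomialFst B' → TensorDecomposition.IsPolynomialSnd B' →
        Nonempty (Functor.diag A ⋙ B ≅ Functor.diag A ⋙ B') → Nonempty (B ≅ B'))) ∧
    -- a field containing all roots of unity is big enough
    (TensorDecomposition.ContainsAllRootsOfUnity K →
      ∀ I : TensorDecomposition.CatIdeal A, I.IsCotrivial K →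
        TensorDecomposition.IsNonadditiveSplittingField K I.Quot) ∧
    -- the tensor decomposition over a field that is big enough
    ((∀ I : TensorDecomposition.CatIdeal A, I.IsCotrivial K →
        TensorDecomposition.IsNonadditiveSplittingField K I.Quot) →
      (∀ F : A ⥤ ModuleCat.{w} K, TensorDecomposition.FiniteDimValued F →
        (Simple F ↔ ∃ S T : A ⥤ ModuleCat.{w} K,
          (Simple S ∧ TensorDecomposition.IsPolynomial S ∧
            TensorDecomposition.FiniteDimValued S) ∧
          (Simple T ∧ TensorDecomposition.IsAntipolynomial T) ∧
          Nonempty (F ≅ S ⊗ T))) ∧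
      (∀ S S' T T' : A ⥤ ModuleCat.{w} K,
        Simple S → TensorDecomposition.IsPolynomial S → TensorDecomposition.FiniteDimValued S →
        Simple S' → TensorDecomposition.IsPolynomial S' →
        TensorDecomposition.FiniteDimValued S' →
        Simple T → TensorDecomposition.IsAntipolynomial T →
        Simple T' → TensorDecomposition.IsAntipolynomial T' →
        Nonempty (S ⊗ T ≅ S' ⊗ T') → Nonempty (S ≅ S') ∧ Nonempty (T ≅ T'))) := by
  have : HasBinaryBiproducts A := hasBinaryBiproducts_of_finite_biproducts A
  refine ⟨⟨fun F hF => TensorDecomposition.simple_iff_exists_bifunctor F hF,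
    fun B B' hB hBf hB1 hB2 hB' hBf' hB1' hB2' ⟨e⟩ => ?_⟩,
    fun hK I hI => TensorDecomposition.isNonadditiveSplittingField_quot hK hI,
    fun hK => ⟨fun F hF => TensorDecomposition.simple_iff_exists_tensor hK F hF,
      fun S S' T T' hS hS1 hSf hS' hS1' hSf' hT hT1 hT' hT1' ⟨e⟩ =>
        TensorDecomposition.nonempty_iso_of_tensor_iso hK hS hS1 hS' hS1' hT hT1 hT' hT1' e⟩⟩
  exact TensorDecomposition.nonempty_iso_of_diag_iso hB hB1 hB2 hB' hB1' hB2' e
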